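/- Let $\alpha\ge 1$ and let $\vec a\in\mathbb R^3$ be a unit vector. A compact $\alpha$-singular minimal surface (with density vector $\vec a$) is a smooth immersion $\phi:M\to\{p\in\mathbb R^3:\langle p,\vec a\rangle>0\}$ of a compact oriented smooth surface $M$ with boundary such that $$2H=\alpha\,\frac{\langle N,\vec a\rangle}{\langle\phi,\vec a\rangle}\quad\text{on } M,$$ where $N$ is the Gauss map and $H$ is the mean curvature (half the trace of the second fundamental form with respect to $N$). Let $\Gamma$ be a smooth regular closed curve, of length $L(\Gamma)$, and say that the surface has boundary $\Gamma$ if $\phi$ composed with a smooth parametrization of $\partial M$ (a single closed curve, traversed once) is a parametrization of $\Gamma$. **Proposition 3.1.** Let $\Gamma\subset\{p:\langle p,\vec a\rangle>0\}$ be a closed curve. The area $A(M)$, in the induced metric, of any compact $\alpha$-singular minimal surface with boundary $\Gamma$ satisfies $$A(M)\le L(\Gamma)\,\sup_{p\in\Gamma}\langle p,\vec a\rangle .$$ Consequently, let $\Gamma$ be a simple closed curve contained in the plane $\Pi$ of equation $\langle p,\vec a\rangle=c>0$, and let $\Omega\subset\Pi$ be the domain bounded by $\Gamma$, i.e. the bounded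 connected component of $\Pi\setminus\Gamma$, with area $|\Omega|$. If there exists a compact $\alpha$-singular minimal surface with boundary $\Gamma$, then $$|\Omega|\le c\,L(\Gamma).$$ -/

import Mathlib

open Set MeasureTheory
open scoped Manifold ContDiff RealInnerProductSpace

/-- The Euclidean plane, in which the charts of a surface take their values. -/
abbrev E2 : Type := EuclideanSpace ℝ (Fin 2)

/-- Euclidean three-space. -/
abbrev E3 : Type := EuclideanSpace ℝ (Fin 3)

/-! ### Surfaces with boundary, immersed in three-space

A surface is a smooth manifold with boundary modelled on the half-plane `EuclideanHalfSpace 2`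
(model with corners `𝓡∂ 2`), and it sits in space by a map `φ : M → E3`. Derivatives in a chart are
taken within `range (𝓡∂ 2)`, i.e. within the closed half-plane, so that they are one-sided at
boundary points and ordinary derivatives at interior points. -/

section Surface

variable {M : Type*} [TopologicalSpace M] [ChartedSpace (EuclideanHalfSpace 2) M]

/-- The local parametrization of the surface given by the chart at `x`. -/
noncomputable def localParam (φ : M → E3) (x : M) : E2 → E3 :=
  φ ∘ (extChartAt (𝓡∂ 2) x).symm

/-- The partial derivative `∂ψ / ∂uᵢ` of a map defined on the closed half-plane. -/
noncomputable def partialD (i : Fin 2) (ψ : E2 → E3) (y : E2) : E3 :=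
  fderivWithin ℝ ψ (range (𝓡∂ 2)) y (EuclideanSpace.single i 1)

/-- The coefficients `g i j = ⟪ψ_i, ψ_j⟫` of the first fundamental form. -/
noncomputable def firstForm (ψ : E2 → E3) (y : E2) (i j : Fin 2) : ℝ :=
  ⟪partialD i ψ y, partialD j ψ y⟫

/-- The coefficients `h i j = ⟪ψ_ij, n⟫` of the second fundamental form with respect to the
normal vector `n`. -/
noncomputable def secondForm (ψ : E2 → E3) (n : E3) (y : E2) (i j : Fin 2) : ℝ :=
  ⟪partialD j (partialD i ψ) y, n⟫

/-- The determinant `EG - F²` of the first fundamental form. -/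
noncomputable def firstFormDet (ψ : E2 → E3) (y : E2) : ℝ :=
  firstForm ψ y 0 0 * firstForm ψ y 1 1 - firstForm ψ y 0 1 ^ 2

/-- The mean curvature (half the sum of the principal curvatures) of a parametrized surface with
respect to the normal vector `n`: `H = (eG - 2fF + gE) / (2(EG - F²))`. -/
noncomputable def paramMeanCurvature (ψ : E2 → E3) (n : E3) (y : E2) : ℝ :=
  (secondForm ψ n y 0 0 * firstForm ψ y 1 1 - 2 * secondForm ψ n y 0 1 * firstForm ψ y 0 1
    + secondForm ψ n y 1 1 * firstForm ψ y 0 0) / (2 * firstFormDet ψ y)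

/-- The mean curvature at `p` of the surface with Gauss map `N`, computed in the chart at `x`. It
does not depend on the chart, as long as `p` lies in the domain of that chart. -/
noncomputable def meanCurvature (φ : M → E3) (N : M → E3) (x p : M) : ℝ :=
  paramMeanCurvature (localParam φ x) (N p) (extChartAt (𝓡∂ 2) x p)

/-- `φ` is a smooth immersion (up to and including the boundary). -/
structure IsSmoothImmersion (φ : M → E3) : Prop where
  smooth : ContMDiff (𝓡∂ 2) 𝓘(ℝ, E3) ∞ φ
  injective_mfderiv : ∀ p : M, Function.Injective (mfderiv (𝓡∂ 2) 𝓘(ℝ, E3) φ p)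

/-- `N` is a Gauss map of the immersion `φ`, i.e. a continuous unit normal vector field along `φ`.
Choosing one is the same as choosing an orientation of the surface. -/
structure IsGaussMap (φ : M → E3) (N : M → E3) : Prop where
  continuous : Continuous N
  norm_eq_one : ∀ p : M, ‖N p‖ = 1
  normal : ∀ (p : M) (v : TangentSpace (𝓡∂ 2) p),
    ⟪N p, (mfderiv (𝓡∂ 2) 𝓘(ℝ, E3) φ p v : E3)⟫ = 0

/-- `φ : M → E3` is an `α`-singular minimal surface with density vector `a`: a smooth immersion of
an oriented surface into the open half-space `⟪q, a⟫ > 0` such that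
`2H = α ⟪N, a⟫ / ⟪φ, a⟫` on `M`. -/
structure IsSingularMinimal (α : ℝ) (a : E3) (φ : M → E3) : Prop where
  immersion : IsSmoothImmersion φ
  inner_pos : ∀ p : M, 0 < ⟪φ p, a⟫
  equation : ∃ N : M → E3, IsGaussMap φ N ∧
    ∀ x : M, ∀ p ∈ (chartAt (EuclideanHalfSpace 2) x).source,
      2 * meanCurvature φ N x p = α * (⟪N p, a⟫ / ⟪φ p, a⟫)

/-- The area measure of the immersed surface, i.e. the measure on `M` of the induced metric. In the
domain of the chart at `x` it is `√(EG - F²) du dv`; these local measures agree on overlaps, and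
the smallest measure that dominates all of them is the one obtained by gluing them. -/
noncomputable def areaMeasure [MeasurableSpace M] (φ : M → E3) : Measure M :=
  ⨆ x : M, Measure.map (extChartAt (𝓡∂ 2) x).symm
    ((volume.restrict (extChartAt (𝓡∂ 2) x).target).withDensity
      fun y => ENNReal.ofReal (Real.sqrt (firstFormDet (localParam φ x) y)))

/-- The total area `A(M)` of the immersed surface. -/
noncomputable def surfaceArea [MeasurableSpace M] (φ : M → E3) : ENNReal :=
  areaMeasure φ univ

/-- The immersed surface `φ : M → E3` has the closed curve `γ` as its boundary: there is a smooth
parametrization `β` of the boundary of `M`, injective on a period, such that `γ = φ ∘ β`. -/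
def HasBoundaryCurve (φ : M → E3) (γ : ℝ → E3) : Prop :=
  ∃ β : ℝ → M, ContMDiff 𝓘(ℝ, ℝ) (𝓡∂ 2) ∞ β ∧ Function.Periodic β 1 ∧
    InjOn β (Ico 0 1) ∧ range β = (𝓡∂ 2).boundary M ∧ ∀ t, φ (β t) = γ t

end Surface

/-! ### Closed curves and planar domains -/

/-- A (smooth, regular) closed curve in space, parametrized with period `1`. -/
structure IsClosedCurve (γ : ℝ → E3) : Prop where
  smooth : ContDiff ℝ ∞ γ
  periodic : Function.Periodic γ 1
  deriv_ne_zero : ∀ t, deriv γ t ≠ 0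

/-- The length of a closed curve of period `1`. -/
noncomputable def curveLength (γ : ℝ → E3) : ℝ :=
  ∫ t in (0 : ℝ)..1, ‖deriv γ t‖

/-- The plane `⟪q, a⟫ = c`. -/
def heightPlane (a : E3) (c : ℝ) : Set E3 := {q | ⟪q, a⟫ = c}

/-- `Ω` is the domain bounded by the simple closed curve with trace `Γ` in the plane `P`, i.e. the
bounded connected component of `P \ Γ`. -/
def IsDomainBoundedBy (P Γ Ω : Set E3) : Prop :=
  Bornology.IsBounded Ω ∧ ∃ q ∈ P \ Γ, Ω = connectedComponentIn (P \ Γ) q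

/-!
# The area of a compact singular minimal surface

*The area bound.* Let `h = ⟪φ, a⟫` be the height function on the surface. On a surface in space
`Δh = 2H ⟪N, a⟫` and `|∇h|² = 1 - ⟪N, a⟫²`, so that the equation `2H = α ⟪N, a⟫ / h` gives

  `div (h ∇h) = |∇h|² + h Δh = 1 + (α - 1) ⟪N, a⟫² ≥ 1`.

By the divergence theorem the area is at most the flux of `h ∇h` through the boundary, hence at most
`∫ h ds ≤ L(Γ) sup_Γ h`. The divergence theorem takes the form of Stokes' theorem for the `1`-form
`⟪V, dφ⟫` of a field `V : M → E3` along the surface, with `V = h N × a`: the quotient of its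
differential by the area form is `surfaceCurl`, which is the divergence above for this `V`
(`IsGaussMap.surfaceCurl_heightField`). Stokes' theorem (`IsGaussMap.exists_stokes`) is reduced by a
partition of unity to Green's formula in the half-plane (`integral_halfPlane_green`). The boundary
curve comes with no orientation: by connectedness its tangent makes a constant sign `ε` with the
orientation given by `N`, and the formula holds up to that sign, which is harmless.

*Planar boundary.* The orthogonal projection of the surface to the plane of `Γ` covers the domain
`Ω` bounded by `Γ`. Indeed, if it missed a point `w ∈ Ω`, the pullback of the angular form
`Im (dζ / (ζ - w))` would be a closed `1`-form on the surface, and Stokes' theorem would make the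
winding number of `Γ` around `w` vanish (`cauchyIntegral_im_eq_zero`). However, the winding number
of a simple closed curve is nonzero around every point of a bounded component of the complement
(`IsJordanCurve.cauchyIntegral_im_ne_zero`): it vanishes far away, it jumps by one across the curve,
and every component of the complement contains one of the two thin strips along the two sides of the
curve. As a projection does not increase area (`volume_image_le_surfaceArea`), `|Ω| ≤ A(M)`, and the
area bound applies with height `c` on `Γ`.
-/

/-! ### Linear algebra in the plane and in space -/

theorem inner_E3 (u v : E3) : ⟪u, v⟫ = u 0 * v 0 + u 1 * v 1 + u 2 * v 2 := by
  simp [PiLp.inner_apply, Fin.sum_univ_three, mul_comm]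

/-- The cross product of `E3`, as a continuous bilinear map. -/
noncomputable def cross3 : E3 →L[ℝ] E3 →L[ℝ] E3 :=
  LinearMap.toContinuousLinearMap
    (LinearMap.toContinuousLinearMap.toLinearMap ∘ₗ
      LinearMap.mk₂ ℝ
        (fun u v : E3 => (!₂[u 1 * v 2 - u 2 * v 1, u 2 * v 0 - u 0 * v 2,
          u 0 * v 1 - u 1 * v 0] : E3))
        (fun u u' v => by ext i; fin_cases i <;> simp <;> ring)
        (fun c u v => by ext i; fin_cases i <;> simp <;> ring)
        (fun u v v' => by ext i; fin_cases i <;> simp <;> ring)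
        (fun c u v => by ext i; fin_cases i <;> simp <;> ring))

theorem cross3_apply (u v : E3) : cross3 u v = (!₂[u 1 * v 2 - u 2 * v 1, u 2 * v 0 - u 0 * v 2,
    u 0 * v 1 - u 1 * v 0] : E3) := rfl

/-- The triple product `det (u, v, w)`. -/
noncomputable def triple (u v w : E3) : ℝ := ⟪cross3 u v, w⟫

theorem triple_eq (u v w : E3) : triple u v w =
    (u 1 * v 2 - u 2 * v 1) * w 0 + (u 2 * v 0 - u 0 * v 2) * w 1
      + (u 0 * v 1 - u 1 * v 0) * w 2 := by
  rw [triple, inner_E3, cross3_apply]; simp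

theorem triple_eq_inner_cross3 (n u v : E3) : triple n u v = ⟪n, cross3 u v⟫ := by
  rw [triple_eq, inner_E3, cross3_apply]; simp; ring

theorem ContinuousAt.triple {X : Type*} [TopologicalSpace X] {f g h : X → E3} {x : X}
    (hf : ContinuousAt f x) (hg : ContinuousAt g x) (hh : ContinuousAt h x) :
    ContinuousAt (fun y => _root_.triple (f y) (g y) (h y)) x := by
  simp only [triple_eq]
  fun_prop

/-- The product of two determinants is the determinant of the mutual inner products. -/
theorem triple_mul_triple (u v w x y z : E3) : triple u v w * triple x y z =
    ⟪u, x⟫ * (⟪v, y⟫ * ⟪w, z⟫ - ⟪v, z⟫ * ⟪w, y⟫)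
      - ⟪u, y⟫ * (⟪v, x⟫ * ⟪w, z⟫ - ⟪v, z⟫ * ⟪w, x⟫)
      + ⟪u, z⟫ * (⟪v, x⟫ * ⟪w, y⟫ - ⟪v, y⟫ * ⟪w, x⟫) := by
  simp only [triple_eq, inner_E3]; ring

theorem triple_sq {n u v : E3} (hn : ⟪n, n⟫ = 1) (hu : ⟪n, u⟫ = 0) (hv : ⟪n, v⟫ = 0) :
    triple n u v ^ 2 = ⟪u, u⟫ * ⟪v, v⟫ - ⟪u, v⟫ ^ 2 := by
  rw [sq, triple_mul_triple, hn, hu, hv, real_inner_comm u v]; ring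

theorem abs_triple_le (u v w : E3) (hu : ‖u‖ = 1) (hv : ‖v‖ = 1) : |triple u v w| ≤ ‖w‖ := by
  have h1 : ‖cross3 u v‖ ≤ 1 := by
    have : ‖cross3 u v‖ ^ 2 = 1 - ⟪u, v⟫ ^ 2 := by
      have h2 : ‖cross3 u v‖ ^ 2 = ⟪u, u⟫ * ⟪v, v⟫ - ⟪u, v⟫ ^ 2 := by
        rw [← real_inner_self_eq_norm_sq]
        simp only [inner_E3, cross3_apply]; simp; ring
      rw [h2, real_inner_self_eq_norm_sq, real_inner_self_eq_norm_sq, hu, hv]; ring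
    nlinarith [norm_nonneg (cross3 u v), sq_nonneg ⟪u, v⟫]
  calc |triple u v w| ≤ ‖cross3 u v‖ * ‖w‖ := abs_real_inner_le_norm _ _
    _ ≤ 1 * ‖w‖ := by gcongr
    _ = ‖w‖ := one_mul _

/-- The determinant of two tangent vectors with a unit vector `a` that need not be normal to them is
at most the area of the parallelogram that they span. -/
theorem triple_sq_le {a : E3} (u v : E3) (ha : ‖a‖ = 1) :
    triple a u v ^ 2 ≤ ⟪u, u⟫ * ⟪v, v⟫ - ⟪u, v⟫ ^ 2 := by
  have h2 : ‖cross3 u v‖ ^ 2 = ⟪u, u⟫ * ⟪v, v⟫ - ⟪u, v⟫ ^ 2 := by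
    rw [← real_inner_self_eq_norm_sq]
    simp only [inner_E3, cross3_apply]; simp; ring
  rw [triple_eq_inner_cross3, ← h2, ← sq_abs]
  have := abs_real_inner_le_norm a (cross3 u v)
  rw [ha, one_mul] at this
  gcongr

theorem triple_smul_right (n u v : E3) (c : ℝ) : triple n u (c • v) = c * triple n u v := by
  simp only [triple_eq, PiLp.smul_apply, smul_eq_mul]; ring

/-- The algebra behind `div (h ∇h) = 1 + (α - 1) ⟪N, a⟫²`: here `u`, `v` span the tangent plane,
`n` is the normal vector, `n'`, `n''` are its derivatives along `u` and `v`, and `eh`, `fh`, `gh`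
are the coefficients of the second fundamental form. -/
theorem curl_height_algebra {n u v n' n'' a : E3} {h α eh fh gh : ℝ} (ha : ⟪a, a⟫ = 1)
    (hn : ⟪n, n⟫ = 1) (hu : ⟪n, u⟫ = 0) (hv : ⟪n, v⟫ = 0) (hn' : ⟪n, n'⟫ = 0) (hn'' : ⟪n, n''⟫ = 0)
    (he : ⟪n', u⟫ = -eh) (hf : ⟪n', v⟫ = -fh) (hf' : ⟪n'', u⟫ = -fh) (hg : ⟪n'', v⟫ = -gh)
    (hJ : triple n u v ≠ 0) (hh : h ≠ 0)
    (hH : 2 * ((eh * ⟪v, v⟫ - 2 * fh * ⟪u, v⟫ + gh * ⟪u, u⟫) /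
      (2 * (⟪u, u⟫ * ⟪v, v⟫ - ⟪u, v⟫ ^ 2))) = α * (⟪n, a⟫ / h)) :
    ⟪u, a⟫ * triple n a v - ⟪v, a⟫ * triple n a u + h * (triple n' a v - triple n'' a u)
      = (1 + (α - 1) * ⟪n, a⟫ ^ 2) * triple n u v := by
  have hJ2 := triple_sq hn hu hv
  have hD : ⟪u, u⟫ * ⟪v, v⟫ - ⟪u, v⟫ ^ 2 ≠ 0 := by rw [← hJ2]; exact pow_ne_zero 2 hJ
  have hvu : ⟪v, u⟫ = ⟪u, v⟫ := real_inner_comm _ _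
  have hun : ⟪u, n⟫ = 0 := by rw [real_inner_comm, hu]
  have hvn : ⟪v, n⟫ = 0 := by rw [real_inner_comm, hv]
  have h1 : triple n u v * triple n a v = ⟪u, a⟫ * ⟪v, v⟫ - ⟪v, a⟫ * ⟪u, v⟫ := by
    rw [triple_mul_triple, hn, hv, hun, hvn]; ring
  have h2 : triple n u v * triple n a u = ⟪u, a⟫ * ⟪u, v⟫ - ⟪v, a⟫ * ⟪u, u⟫ := by
    rw [triple_mul_triple, hn, hu, hun, hvn, hvu]; ring
  have h3 : triple n u v * triple n' a v = ⟪n, a⟫ * (eh * ⟪v, v⟫ - fh * ⟪u, v⟫) := by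
    rw [triple_mul_triple, hn', hv, real_inner_comm n' u, real_inner_comm n' v, he, hf]; ring
  have h4 : triple n u v * triple n'' a u = ⟪n, a⟫ * (fh * ⟪u, v⟫ - gh * ⟪u, u⟫) := by
    rw [triple_mul_triple, hn'', hu, real_inner_comm n'' u, real_inner_comm n'' v, hf', hg, hvu]
    ring
  have h5 : triple a u v * triple n u v = ⟪n, a⟫ * (⟪u, u⟫ * ⟪v, v⟫ - ⟪u, v⟫ ^ 2) := by
    rw [triple_mul_triple, hun, hvn, real_inner_comm n a, hvu]; ring
  have h6 : triple a u v * triple a u v = (⟪u, u⟫ * ⟪v, v⟫ - ⟪u, v⟫ ^ 2)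
      - (⟪u, a⟫ ^ 2 * ⟪v, v⟫ - 2 * ⟪u, v⟫ * ⟪u, a⟫ * ⟪v, a⟫ + ⟪v, a⟫ ^ 2 * ⟪u, u⟫) := by
    rw [triple_mul_triple, ha, real_inner_comm u a, real_inner_comm v a, hvu]; ring
  -- the tangential part of `a` has squared length `1 - ⟪n, a⟫²`
  have h7 : ⟪u, a⟫ ^ 2 * ⟪v, v⟫ - 2 * ⟪u, v⟫ * ⟪u, a⟫ * ⟪v, a⟫ + ⟪v, a⟫ ^ 2 * ⟪u, u⟫
      = (⟪u, u⟫ * ⟪v, v⟫ - ⟪u, v⟫ ^ 2) * (1 - ⟪n, a⟫ ^ 2) := by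
    have h8 : (triple a u v * triple a u v) * (triple n u v) ^ 2
        = ⟪n, a⟫ ^ 2 * (⟪u, u⟫ * ⟪v, v⟫ - ⟪u, v⟫ ^ 2) ^ 2 := by
      rw [← mul_pow, ← h5]; ring
    rw [hJ2] at h8
    have h9 : triple a u v * triple a u v = ⟪n, a⟫ ^ 2 * (⟪u, u⟫ * ⟪v, v⟫ - ⟪u, v⟫ ^ 2) :=
      mul_right_cancel₀ hD (by rw [h8]; ring)
    linear_combination h6 - h9
  have h10 : (eh * ⟪v, v⟫ - 2 * fh * ⟪u, v⟫ + gh * ⟪u, u⟫) * h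
      = α * ⟪n, a⟫ * (⟪u, u⟫ * ⟪v, v⟫ - ⟪u, v⟫ ^ 2) := by
    generalize ⟪u, u⟫ * ⟪v, v⟫ - ⟪u, v⟫ ^ 2 = D at hD hH ⊢
    field_simp at hH
    linear_combination hH
  apply mul_left_cancel₀ hJ
  linear_combination ⟪u, a⟫ * h1 - ⟪v, a⟫ * h2 + h * h3 - h * h4 + h7 + ⟪n, a⟫ * h10
    - (1 + (α - 1) * ⟪n, a⟫ ^ 2) * hJ2

/-- The first coordinate vector of the plane; at boundary points of the half-plane it points
inwards. -/
noncomputable abbrev e0 : E2 := EuclideanSpace.single 0 1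

/-- The second coordinate vector of the plane; it spans the boundary of the half-plane. -/
noncomputable abbrev e1 : E2 := EuclideanSpace.single 1 1

theorem E2_eq (y : E2) : y = y 0 • e0 + y 1 • e1 := by
  ext i; fin_cases i <;> simp [e0, e1]

theorem clm_E2_apply {F : Type*} [NormedAddCommGroup F] [NormedSpace ℝ F] (L : E2 →L[ℝ] F)
    (y : E2) : L y = y 0 • L e0 + y 1 • L e1 := by
  conv_lhs => rw [E2_eq y]
  simp

theorem det_E2 (T : E2 →L[ℝ] E2) : T.det = (T e0) 0 * (T e1) 1 - (T e1) 0 * (T e0) 1 := by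
  rw [ContinuousLinearMap.det, ← LinearMap.det_toMatrix (EuclideanSpace.basisFun (Fin 2) ℝ).toBasis,
    Matrix.det_fin_two]
  simp [LinearMap.toMatrix_apply, e0, e1]

theorem bilin_comp_E2 {F G : Type*} [NormedAddCommGroup F] [NormedSpace ℝ F] [NormedAddCommGroup G]
    [NormedSpace ℝ G] (b : F →L[ℝ] G →L[ℝ] ℝ) (K : E2 →L[ℝ] F) (L : E2 →L[ℝ] G) (T : E2 →L[ℝ] E2) :
    b (K (T e0)) (L (T e1)) - b (K (T e1)) (L (T e0))
      = T.det * (b (K e0) (L e1) - b (K e1) (L e0)) := by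
  rw [det_E2, clm_E2_apply K (T e0), clm_E2_apply K (T e1), clm_E2_apply L (T e0),
    clm_E2_apply L (T e1)]
  simp only [map_add, map_smul, add_apply, smul_apply,
    smul_eq_mul]
  ring

/-! ### Green's theorem in the half-plane -/

/-- The closed half-plane `y 0 ≥ 0`, as the range of the model with corners. -/
abbrev halfPlane : Set E2 := range (𝓡∂ 2)

theorem mem_halfPlane {y : E2} : y ∈ halfPlane ↔ 0 ≤ y 0 := by
  rw [halfPlane, range_modelWithCornersEuclideanHalfSpace]; rfl

theorem isClosed_halfPlane : IsClosed halfPlane := (𝓡∂ 2).isClosed_range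

theorem halfPlane_mem_nhds {y : E2} (hy : 0 < y 0) : halfPlane ∈ nhds y := by
  rw [mem_nhds_iff]
  refine ⟨{z | 0 < z 0}, fun z hz => mem_halfPlane.2 (le_of_lt hz), ?_, hy⟩
  exact isOpen_lt continuous_const (by fun_prop)

/-- The point of the plane with given coordinates. -/
noncomputable def planePt (u v : ℝ) : E2 := u • e0 + v • e1

@[simp] theorem planePt_zero (u v : ℝ) : planePt u v 0 = u := by simp [planePt, e0, e1]
@[simp] theorem planePt_one (u v : ℝ) : planePt u v 1 = v := by simp [planePt, e0, e1]

theorem planePt_eta (y : E2) : planePt (y 0) (y 1) = y := (E2_eq y).symm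

theorem continuous_planePt : Continuous fun p : ℝ × ℝ => planePt p.1 p.2 := by
  unfold planePt; fun_prop

/-- The identification of `ℝ × ℝ` with the Euclidean plane. -/
noncomputable def planeEquiv : ℝ × ℝ ≃ᵐ E2 :=
  MeasurableEquiv.finTwoArrow.symm.trans (MeasurableEquiv.toLp 2 (Fin 2 → ℝ))

theorem planeEquiv_apply (p : ℝ × ℝ) : planeEquiv p = planePt p.1 p.2 := by
  ext i; fin_cases i <;> simp [planeEquiv, planePt, e0, e1]

theorem measurePreserving_planeEquiv : MeasurePreserving planeEquiv :=
  ((volume_preserving_finTwoArrow ℝ).symm).trans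
    (EuclideanSpace.volume_preserving_symm_measurableEquiv_toLp (Fin 2)).symm

theorem hasDerivAt_planePt_left {F : E2 → ℝ} {u v : ℝ} (hu : 0 < u)
    (hF : DifferentiableWithinAt ℝ F halfPlane (planePt u v)) :
    HasDerivAt (fun s => F (planePt s v)) (fderivWithin ℝ F halfPlane (planePt u v) e0) u := by
  have h := hF.hasFDerivWithinAt.hasFDerivAt (halfPlane_mem_nhds (by simpa using hu))
  have h2 : HasDerivAt (fun s : ℝ => planePt s v) e0 u := by
    simpa [planePt] using ((hasDerivAt_id u).smul_const e0).add_const (v • e1)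
  exact h.comp_hasDerivAt u h2

theorem hasDerivAt_planePt_right {F : E2 → ℝ} {u v : ℝ} (hu : 0 < u)
    (hF : DifferentiableWithinAt ℝ F halfPlane (planePt u v)) :
    HasDerivAt (fun s => F (planePt u s)) (fderivWithin ℝ F halfPlane (planePt u v) e1) v := by
  have h := hF.hasFDerivWithinAt.hasFDerivAt (halfPlane_mem_nhds (by simpa using hu))
  have h2 : HasDerivAt (fun s : ℝ => planePt u s) e1 v := by
    simpa [planePt] using ((hasDerivAt_id v).smul_const e1).const_add (u • e0)
  exact h.comp_hasDerivAt v h2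

theorem setIntegral_halfPlane (f : E2 → ℝ) :
    ∫ y in halfPlane, f y = ∫ p in Ici (0 : ℝ) ×ˢ (univ : Set ℝ), f (planePt p.1 p.2) := by
  rw [← measurePreserving_planeEquiv.setIntegral_preimage_emb planeEquiv.measurableEmbedding]
  have : planeEquiv ⁻¹' halfPlane = Ici (0 : ℝ) ×ˢ (univ : Set ℝ) := by
    ext p
    rw [mem_preimage, planeEquiv_apply, mem_halfPlane]
    simp
  rw [this]
  simp only [planeEquiv_apply]

theorem integrableOn_halfPlane {f : E2 → ℝ} (hf : IntegrableOn f halfPlane) :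
    Integrable (fun p : ℝ × ℝ => f (planePt p.1 p.2))
      ((volume.restrict (Ici (0 : ℝ))).prod (volume : Measure ℝ)) := by
  have h := (measurePreserving_planeEquiv.restrict_preimage_emb planeEquiv.measurableEmbedding
    halfPlane).integrable_comp_emb planeEquiv.measurableEmbedding (g := f)
  have h2 : planeEquiv ⁻¹' halfPlane = Ici (0 : ℝ) ×ˢ (univ : Set ℝ) := by
    ext p
    rw [mem_preimage, planeEquiv_apply, mem_halfPlane]
    simp
  rw [h2, Measure.volume_eq_prod, ← Measure.prod_restrict, Measure.restrict_univ] at h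
  refine (h.2 hf).congr (Filter.Eventually.of_forall fun p => ?_)
  simp only [Function.comp, planeEquiv_apply]

section Green

variable {F : E2 → ℝ} {K : Set E2}

theorem fderivWithin_eq_zero_of_notMem (hK : IsCompact K) (hF0 : ∀ y ∈ halfPlane, y ∉ K → F y = 0)
    {y : E2} (hy : y ∈ halfPlane) (hyK : y ∉ K) : fderivWithin ℝ F halfPlane y = 0 := by
  have h : F =ᶠ[nhdsWithin y halfPlane] fun _ => 0 := by
    filter_upwards [self_mem_nhdsWithin,
      mem_nhdsWithin_of_mem_nhds (hK.isClosed.isOpen_compl.mem_nhds hyK)]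
      with z hz hzK using hF0 z hz hzK
  rw [h.fderivWithin_eq (hF0 y hy hyK)]
  simp

theorem continuousOn_integrableOn_halfPlane {f : E2 → ℝ} (hf : ContinuousOn f halfPlane)
    (hK : IsCompact K) (h0 : ∀ y ∈ halfPlane, y ∉ K → f y = 0) : IntegrableOn f halfPlane := by
  refine IntegrableOn.of_forall_sdiff_eq_zero (s := K ∩ halfPlane) ?_
    isClosed_halfPlane.measurableSet
    fun y hy => h0 y hy.1 fun h => hy.2 ⟨h, hy.1⟩
  exact (hf.mono inter_subset_right).integrableOn_compact (hK.inter_right isClosed_halfPlane)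

theorem continuousOn_fderivWithin_apply (hF : ContDiffOn ℝ 1 F halfPlane) (e : E2) :
    ContinuousOn (fun y => fderivWithin ℝ F halfPlane y e) halfPlane :=
  (hF.continuousOn_fderivWithin (𝓡∂ 2).uniqueDiffOn le_rfl).clm_apply continuousOn_const

theorem integrableOn_fderivWithin_apply (hF : ContDiffOn ℝ 1 F halfPlane) (hK : IsCompact K)
    (hF0 : ∀ y ∈ halfPlane, y ∉ K → F y = 0) (e : E2) :
    IntegrableOn (fun y => fderivWithin ℝ F halfPlane y e) halfPlane :=
  continuousOn_integrableOn_halfPlane (continuousOn_fderivWithin_apply hF e) hK fun y hy hyK => by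
    rw [fderivWithin_eq_zero_of_notMem hK hF0 hy hyK]; rfl

theorem exists_bound_planePt (hK : IsCompact K) :
    ∃ B, 0 < B ∧ ∀ u v : ℝ, B < |u| ∨ B < |v| → planePt u v ∉ K := by
  obtain ⟨B, hB⟩ := hK.isBounded.exists_norm_le
  refine ⟨max B 1, by positivity, fun u v h hm => ?_⟩
  have hn := hB _ hm
  have h0 := PiLp.norm_apply_le (planePt u v) 0
  have h1 := PiLp.norm_apply_le (planePt u v) 1
  simp only [planePt_zero, planePt_one, Real.norm_eq_abs] at h0 h1
  have := le_max_left B 1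
  rcases h with h | h <;> linarith

theorem integral_halfPlane_deriv_right (hF : ContDiffOn ℝ 1 F halfPlane) (hK : IsCompact K)
    (hF0 : ∀ y ∈ halfPlane, y ∉ K → F y = 0) :
    ∫ y in halfPlane, fderivWithin ℝ F halfPlane y e1 = 0 := by
  obtain ⟨B, hB, hBK⟩ := exists_bound_planePt hK
  have hi := integrableOn_halfPlane (integrableOn_fderivWithin_apply hF hK hF0 e1)
  rw [setIntegral_halfPlane, Measure.volume_eq_prod, ← Measure.prod_restrict, Measure.restrict_univ,
    integral_prod _ hi, integral_Ici_eq_integral_Ioi]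
  refine setIntegral_eq_zero_of_forall_eq_zero fun u hu => ?_
  have hu' : (0 : ℝ) < u := hu
  have hmem : ∀ v, planePt u v ∈ halfPlane := fun v => mem_halfPlane.2 (by simpa using hu'.le)
  have hcont : ∀ {f : E2 → ℝ}, ContinuousOn f halfPlane →
      (∀ y ∈ halfPlane, y ∉ K → f y = 0) → Integrable fun v => f (planePt u v) := by
    intro f hf h0
    refine Continuous.integrable_of_hasCompactSupport ?_ ?_
    · exact hf.comp_continuous
        (continuous_planePt.comp (by fun_prop : Continuous fun v : ℝ => (u, v)))
        hmem
    · refine HasCompactSupport.intro (isCompact_Icc (a := -B) (b := B)) fun v hv => ?_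
      refine h0 _ (hmem v) (hBK u v (Or.inr ?_))
      rw [lt_abs]
      by_contra! h
      exact hv ⟨by linarith, by linarith⟩
  refine integral_eq_zero_of_hasDerivAt_of_integrable (f := fun v => F (planePt u v))
    (fun v => hasDerivAt_planePt_right hu' ((hF.differentiableOn one_ne_zero) _ (hmem v))) ?_ ?_
  · exact hcont (continuousOn_fderivWithin_apply hF e1) fun y hy hyK => by
      rw [fderivWithin_eq_zero_of_notMem hK hF0 hy hyK]; rfl
  · exact hcont hF.continuousOn hF0

theorem integral_halfPlane_deriv_left (hF : ContDiffOn ℝ 1 F halfPlane) (hK : IsCompact K)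
    (hF0 : ∀ y ∈ halfPlane, y ∉ K → F y = 0) :
    ∫ y in halfPlane, fderivWithin ℝ F halfPlane y e0 = -∫ v : ℝ, F (planePt 0 v) := by
  obtain ⟨B, hB, hBK⟩ := exists_bound_planePt hK
  have hi := integrableOn_halfPlane (integrableOn_fderivWithin_apply hF hK hF0 e0)
  rw [setIntegral_halfPlane, Measure.volume_eq_prod, ← Measure.prod_restrict, Measure.restrict_univ,
    integral_prod_symm _ hi, ← integral_neg]
  refine integral_congr_ae (Filter.Eventually.of_forall fun v => ?_)
  simp only
  rw [integral_Ici_eq_integral_Ioi]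
  have hmaps : MapsTo (fun u => planePt u v) (Ici 0) halfPlane :=
    fun u hu => mem_halfPlane.2 (by simpa using hu)
  have hline : Continuous fun u => planePt u v :=
    continuous_planePt.comp (by fun_prop : Continuous fun u : ℝ => (u, v))
  have h := integral_Ioi_of_hasDerivAt_of_tendsto (a := 0) (m := 0) (f := fun u => F (planePt u v))
    (f' := fun u => fderivWithin ℝ F halfPlane (planePt u v) e0)
    ((hF.continuousOn.comp hline.continuousOn hmaps) 0 self_mem_Ici)
    (fun u hu => hasDerivAt_planePt_left hu
      ((hF.differentiableOn one_ne_zero) _ (hmaps (mem_Ici.2 (le_of_lt hu)))))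
    ?_ ?_
  · rw [h, zero_sub]
  · refine IntegrableOn.of_forall_sdiff_eq_zero (s := Icc 0 B) ?_ measurableSet_Ioi fun u hu => ?_
    · exact (((continuousOn_fderivWithin_apply hF e0).comp hline.continuousOn hmaps).mono
        Icc_subset_Ici_self).integrableOn_compact isCompact_Icc
    · have hu0 : (0 : ℝ) < u := hu.1
      have huB : B < u := by
        by_contra! hle
        exact hu.2 ⟨hu0.le, hle⟩
      rw [fderivWithin_eq_zero_of_notMem hK hF0 (hmaps (mem_Ici.2 hu0.le))
        (hBK u v (Or.inl (lt_of_lt_of_le huB (le_abs_self u))))]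
      rfl
  · refine tendsto_const_nhds.congr' ?_
    filter_upwards [Filter.eventually_gt_atTop B] with u hu
    exact (hF0 _ (hmaps (mem_Ici.2 (hB.trans hu).le))
      (hBK u v (Or.inl (lt_of_lt_of_le hu (le_abs_self u))))).symm

end Green

/-- Green's theorem in the half-plane, for a compactly supported `1`-form `P du + Q dv`. -/
theorem integral_halfPlane_green {P Q : E2 → ℝ} {K : Set E2} (hP : ContDiffOn ℝ 1 P halfPlane)
    (hQ : ContDiffOn ℝ 1 Q halfPlane) (hK : IsCompact K)
    (hP0 : ∀ y ∈ halfPlane, y ∉ K → P y = 0) (hQ0 : ∀ y ∈ halfPlane, y ∉ K → Q y = 0) :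
    ∫ y in halfPlane, (fderivWithin ℝ Q halfPlane y e0 - fderivWithin ℝ P halfPlane y e1)
      = -∫ v : ℝ, Q (planePt 0 v) := by
  rw [integral_sub (integrableOn_fderivWithin_apply hQ hK hQ0 e0)
    (integrableOn_fderivWithin_apply hP hK hP0 e1), integral_halfPlane_deriv_right hP hK hP0,
    integral_halfPlane_deriv_left hQ hK hQ0, sub_zero]

/-! ### Calculus in the charts of a surface -/

section Charts

variable {M : Type*} [TopologicalSpace M] [ChartedSpace (EuclideanHalfSpace 2) M]
variable {F : Type*} [NormedAddCommGroup F] [NormedSpace ℝ F]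

/-- The derivative at `p` of a map defined on the surface, read in the chart at `x`. -/
noncomputable def chartDeriv (f : M → F) (x p : M) : E2 →L[ℝ] F :=
  fderivWithin ℝ (f ∘ (extChartAt (𝓡∂ 2) x).symm) halfPlane (extChartAt (𝓡∂ 2) x p)

theorem partialD_localParam_zero (φ : M → E3) (x p : M) :
    partialD 0 (localParam φ x) (extChartAt (𝓡∂ 2) x p) = chartDeriv φ x p e0 := rfl

theorem partialD_localParam_one (φ : M → E3) (x p : M) :
    partialD 1 (localParam φ x) (extChartAt (𝓡∂ 2) x p) = chartDeriv φ x p e1 := rfl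

theorem target_subset_halfPlane (x : M) : (extChartAt (𝓡∂ 2) x).target ⊆ halfPlane :=
  extChartAt_target_subset_range x

theorem target_mem_nhdsWithin {x : M} {y : E2} (hy : y ∈ (extChartAt (𝓡∂ 2) x).target) :
    (extChartAt (𝓡∂ 2) x).target ∈ nhdsWithin y halfPlane :=
  extChartAt_target_mem_nhdsWithin_of_mem hy

theorem continuousWithinAt_chart_symm {x : M} {y : E2} (hy : y ∈ (extChartAt (𝓡∂ 2) x).target) :
    ContinuousWithinAt (extChartAt (𝓡∂ 2) x).symm halfPlane y :=
  ((continuousOn_extChartAt_symm (I := 𝓡∂ 2) x) y hy).mono_of_mem_nhdsWithin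
    (target_mem_nhdsWithin hy)

theorem contDiffWithinAt_chart {n : WithTop ℕ∞} [IsManifold (𝓡∂ 2) n M] {f : M → F}
    (hf : ContMDiff (𝓡∂ 2) 𝓘(ℝ, F) n f) {x : M} {y : E2}
    (hy : y ∈ (extChartAt (𝓡∂ 2) x).target) :
    ContDiffWithinAt ℝ n (f ∘ (extChartAt (𝓡∂ 2) x).symm) halfPlane y := by
  have h : ContMDiffOn 𝓘(ℝ, E2) 𝓘(ℝ, F) n (f ∘ (extChartAt (𝓡∂ 2) x).symm)
      (extChartAt (𝓡∂ 2) x).target :=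
    hf.comp_contMDiffOn (contMDiffOn_extChartAt_symm x)
  exact (contMDiffOn_iff_contDiffOn.1 h y hy).mono_of_mem_nhdsWithin (target_mem_nhdsWithin hy)

theorem mfderiv_eq_chartDeriv {f : M → F} (hf : ContMDiff (𝓡∂ 2) 𝓘(ℝ, F) 1 f) (p : M) :
    mfderiv (𝓡∂ 2) 𝓘(ℝ, F) f p = chartDeriv f p p :=
  ((hf p).mdifferentiableAt one_ne_zero).mfderiv

variable [IsManifold (𝓡∂ 2) ∞ M]

theorem differentiableWithinAt_chart {f : M → F} (hf : ContMDiff (𝓡∂ 2) 𝓘(ℝ, F) 1 f) {x : M}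
    {y : E2} (hy : y ∈ (extChartAt (𝓡∂ 2) x).target) :
    DifferentiableWithinAt ℝ (f ∘ (extChartAt (𝓡∂ 2) x).symm) halfPlane y :=
  (contDiffWithinAt_chart hf hy).differentiableWithinAt one_ne_zero

theorem chartDeriv_eq_comp {f : M → F} (hf : ContMDiff (𝓡∂ 2) 𝓘(ℝ, F) 1 f) {x z p : M}
    (hx : p ∈ (extChartAt (𝓡∂ 2) x).source) (hz : p ∈ (extChartAt (𝓡∂ 2) z).source) :
    chartDeriv f x p = (chartDeriv f z p).comp (tangentCoordChange (𝓡∂ 2) x z p) := by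
  have hτ := hasFDerivWithinAt_tangentCoordChange (I := 𝓡∂ 2) (x := x) (y := z) ⟨hx, hz⟩
  set τ := extChartAt (𝓡∂ 2) z ∘ (extChartAt (𝓡∂ 2) x).symm with hτd
  have hτp : τ (extChartAt (𝓡∂ 2) x p) = extChartAt (𝓡∂ 2) z p := by
    rw [hτd, Function.comp_apply, (extChartAt (𝓡∂ 2) x).left_inv hx]
  have hg : HasFDerivWithinAt (f ∘ (extChartAt (𝓡∂ 2) z).symm) (chartDeriv f z p) halfPlane
      (τ (extChartAt (𝓡∂ 2) x p)) := by
    rw [hτp]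
    exact (differentiableWithinAt_chart hf ((extChartAt (𝓡∂ 2) z).map_source hz)).hasFDerivWithinAt
  have hmaps : MapsTo τ halfPlane halfPlane := fun y _ => mem_range_self _
  have h := hg.comp _ hτ hmaps
  have hev : (f ∘ (extChartAt (𝓡∂ 2) x).symm) =ᶠ[nhdsWithin (extChartAt (𝓡∂ 2) x p) halfPlane]
      (f ∘ (extChartAt (𝓡∂ 2) z).symm) ∘ τ := by
    have hc : (extChartAt (𝓡∂ 2) x).symm ⁻¹' (extChartAt (𝓡∂ 2) z).source ∈
        nhdsWithin (extChartAt (𝓡∂ 2) x p) halfPlane := by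
      apply (continuousWithinAt_chart_symm
        ((extChartAt (𝓡∂ 2) x).map_source hx)).preimage_mem_nhdsWithin
      rw [(extChartAt (𝓡∂ 2) x).left_inv hx]
      exact (isOpen_extChartAt_source (I := 𝓡∂ 2) z).mem_nhds hz
    filter_upwards [hc] with y hy
    simp only [τ, Function.comp]
    rw [(extChartAt (𝓡∂ 2) z).left_inv hy]
  have hxm : extChartAt (𝓡∂ 2) x p ∈ halfPlane :=
    target_subset_halfPlane x ((extChartAt (𝓡∂ 2) x).map_source hx)
  exact (h.congr_of_eventuallyEq hev (hev.eq_of_nhdsWithin hxm)).fderivWithin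
    ((𝓡∂ 2).uniqueDiffOn _ hxm)

theorem tangentCoordChange_det_ne_zero {x z p : M}
    (hx : p ∈ (extChartAt (𝓡∂ 2) x).source) (hz : p ∈ (extChartAt (𝓡∂ 2) z).source) :
    (tangentCoordChange (𝓡∂ 2) x z p).det ≠ 0 := by
  have h : (tangentCoordChange (𝓡∂ 2) z x p).comp (tangentCoordChange (𝓡∂ 2) x z p)
      = ContinuousLinearMap.id ℝ E2 := by
    ext1 v
    rw [ContinuousLinearMap.comp_apply, tangentCoordChange_comp ⟨⟨hx, hz⟩, hx⟩,
      tangentCoordChange_self hx]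
    rfl
  intro h0
  have h1 : LinearMap.det ((tangentCoordChange (𝓡∂ 2) z x p).toLinearMap ∘ₗ
      (tangentCoordChange (𝓡∂ 2) x z p).toLinearMap) = 1 := by
    have := congrArg ContinuousLinearMap.toLinearMap h
    exact (congrArg LinearMap.det this).trans LinearMap.det_id
  rw [LinearMap.det_comp] at h1
  have h2 : LinearMap.det (tangentCoordChange (𝓡∂ 2) x z p).toLinearMap = 0 := h0
  rw [h2, mul_zero] at h1
  exact zero_ne_one h1

end Charts

section Immersion

variable {M : Type*} [TopologicalSpace M] [ChartedSpace (EuclideanHalfSpace 2) M]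
  {φ N : M → E3}

theorem IsSmoothImmersion.contMDiff_one (hφ : IsSmoothImmersion φ) :
    ContMDiff (𝓡∂ 2) 𝓘(ℝ, E3) 1 φ := hφ.smooth.of_le (by norm_cast)

/-- The signed area density `det (N, φ_u, φ_v)` at `p` in the chart at `x`. -/
noncomputable def areaDensity (φ N : M → E3) (x p : M) : ℝ :=
  triple (N p) (chartDeriv φ x p e0) (chartDeriv φ x p e1)

theorem IsGaussMap.inner_self (hN : IsGaussMap φ N) (p : M) : ⟪N p, N p⟫ = 1 := by
  rw [real_inner_self_eq_norm_sq, hN.norm_eq_one, one_pow]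

/-- The signed area density in the chart at `x`, as a function on the half-plane. -/
theorem areaDensity_symm {x : M} {y : E2} (hy : y ∈ (extChartAt (𝓡∂ 2) x).target) :
    areaDensity φ N x ((extChartAt (𝓡∂ 2) x).symm y) =
      ⟪N ((extChartAt (𝓡∂ 2) x).symm y),
        cross3 (partialD 0 (localParam φ x) y) (partialD 1 (localParam φ x) y)⟫ := by
  rw [areaDensity, triple_eq_inner_cross3, ← partialD_localParam_zero, ← partialD_localParam_one,
    (extChartAt (𝓡∂ 2) x).right_inv hy]

variable [IsManifold (𝓡∂ 2) ∞ M]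

theorem IsSmoothImmersion.chartDeriv_injective (hφ : IsSmoothImmersion φ) {x p : M}
    (hx : p ∈ (extChartAt (𝓡∂ 2) x).source) : Function.Injective (chartDeriv φ x p) := by
  have h := hφ.injective_mfderiv p
  rw [mfderiv_eq_chartDeriv hφ.contMDiff_one] at h
  rw [chartDeriv_eq_comp hφ.contMDiff_one hx (mem_extChartAt_source p)]
  have hT := tangentCoordChange_det_ne_zero (p := p) hx (mem_extChartAt_source p)
  rw [ContinuousLinearMap.coe_comp]
  exact Function.Injective.comp h (LinearMap.equivOfDetNeZero _ hT).injective

theorem IsGaussMap.inner_chartDeriv (hN : IsGaussMap φ N) (hφ : IsSmoothImmersion φ) {x p : M}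
    (hx : p ∈ (extChartAt (𝓡∂ 2) x).source) (v : E2) : ⟪N p, chartDeriv φ x p v⟫ = 0 := by
  have h := hN.normal p (tangentCoordChange (𝓡∂ 2) x p p v)
  rw [mfderiv_eq_chartDeriv hφ.contMDiff_one] at h
  rw [chartDeriv_eq_comp hφ.contMDiff_one hx (mem_extChartAt_source p)]
  exact h

theorem IsGaussMap.areaDensity_sq (hN : IsGaussMap φ N) (hφ : IsSmoothImmersion φ) {x p : M}
    (hx : p ∈ (extChartAt (𝓡∂ 2) x).source) :
    areaDensity φ N x p ^ 2 = firstFormDet (localParam φ x) (extChartAt (𝓡∂ 2) x p) :=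
  triple_sq (hN.inner_self p) (hN.inner_chartDeriv hφ hx e0) (hN.inner_chartDeriv hφ hx e1)

theorem IsSmoothImmersion.firstFormDet_ne_zero (hφ : IsSmoothImmersion φ) {x p : M}
    (hx : p ∈ (extChartAt (𝓡∂ 2) x).source) :
    firstFormDet (localParam φ x) (extChartAt (𝓡∂ 2) x p) ≠ 0 := by
  intro h
  have hinj := hφ.chartDeriv_injective hx
  simp only [firstFormDet, firstForm, partialD_localParam_zero, partialD_localParam_one] at h
  set u := chartDeriv φ x p e0
  set v := chartDeriv φ x p e1
  have h1 : ⟪v, v⟫ • u - ⟪u, v⟫ • v = 0 := by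
    rw [← inner_self_eq_zero (𝕜 := ℝ)]
    simp only [inner_sub_left, inner_sub_right, real_inner_smul_left, real_inner_smul_right]
    rw [real_inner_comm u v]
    linear_combination ⟪v, v⟫ * h
  have h2 : chartDeriv φ x p (⟪v, v⟫ • e0 - ⟪u, v⟫ • e1) = chartDeriv φ x p 0 := by
    rw [map_zero, map_sub, map_smul, map_smul]; exact h1
  have h3 := congrFun (congrArg WithLp.ofLp (hinj h2)) 0
  simp [e0, e1] at h3
  have h4 : chartDeriv φ x p e1 = chartDeriv φ x p 0 := by rw [map_zero]; exact h3
  have h5 := congrFun (congrArg WithLp.ofLp (hinj h4)) 1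
  simp [e1] at h5

theorem IsGaussMap.areaDensity_ne_zero (hN : IsGaussMap φ N) (hφ : IsSmoothImmersion φ) {x p : M}
    (hx : p ∈ (extChartAt (𝓡∂ 2) x).source) : areaDensity φ N x p ≠ 0 := by
  have h := hφ.firstFormDet_ne_zero hx
  rw [← hN.areaDensity_sq hφ hx] at h
  exact fun h0 => h (by rw [h0]; ring)

theorem IsGaussMap.sqrt_firstFormDet (hN : IsGaussMap φ N) (hφ : IsSmoothImmersion φ) {x p : M}
    (hx : p ∈ (extChartAt (𝓡∂ 2) x).source) :
    Real.sqrt (firstFormDet (localParam φ x) (extChartAt (𝓡∂ 2) x p)) = |areaDensity φ N x p| := by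
  rw [← hN.areaDensity_sq hφ hx, Real.sqrt_sq_eq_abs]

/-- `φ_u × φ_v = det (N, φ_u, φ_v) N`. -/
theorem IsGaussMap.cross3_eq (hN : IsGaussMap φ N) (hφ : IsSmoothImmersion φ) {x p : M}
    (hx : p ∈ (extChartAt (𝓡∂ 2) x).source) :
    cross3 (chartDeriv φ x p e0) (chartDeriv φ x p e1) = areaDensity φ N x p • N p := by
  have h1 := hN.areaDensity_sq hφ hx
  simp only [firstFormDet, firstForm, partialD_localParam_zero, partialD_localParam_one] at h1
  rw [← sub_eq_zero, ← inner_self_eq_zero (𝕜 := ℝ)]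
  have h2 : areaDensity φ N x p = ⟪N p, cross3 (chartDeriv φ x p e0) (chartDeriv φ x p e1)⟫ :=
    triple_eq_inner_cross3 _ _ _
  simp only [inner_sub_left, inner_sub_right, real_inner_smul_left, real_inner_smul_right,
    hN.inner_self p]
  rw [real_inner_comm (N p), ← h2]
  have h3 : ⟪cross3 (chartDeriv φ x p e0) (chartDeriv φ x p e1),
      cross3 (chartDeriv φ x p e0) (chartDeriv φ x p e1)⟫ = areaDensity φ N x p ^ 2 := by
    rw [h1]
    simp only [inner_E3, cross3_apply]; simp; ring
  rw [h3]; ring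

theorem IsSmoothImmersion.contDiffWithinAt_localParam (hφ : IsSmoothImmersion φ) {x : M} {y : E2}
    (hy : y ∈ (extChartAt (𝓡∂ 2) x).target) :
    ContDiffWithinAt ℝ ∞ (localParam φ x) halfPlane y :=
  contDiffWithinAt_chart hφ.smooth hy

theorem IsSmoothImmersion.contDiffWithinAt_partialD (hφ : IsSmoothImmersion φ) (i : Fin 2) {x : M}
    {y : E2} (hy : y ∈ (extChartAt (𝓡∂ 2) x).target) :
    ContDiffWithinAt ℝ ∞ (partialD i (localParam φ x)) halfPlane y :=
  ((hφ.contDiffWithinAt_localParam hy).fderivWithin_right (𝓡∂ 2).uniqueDiffOn (by norm_cast)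
    (target_subset_halfPlane x hy)).clm_apply contDiffWithinAt_const

theorem IsSmoothImmersion.contDiffWithinAt_cross3 (hφ : IsSmoothImmersion φ) {x : M} {y : E2}
    (hy : y ∈ (extChartAt (𝓡∂ 2) x).target) :
    ContDiffWithinAt ℝ ∞
      (fun z => cross3 (partialD 0 (localParam φ x) z) (partialD 1 (localParam φ x) z))
      halfPlane y :=
  (cross3.contDiff.comp_contDiffWithinAt (hφ.contDiffWithinAt_partialD 0 hy)).clm_apply
    (hφ.contDiffWithinAt_partialD 1 hy)

theorem IsGaussMap.continuousWithinAt_areaDensity (hN : IsGaussMap φ N) (hφ : IsSmoothImmersion φ)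
    {x : M} {y : E2} (hy : y ∈ (extChartAt (𝓡∂ 2) x).target) :
    ContinuousWithinAt (fun z => areaDensity φ N x ((extChartAt (𝓡∂ 2) x).symm z)) halfPlane y := by
  have h : ContinuousWithinAt (fun z => ⟪N ((extChartAt (𝓡∂ 2) x).symm z),
      cross3 (partialD 0 (localParam φ x) z) (partialD 1 (localParam φ x) z)⟫) halfPlane y :=
    ContinuousWithinAt.inner
      (hN.continuous.continuousAt.comp_continuousWithinAt (continuousWithinAt_chart_symm hy))
      (hφ.contDiffWithinAt_cross3 hy).continuousWithinAt
  refine h.congr_of_eventuallyEq ?_ (areaDensity_symm hy)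
  filter_upwards [target_mem_nhdsWithin hy] with z hz using areaDensity_symm hz

/-- The sign of the area density is locally constant. -/
theorem IsGaussMap.eventually_sign_areaDensity (hN : IsGaussMap φ N) (hφ : IsSmoothImmersion φ)
    {x : M} {y : E2} (hy : y ∈ (extChartAt (𝓡∂ 2) x).target) :
    ∀ᶠ z in nhdsWithin y halfPlane, SignType.sign (areaDensity φ N x ((extChartAt (𝓡∂ 2) x).symm z))
      = SignType.sign (areaDensity φ N x ((extChartAt (𝓡∂ 2) x).symm y)) := by
  have hc := hN.continuousWithinAt_areaDensity hφ hy
  have hne := hN.areaDensity_ne_zero hφ ((extChartAt (𝓡∂ 2) x).map_target hy)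
  rcases hne.lt_or_gt with h | h
  · filter_upwards [hc.eventually (gt_mem_nhds h)] with z hz
    rw [sign_neg hz, sign_neg h]
  · filter_upwards [hc.eventually (lt_mem_nhds h)] with z hz
    rw [sign_pos hz, sign_pos h]

/-- A Gauss map of a smooth immersion is smooth: being continuous, it is locally one of the two
normalizations of `φ_u × φ_v`. -/
theorem IsGaussMap.contMDiff (hN : IsGaussMap φ N) (hφ : IsSmoothImmersion φ) :
    ContMDiff (𝓡∂ 2) 𝓘(ℝ, E3) ∞ N := by
  intro p
  rw [contMDiffAt_iff]
  refine ⟨hN.continuous.continuousAt, ?_⟩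
  have hp := mem_extChartAt_target (I := 𝓡∂ 2) p
  set y₀ := extChartAt (𝓡∂ 2) p p
  set ν := fun z => cross3 (partialD 0 (localParam φ p) z) (partialD 1 (localParam φ p) z) with hν
  set J := fun z => areaDensity φ N p ((extChartAt (𝓡∂ 2) p).symm z) with hJ
  have hν_eq : ∀ z ∈ (extChartAt (𝓡∂ 2) p).target,
      ν z = J z • N ((extChartAt (𝓡∂ 2) p).symm z) := by
    intro z hz
    have h := hN.cross3_eq hφ ((extChartAt (𝓡∂ 2) p).map_target hz)
    rw [← partialD_localParam_zero, ← partialD_localParam_one,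
      (extChartAt (𝓡∂ 2) p).right_inv hz] at h
    exact h
  have hJne : ∀ z ∈ (extChartAt (𝓡∂ 2) p).target, J z ≠ 0 := fun z hz =>
    hN.areaDensity_ne_zero hφ ((extChartAt (𝓡∂ 2) p).map_target hz)
  have hnorm : ∀ z ∈ (extChartAt (𝓡∂ 2) p).target, ‖ν z‖ = |J z| := by
    intro z hz
    rw [hν_eq z hz, norm_smul, hN.norm_eq_one, mul_one, Real.norm_eq_abs]
  have hν0 : ν y₀ ≠ 0 := by
    rw [← norm_ne_zero_iff, hnorm y₀ hp]
    exact abs_ne_zero.2 (hJne y₀ hp)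
  have hsm : ContDiffWithinAt ℝ ∞ (fun z => ((SignType.sign (J y₀) : ℝ) * ‖ν z‖)⁻¹ • ν z)
      halfPlane y₀ := by
    have h1 := hφ.contDiffWithinAt_cross3 hp
    have h2 : ((SignType.sign (J y₀) : ℝ)) ≠ 0 := by
      rcases (hJne y₀ hp).lt_or_gt with h | h
      · rw [sign_neg h]; simp
      · rw [sign_pos h]; simp
    exact ((contDiffWithinAt_const.mul (h1.norm ℝ hν0)).inv
      (mul_ne_zero h2 (norm_ne_zero_iff.2 hν0))).smul h1
  have hEq : ∀ z ∈ (extChartAt (𝓡∂ 2) p).target, SignType.sign (J z) = SignType.sign (J y₀) →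
      N ((extChartAt (𝓡∂ 2) p).symm z) = ((SignType.sign (J y₀) : ℝ) * ‖ν z‖)⁻¹ • ν z := by
    intro z hz hs
    rw [← hs, hnorm z hz, sign_mul_abs, hν_eq z hz, inv_smul_smul₀ (hJne z hz)]
  have hfin : ContDiffWithinAt ℝ ∞ (N ∘ (extChartAt (𝓡∂ 2) p).symm) halfPlane y₀ := by
    refine hsm.congr_of_eventuallyEq ?_ (hEq y₀ hp rfl)
    filter_upwards [target_mem_nhdsWithin hp, hN.eventually_sign_areaDensity hφ hp] with z hz hs
      using hEq z hz hs
  exact hfin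

/-- The curl of a vector field `V` along the oriented surface: the function whose product with the
area form is the exterior derivative of the `1`-form `⟪V, dφ⟫`. It is computed in the chart at the
point itself. -/
noncomputable def surfaceCurl (φ N V : M → E3) (p : M) : ℝ :=
  (⟪chartDeriv V p p e0, chartDeriv φ p p e1⟫ - ⟪chartDeriv V p p e1, chartDeriv φ p p e0⟫)
    / areaDensity φ N p p

theorem areaDensity_eq_det_mul (hφ : IsSmoothImmersion φ) {x z p : M}
    (hx : p ∈ (extChartAt (𝓡∂ 2) x).source) (hz : p ∈ (extChartAt (𝓡∂ 2) z).source) :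
    areaDensity φ N x p = (tangentCoordChange (𝓡∂ 2) x z p).det * areaDensity φ N z p := by
  simp only [areaDensity]
  rw [chartDeriv_eq_comp hφ.contMDiff_one hx hz, det_E2]
  simp only [ContinuousLinearMap.comp_apply]
  rw [clm_E2_apply (chartDeriv φ z p) (tangentCoordChange (𝓡∂ 2) x z p e0),
    clm_E2_apply (chartDeriv φ z p) (tangentCoordChange (𝓡∂ 2) x z p e1)]
  simp only [triple_eq, PiLp.add_apply, PiLp.smul_apply, smul_eq_mul]
  ring

/-- The curl does not depend on the chart. -/
theorem IsGaussMap.surfaceCurl_mul (hN : IsGaussMap φ N) (hφ : IsSmoothImmersion φ) {V : M → E3}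
    (hV : ContMDiff (𝓡∂ 2) 𝓘(ℝ, E3) 1 V) {x p : M} (hx : p ∈ (extChartAt (𝓡∂ 2) x).source) :
    ⟪chartDeriv V x p e0, chartDeriv φ x p e1⟫ - ⟪chartDeriv V x p e1, chartDeriv φ x p e0⟫
      = surfaceCurl φ N V p * areaDensity φ N x p := by
  have hp := mem_extChartAt_source (I := 𝓡∂ 2) p
  have h := bilin_comp_E2 (innerSL ℝ) (chartDeriv V p p) (chartDeriv φ p p)
    (tangentCoordChange (𝓡∂ 2) x p p)
  rw [chartDeriv_eq_comp hφ.contMDiff_one hx hp, chartDeriv_eq_comp hV hx hp,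
    areaDensity_eq_det_mul hφ hx hp, surfaceCurl]
  simp only [ContinuousLinearMap.comp_apply]
  refine Eq.trans h ?_
  change _ * (⟪chartDeriv V p p e0, chartDeriv φ p p e1⟫
    - ⟪chartDeriv V p p e1, chartDeriv φ p p e0⟫) = _
  field_simp [hN.areaDensity_ne_zero hφ hp]

theorem surfaceCurl_sum {ι : Type*} (s : Finset ι) (V : ι → M → E3)
    (hV : ∀ i, ContMDiff (𝓡∂ 2) 𝓘(ℝ, E3) 1 (V i)) (p : M) :
    surfaceCurl φ N (fun q => ∑ i ∈ s, V i q) p = ∑ i ∈ s, surfaceCurl φ N (V i) p := by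
  have hp := mem_extChartAt_target (I := 𝓡∂ 2) p
  have h : chartDeriv (fun q => ∑ i ∈ s, V i q) p p = ∑ i ∈ s, chartDeriv (V i) p p := by
    simp only [chartDeriv]
    have := fderivWithin_fun_sum ((𝓡∂ 2).uniqueDiffOn _ (target_subset_halfPlane p hp))
      (u := s) fun i _ => differentiableWithinAt_chart (hV i) hp
    exact this
  simp only [surfaceCurl, h, sum_apply, sum_inner, ← Finset.sum_sub_distrib,
    Finset.sum_div]

end Immersion

/-! ### The area measure in a chart -/

/-- Measures that agree on the overlaps of a countable cover are glued by their supremum. -/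
theorem iSup_measure_apply_of_agree {X ι : Type*} [MeasurableSpace X] {μ : ι → Measure X}
    {U : ι → Set X} (hU : ∀ i, MeasurableSet (U i)) (hμU : ∀ i, μ i (U i)ᶜ = 0)
    (hagree : ∀ i j S, MeasurableSet S → S ⊆ U i → S ⊆ U j → μ i S = μ j S)
    {t : ℕ → ι} (ht : ⋃ n, U (t n) = univ) {i : ι} {S : Set X} (hS : MeasurableSet S)
    (hSi : S ⊆ U i) : (⨆ j, μ j) S = μ i S := by
  set D : ℕ → Set X := disjointed fun n => U (t n) with hD
  have hDm : ∀ n, MeasurableSet (D n) := MeasurableSet.disjointed fun n => hU (t n)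
  have hDU : ∀ n, D n ⊆ U (t n) := disjointed_subset _
  have hDd : Pairwise (Function.onFun Disjoint D) := disjoint_disjointed _
  have hDuniv : ⋃ n, D n = univ := by rw [hD, iUnion_disjointed, ht]
  have hsplit : ∀ (j : ι) (A : Set X), MeasurableSet A → μ j A = ∑' n, μ j (A ∩ D n) := by
    intro j A hA
    rw [← measure_iUnion (fun m n hmn => (hDd hmn).mono inter_subset_right inter_subset_right)
      fun n => hA.inter (hDm n), ← inter_iUnion, hDuniv, inter_univ]
  have hcut : ∀ (j : ι) (A : Set X), μ j A = μ j (A ∩ U j) := by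
    intro j A
    refine le_antisymm ?_ (measure_mono inter_subset_left)
    calc μ j A ≤ μ j ((A ∩ U j) ∪ (U j)ᶜ) := measure_mono fun x hx => by
          by_cases h : x ∈ U j
          · exact Or.inl ⟨hx, h⟩
          · exact Or.inr h
      _ ≤ μ j (A ∩ U j) + μ j (U j)ᶜ := measure_union_le _ _
      _ = μ j (A ∩ U j) := by rw [hμU, add_zero]
  set ν : Measure X := Measure.sum fun n => (μ (t n)).restrict (D n) with hν
  have hνA : ∀ A, MeasurableSet A → ν A = ∑' n, μ (t n) (A ∩ D n) := by
    intro A hA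
    rw [hν, Measure.sum_apply _ hA]
    simp only [Measure.restrict_apply hA]
  have hle : ⨆ j, μ j ≤ ν := by
    refine iSup_le fun j => Measure.le_iff.2 fun A hA => ?_
    rw [hsplit j A hA, hνA A hA]
    refine ENNReal.tsum_le_tsum fun n => ?_
    rw [hcut, hagree j (t n) _ ((hA.inter (hDm n)).inter (hU j)) inter_subset_right
      (inter_subset_left.trans (inter_subset_right.trans (hDU n)))]
    exact measure_mono inter_subset_left
  refine le_antisymm ?_ (Measure.le_iff.1 (le_iSup μ i) S hS)
  refine (Measure.le_iff.1 hle S hS).trans_eq ?_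
  rw [hνA S hS, hsplit i S hS]
  exact tsum_congr fun n => hagree _ _ _ (hS.inter (hDm n)) (inter_subset_right.trans (hDU n))
    (inter_subset_left.trans hSi)

section Area

variable {M : Type*} [TopologicalSpace M] [ChartedSpace (EuclideanHalfSpace 2) M]

theorem measurableSet_target (x : M) : MeasurableSet (extChartAt (𝓡∂ 2) x).target := by
  rw [extChartAt_target]
  exact ((chartAt _ x).open_target.preimage (𝓡∂ 2).continuous_symm).measurableSet.inter
    isClosed_halfPlane.measurableSet

/-- The area density `√(EG - F²)` of the chart at `x`. -/
noncomputable def chartDensity (φ : M → E3) (x : M) (y : E2) : ENNReal :=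
  ENNReal.ofReal (Real.sqrt (firstFormDet (localParam φ x) y))

theorem IsGaussMap.chartDensity_eq [IsManifold (𝓡∂ 2) ∞ M] {φ N : M → E3} (hN : IsGaussMap φ N)
    (hφ : IsSmoothImmersion φ) {x p : M} (hx : p ∈ (extChartAt (𝓡∂ 2) x).source) :
    chartDensity φ x (extChartAt (𝓡∂ 2) x p) = ENNReal.ofReal |areaDensity φ N x p| := by
  rw [chartDensity, hN.sqrt_firstFormDet hφ hx]

variable [MeasurableSpace M]

/-- The area measure in the domain of the chart at `x`. -/
noncomputable def chartMeasure (φ : M → E3) (x : M) : Measure M :=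
  Measure.map (extChartAt (𝓡∂ 2) x).symm
    ((volume.restrict (extChartAt (𝓡∂ 2) x).target).withDensity (chartDensity φ x))

variable [BorelSpace M]

theorem aemeasurable_chart_symm (φ : M → E3) (x : M) :
    AEMeasurable (extChartAt (𝓡∂ 2) x).symm
      ((volume.restrict (extChartAt (𝓡∂ 2) x).target).withDensity (chartDensity φ x)) :=
  ((continuousOn_extChartAt_symm x).aemeasurable (measurableSet_target x)).mono_ac
    (withDensity_absolutelyContinuous _ _)

theorem chartMeasure_apply (φ : M → E3) (x : M) {S : Set M} (hS : MeasurableSet S) :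
    chartMeasure φ x S =
      ∫⁻ y in (extChartAt (𝓡∂ 2) x).symm ⁻¹' S ∩ (extChartAt (𝓡∂ 2) x).target,
        chartDensity φ x y := by
  rw [chartMeasure, Measure.map_apply_of_aemeasurable (aemeasurable_chart_symm φ x) hS,
    withDensity_apply', Measure.restrict_restrict' (measurableSet_target x)]

theorem measurableSet_source (x : M) : MeasurableSet (extChartAt (𝓡∂ 2) x).source :=
  (isOpen_extChartAt_source x).measurableSet

theorem measurableSet_symm_preimage (x : M) {S : Set M} (hS : MeasurableSet S) :
    MeasurableSet ((extChartAt (𝓡∂ 2) x).symm ⁻¹' S ∩ (extChartAt (𝓡∂ 2) x).target) := by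
  classical
  have h := ((continuousOn_extChartAt_symm (I := 𝓡∂ 2) x).measurable_piecewise (g := fun _ => x)
    continuousOn_const (measurableSet_target x))
  have h2 := (h hS).inter (measurableSet_target x)
  convert h2 using 1
  ext y
  simp only [mem_inter_iff, mem_preimage, and_congr_left_iff]
  intro hy
  rw [piecewise_eq_of_mem _ _ _ hy]

theorem chartMeasure_compl_source (φ : M → E3) (x : M) :
    chartMeasure φ x (extChartAt (𝓡∂ 2) x).sourceᶜ = 0 := by
  rw [chartMeasure_apply φ x (measurableSet_source x).compl]
  have : (extChartAt (𝓡∂ 2) x).symm ⁻¹' (extChartAt (𝓡∂ 2) x).sourceᶜ ∩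
      (extChartAt (𝓡∂ 2) x).target = ∅ :=
    eq_empty_of_forall_notMem fun y hy => hy.1 ((extChartAt (𝓡∂ 2) x).map_target hy.2)
  rw [this]
  simp

variable [IsManifold (𝓡∂ 2) ∞ M] {φ N : M → E3}

theorem IsGaussMap.chartMeasure_agree (hN : IsGaussMap φ N) (hφ : IsSmoothImmersion φ) (x z : M)
    {S : Set M} (hS : MeasurableSet S) (hSx : S ⊆ (extChartAt (𝓡∂ 2) x).source)
    (hSz : S ⊆ (extChartAt (𝓡∂ 2) z).source) : chartMeasure φ x S = chartMeasure φ z S := by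
  rw [chartMeasure_apply φ x hS, chartMeasure_apply φ z hS]
  set A := (extChartAt (𝓡∂ 2) x).symm ⁻¹' S ∩ (extChartAt (𝓡∂ 2) x).target with hA
  set τ := extChartAt (𝓡∂ 2) z ∘ (extChartAt (𝓡∂ 2) x).symm with hτ
  have himage : (extChartAt (𝓡∂ 2) z).symm ⁻¹' S ∩ (extChartAt (𝓡∂ 2) z).target = τ '' A := by
    ext y
    constructor
    · rintro ⟨hy, hyt⟩
      have hx := hSx hy
      refine ⟨extChartAt (𝓡∂ 2) x ((extChartAt (𝓡∂ 2) z).symm y),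
        ⟨?_, (extChartAt (𝓡∂ 2) x).map_source hx⟩, ?_⟩
      · rw [mem_preimage, (extChartAt (𝓡∂ 2) x).left_inv hx]; exact hy
      · rw [hτ, Function.comp_apply, (extChartAt (𝓡∂ 2) x).left_inv hx,
          (extChartAt (𝓡∂ 2) z).right_inv hyt]
    · rintro ⟨w, ⟨hw, hwt⟩, rfl⟩
      have hz := hSz hw
      refine ⟨?_, (extChartAt (𝓡∂ 2) z).map_source hz⟩
      rw [mem_preimage, hτ, Function.comp_apply, (extChartAt (𝓡∂ 2) z).left_inv hz]
      exact hw
  have hτd : ∀ y ∈ A, HasFDerivWithinAt τ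
      (tangentCoordChange (𝓡∂ 2) x z ((extChartAt (𝓡∂ 2) x).symm y)) A y := by
    intro y hy
    have h := hasFDerivWithinAt_tangentCoordChange (I := 𝓡∂ 2) (x := x) (y := z)
      ⟨hSx hy.1, hSz hy.1⟩
    rw [(extChartAt (𝓡∂ 2) x).right_inv hy.2] at h
    exact h.mono fun w hw => target_subset_halfPlane x hw.2
  have hinj : InjOn τ A := by
    intro y hy w hw hyw
    have h := (extChartAt (𝓡∂ 2) z).injOn (hSz hy.1) (hSz hw.1) hyw
    exact (extChartAt (𝓡∂ 2) x).symm.injOn hy.2 hw.2 h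
  rw [himage, lintegral_image_eq_lintegral_abs_det_fderiv_mul volume
    (measurableSet_symm_preimage x hS) hτd hinj]
  refine setLIntegral_congr_fun (measurableSet_symm_preimage x hS) fun y hy => ?_
  have h1 := hN.chartDensity_eq hφ (hSx hy.1)
  rw [(extChartAt (𝓡∂ 2) x).right_inv hy.2] at h1
  rw [h1, hτ, Function.comp_apply, hN.chartDensity_eq hφ (hSz hy.1),
    areaDensity_eq_det_mul hφ (hSx hy.1) (hSz hy.1), abs_mul, ENNReal.ofReal_mul (abs_nonneg _)]

variable [CompactSpace M]

theorem IsGaussMap.areaMeasure_apply (hN : IsGaussMap φ N) (hφ : IsSmoothImmersion φ) (x : M)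
    {S : Set M} (hS : MeasurableSet S) (hSx : S ⊆ (extChartAt (𝓡∂ 2) x).source) :
    areaMeasure φ S = chartMeasure φ x S := by
  obtain ⟨s, hs, hcov⟩ := countable_cover_nhds_of_sigmaCompact
    (f := fun z : M => (extChartAt (𝓡∂ 2) z).source) fun z => extChartAt_source_mem_nhds z
  have hne : s.Nonempty := by
    by_contra h
    rw [not_nonempty_iff_eq_empty] at h
    rw [h] at hcov
    simp only [mem_empty_iff_false, iUnion_of_empty, iUnion_empty] at hcov
    exact (hcov ▸ mem_univ x : x ∈ (∅ : Set M))
  obtain ⟨t, rfl⟩ := hs.exists_eq_range hne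
  rw [biUnion_range] at hcov
  exact iSup_measure_apply_of_agree (U := fun z : M => (extChartAt (𝓡∂ 2) z).source)
    measurableSet_source (chartMeasure_compl_source φ)
    (fun i j S hS hi hj => hN.chartMeasure_agree hφ i j hS hi hj) hcov hS hSx

theorem IsGaussMap.restrict_areaMeasure (hN : IsGaussMap φ N) (hφ : IsSmoothImmersion φ) (x : M) :
    (areaMeasure φ).restrict (extChartAt (𝓡∂ 2) x).source = chartMeasure φ x := by
  ext S hS
  rw [Measure.restrict_apply hS, hN.areaMeasure_apply hφ x (hS.inter (measurableSet_source x))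
    inter_subset_right]
  exact measure_inter_conull (chartMeasure_compl_source φ x)

theorem IsGaussMap.isFiniteMeasure (hN : IsGaussMap φ N) (hφ : IsSmoothImmersion φ) :
    IsFiniteMeasure (areaMeasure φ) := by
  have hloc : IsLocallyFiniteMeasure (areaMeasure φ) := by
    refine ⟨fun p => ?_⟩
    have hp := mem_extChartAt_target (I := 𝓡∂ 2) p
    have hc := (hN.continuousWithinAt_areaDensity hφ hp).abs
    set C := |areaDensity φ N p ((extChartAt (𝓡∂ 2) p).symm (extChartAt (𝓡∂ 2) p p))| + 1
    obtain ⟨O, hO, hpO, hOC⟩ := mem_nhdsWithin.1 (hc.eventually (gt_mem_nhds (lt_add_one _)))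
    set W := O ∩ Metric.ball (extChartAt (𝓡∂ 2) p p) 1
    have hW : IsOpen W := hO.inter Metric.isOpen_ball
    have hU : IsOpen ((extChartAt (𝓡∂ 2) p).source ∩ extChartAt (𝓡∂ 2) p ⁻¹' W) :=
      (continuousOn_extChartAt p).isOpen_inter_preimage (isOpen_extChartAt_source p) hW
    refine ⟨_, hU.mem_nhds ⟨mem_extChartAt_source p, hpO, Metric.mem_ball_self one_pos⟩, ?_⟩
    rw [hN.areaMeasure_apply hφ p hU.measurableSet inter_subset_left,
      chartMeasure_apply φ p hU.measurableSet]
    set A := (extChartAt (𝓡∂ 2) p).symm ⁻¹' ((extChartAt (𝓡∂ 2) p).source ∩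
      extChartAt (𝓡∂ 2) p ⁻¹' W) ∩ (extChartAt (𝓡∂ 2) p).target with hA
    have hAW : A ⊆ W := by
      rintro y ⟨⟨_, hy⟩, hyt⟩
      rwa [mem_preimage, (extChartAt (𝓡∂ 2) p).right_inv hyt] at hy
    calc ∫⁻ y in A, chartDensity φ p y ≤ ∫⁻ _ in A, ENNReal.ofReal C := by
          refine setLIntegral_mono measurable_const fun y hy => ?_
          have h1 := hN.chartDensity_eq hφ ((extChartAt (𝓡∂ 2) p).map_target hy.2)
          rw [(extChartAt (𝓡∂ 2) p).right_inv hy.2] at h1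
          rw [h1]
          exact ENNReal.ofReal_le_ofReal
            (le_of_lt (hOC ⟨(hAW hy).1, target_subset_halfPlane p hy.2⟩))
      _ = ENNReal.ofReal C * volume A := setLIntegral_const _ _
      _ < ⊤ := ENNReal.mul_lt_top ENNReal.ofReal_lt_top
          ((measure_mono (hAW.trans inter_subset_right)).trans_lt measure_ball_lt_top)
  exact ⟨isCompact_univ.measure_lt_top⟩

/-- The integral over the surface of a function supported in the domain of a chart. -/
theorem IsGaussMap.integral_areaMeasure (hN : IsGaussMap φ N) (hφ : IsSmoothImmersion φ) (x : M)
    {k : M → ℝ} (hk : Continuous k) (hkx : ∀ p ∉ (extChartAt (𝓡∂ 2) x).source, k p = 0) :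
    ∫ p, k p ∂(areaMeasure φ) = ∫ y in (extChartAt (𝓡∂ 2) x).target,
      |areaDensity φ N x ((extChartAt (𝓡∂ 2) x).symm y)| * k ((extChartAt (𝓡∂ 2) x).symm y) := by
  rw [← setIntegral_eq_integral_of_forall_compl_eq_zero hkx, hN.restrict_areaMeasure hφ x,
    chartMeasure, integral_map (aemeasurable_chart_symm φ x) hk.measurable.aestronglyMeasurable,
    integral_withDensity_eq_integral_toReal_smul₀]
  · refine setIntegral_congr_fun (measurableSet_target x) fun y hy => ?_
    have h1 := hN.chartDensity_eq hφ ((extChartAt (𝓡∂ 2) x).map_target hy)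
    rw [(extChartAt (𝓡∂ 2) x).right_inv hy] at h1
    rw [h1, ENNReal.toReal_ofReal (abs_nonneg _), smul_eq_mul]
  · have h : ContinuousOn (fun y => |areaDensity φ N x ((extChartAt (𝓡∂ 2) x).symm y)|)
        (extChartAt (𝓡∂ 2) x).target := fun y hy =>
      ((hN.continuousWithinAt_areaDensity hφ hy).mono (target_subset_halfPlane x)).abs
    refine ((h.aemeasurable (measurableSet_target x)).ennreal_ofReal).congr ?_
    refine (ae_restrict_iff' (measurableSet_target x)).2
      (Filter.Eventually.of_forall fun y hy => ?_)
    have h1 := hN.chartDensity_eq hφ ((extChartAt (𝓡∂ 2) x).map_target hy)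
    rw [(extChartAt (𝓡∂ 2) x).right_inv hy] at h1
    exact h1.symm
  · exact Filter.Eventually.of_forall fun y => ENNReal.ofReal_lt_top

end Area

/-! ### Stokes' theorem in a chart -/

theorem fderivWithin_inner_halfPlane {f g : E2 → E3} {y : E2}
    (hf : DifferentiableWithinAt ℝ f halfPlane y) (hg : DifferentiableWithinAt ℝ g halfPlane y)
    (hy : y ∈ halfPlane) (e : E2) :
    fderivWithin ℝ (fun z => ⟪f z, g z⟫) halfPlane y e =
      ⟪f y, fderivWithin ℝ g halfPlane y e⟫ + ⟪fderivWithin ℝ f halfPlane y e, g y⟫ := by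
  rw [(hf.hasFDerivWithinAt.inner ℝ hg.hasFDerivWithinAt).fderivWithin ((𝓡∂ 2).uniqueDiffOn y hy)]
  rfl

section LocalStokes

variable {M : Type*} [TopologicalSpace M] [ChartedSpace (EuclideanHalfSpace 2) M]
  [IsManifold (𝓡∂ 2) ∞ M] {φ N V : M → E3}

theorem continuousAt_chartDeriv {F : Type*} [NormedAddCommGroup F] [NormedSpace ℝ F] {f : M → F}
    (hf : ContMDiff (𝓡∂ 2) 𝓘(ℝ, F) 1 f) {x p : M} (hx : p ∈ (extChartAt (𝓡∂ 2) x).source) :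
    ContinuousAt (chartDeriv f x) p := by
  have hy := (extChartAt (𝓡∂ 2) x).map_source hx
  have h : ContinuousWithinAt
      (fderivWithin ℝ (f ∘ (extChartAt (𝓡∂ 2) x).symm) halfPlane) halfPlane
      (extChartAt (𝓡∂ 2) x p) :=
    ((contDiffWithinAt_chart hf hy).fderivWithin_right (m := 0) (𝓡∂ 2).uniqueDiffOn (by norm_num)
      (target_subset_halfPlane x hy)).continuousWithinAt
  refine Filter.Tendsto.comp h ?_
  exact tendsto_nhdsWithin_iff.2 ⟨continuousAt_extChartAt' hx,
    Filter.Eventually.of_forall fun q => mem_range_self _⟩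

theorem IsGaussMap.continuousAt_areaDensity (hN : IsGaussMap φ N) (hφ : IsSmoothImmersion φ)
    {x p : M} (hx : p ∈ (extChartAt (𝓡∂ 2) x).source) : ContinuousAt (areaDensity φ N x) p := by
  have h := continuousAt_chartDeriv hφ.contMDiff_one hx
  have h1 : ContinuousAt N p := hN.continuous.continuousAt
  exact h1.triple (h.clm_apply continuousAt_const) (h.clm_apply continuousAt_const)

theorem IsGaussMap.continuous_surfaceCurl (hN : IsGaussMap φ N) (hφ : IsSmoothImmersion φ)
    (hV : ContMDiff (𝓡∂ 2) 𝓘(ℝ, E3) 1 V) : Continuous (surfaceCurl φ N V) := by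
  rw [continuous_iff_continuousAt]
  intro p
  have hp := mem_extChartAt_source (I := 𝓡∂ 2) p
  have h1 := continuousAt_chartDeriv hφ.contMDiff_one hp
  have h2 := continuousAt_chartDeriv hV hp
  have h3 := hN.continuousAt_areaDensity hφ hp
  have h : ContinuousAt (fun q => (⟪chartDeriv V p q e0, chartDeriv φ p q e1⟫
      - ⟪chartDeriv V p q e1, chartDeriv φ p q e0⟫) / areaDensity φ N p q) p := by
    refine ContinuousAt.div ?_ h3 (hN.areaDensity_ne_zero hφ hp)
    fun_prop
  refine h.congr ?_
  filter_upwards [extChartAt_source_mem_nhds (I := 𝓡∂ 2) p] with q hq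
  rw [hN.surfaceCurl_mul hφ hV hq, mul_div_cancel_right₀ _ (hN.areaDensity_ne_zero hφ hq)]

omit [IsManifold (𝓡∂ 2) ∞ M] in
theorem surfaceCurl_eq_zero_of_notMem_tsupport {p : M} (hp : p ∉ tsupport V) :
    surfaceCurl φ N V p = 0 := by
  have h : (V ∘ (extChartAt (𝓡∂ 2) p).symm)
      =ᶠ[nhdsWithin (extChartAt (𝓡∂ 2) p p) halfPlane] fun _ => 0 := by
    have hc := continuousWithinAt_chart_symm (mem_extChartAt_target (I := 𝓡∂ 2) p)
    have hmem : (tsupport V)ᶜ ∈ nhds ((extChartAt (𝓡∂ 2) p).symm (extChartAt (𝓡∂ 2) p p)) := by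
      rw [extChartAt_to_inv]
      exact (isClosed_tsupport V).isOpen_compl.mem_nhds hp
    filter_upwards [hc.preimage_mem_nhdsWithin hmem] with y hy
    exact image_eq_zero_of_notMem_tsupport (f := V) hy
  have h0 : chartDeriv V p p = 0 := by
    rw [chartDeriv, h.fderivWithin_eq (h.eq_of_nhdsWithin
      (target_subset_halfPlane p (mem_extChartAt_target p)))]
    simp
  simp [surfaceCurl, h0]

theorem IsSmoothImmersion.partialD_comm (hφ : IsSmoothImmersion φ) {x : M} {y : E2}
    (hy : y ∈ (extChartAt (𝓡∂ 2) x).target) :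
    partialD 1 (partialD 0 (localParam φ x)) y = partialD 0 (partialD 1 (localParam φ x)) y := by
  have hyR := target_subset_halfPlane x hy
  have hψ := hφ.contDiffWithinAt_localParam hy
  have hd : DifferentiableWithinAt ℝ (fderivWithin ℝ (localParam φ x) halfPlane) halfPlane y :=
    (hψ.fderivWithin_right (m := 1) (𝓡∂ 2).uniqueDiffOn (by norm_cast) hyR).differentiableWithinAt
      one_ne_zero
  have hsym := hψ.isSymmSndFDerivWithinAt (by simp; norm_cast) (𝓡∂ 2).uniqueDiffOn
    ((𝓡∂ 2).range_subset_closure_interior hyR) hyR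
  have hpart : ∀ i j, partialD j (partialD i (localParam φ x)) y =
      fderivWithin ℝ (fderivWithin ℝ (localParam φ x) halfPlane) halfPlane y
        (EuclideanSpace.single j 1) (EuclideanSpace.single i 1) := by
    intro i j
    have h := (hd.hasFDerivWithinAt.clm_apply (hasFDerivWithinAt_const
      (EuclideanSpace.single i (1 : ℝ) : E2) y halfPlane)).fderivWithin ((𝓡∂ 2).uniqueDiffOn y hyR)
    have h2 := congrArg (fun L : E2 →L[ℝ] E3 => L (EuclideanSpace.single j 1)) h
    refine Eq.trans h2 ?_
    simp
  rw [hpart, hpart]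
  exact hsym _ _

/-- The field `V` multiplied by the orientation sign of the chart at `x`, read in that chart and
extended by zero. -/
noncomputable def signedField (φ N V : M → E3) (x : M) (y : E2) : E3 :=
  open Classical in
  if y ∈ (extChartAt (𝓡∂ 2) x).target then
    (SignType.sign (areaDensity φ N x ((extChartAt (𝓡∂ 2) x).symm y)) : ℝ) •
      V ((extChartAt (𝓡∂ 2) x).symm y)
  else 0

omit [IsManifold (𝓡∂ 2) ∞ M] in
theorem signedField_of_mem {x : M} {y : E2} (hy : y ∈ (extChartAt (𝓡∂ 2) x).target) :
    signedField φ N V x y =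
    (SignType.sign (areaDensity φ N x ((extChartAt (𝓡∂ 2) x).symm y)) : ℝ) •
      V ((extChartAt (𝓡∂ 2) x).symm y) := if_pos hy

omit [IsManifold (𝓡∂ 2) ∞ M] in
theorem signedField_eq_zero {x : M} {y : E2} (hy : y ∉ extChartAt (𝓡∂ 2) x '' tsupport V) :
    signedField φ N V x y = 0 := by
  by_cases h : y ∈ (extChartAt (𝓡∂ 2) x).target
  · rw [signedField_of_mem h, image_eq_zero_of_notMem_tsupport (f := V), smul_zero]
    intro hV
    exact hy ⟨_, hV, (extChartAt (𝓡∂ 2) x).right_inv h⟩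
  · exact if_neg h

theorem IsGaussMap.signedField_eventuallyEq (hN : IsGaussMap φ N) (hφ : IsSmoothImmersion φ)
    {x : M} {y : E2} (hy : y ∈ (extChartAt (𝓡∂ 2) x).target) (i : Fin 2) :
    (fun z => ⟪signedField φ N V x z, partialD i (localParam φ x) z⟫) =ᶠ[nhdsWithin y halfPlane]
      fun z => (SignType.sign (areaDensity φ N x ((extChartAt (𝓡∂ 2) x).symm y)) : ℝ) *
        ⟪(V ∘ (extChartAt (𝓡∂ 2) x).symm) z, partialD i (localParam φ x) z⟫ := by
  filter_upwards [target_mem_nhdsWithin hy, hN.eventually_sign_areaDensity hφ hy] with z hz hs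
  rw [signedField_of_mem hz, hs, real_inner_smul_left]
  rfl

theorem IsGaussMap.fderivWithin_inner_signedField (hN : IsGaussMap φ N) (hφ : IsSmoothImmersion φ)
    (hV : ContMDiff (𝓡∂ 2) 𝓘(ℝ, E3) 1 V) {x : M} {y : E2}
    (hy : y ∈ (extChartAt (𝓡∂ 2) x).target) (i j : Fin 2) :
    fderivWithin ℝ (fun z => ⟪signedField φ N V x z, partialD i (localParam φ x) z⟫) halfPlane y
        (EuclideanSpace.single j 1) =
      (SignType.sign (areaDensity φ N x ((extChartAt (𝓡∂ 2) x).symm y)) : ℝ) *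
        (⟪V ((extChartAt (𝓡∂ 2) x).symm y), partialD j (partialD i (localParam φ x)) y⟫ +
          ⟪fderivWithin ℝ (V ∘ (extChartAt (𝓡∂ 2) x).symm) halfPlane y (EuclideanSpace.single j 1),
            partialD i (localParam φ x) y⟫) := by
  have hyR := target_subset_halfPlane x hy
  have hev := hN.signedField_eventuallyEq (V := V) hφ hy i
  have hu := (𝓡∂ 2).uniqueDiffOn y hyR
  have hd1 := differentiableWithinAt_chart hV hy
  have hd2 := (hφ.contDiffWithinAt_partialD i hy).differentiableWithinAt (by simp)
  rw [hev.fderivWithin_eq (hev.eq_of_nhdsWithin hyR), fderivWithin_const_mul hu (hd1.inner ℝ hd2),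
    smul_apply, smul_eq_mul, fderivWithin_inner_halfPlane hd1 hd2 hyR]
  rfl

variable [CompactSpace M]

omit [IsManifold (𝓡∂ 2) ∞ M] in
theorem isCompact_image_tsupport {x : M} (hVx : tsupport V ⊆ (extChartAt (𝓡∂ 2) x).source) :
    IsCompact (extChartAt (𝓡∂ 2) x '' tsupport V) :=
  (isClosed_tsupport V).isCompact.image_of_continuousOn ((continuousOn_extChartAt x).mono hVx)

theorem IsGaussMap.contDiffOn_inner_signedField (hN : IsGaussMap φ N) (hφ : IsSmoothImmersion φ)
    (hV : ContMDiff (𝓡∂ 2) 𝓘(ℝ, E3) 1 V) {x : M}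
    (hVx : tsupport V ⊆ (extChartAt (𝓡∂ 2) x).source) (i : Fin 2) :
    ContDiffOn ℝ 1 (fun z => ⟪signedField φ N V x z, partialD i (localParam φ x) z⟫) halfPlane := by
  intro y hyR
  by_cases hy : y ∈ (extChartAt (𝓡∂ 2) x).target
  · have h : ContDiffWithinAt ℝ 1 (fun z =>
        (SignType.sign (areaDensity φ N x ((extChartAt (𝓡∂ 2) x).symm y)) : ℝ) *
        ⟪(V ∘ (extChartAt (𝓡∂ 2) x).symm) z, partialD i (localParam φ x) z⟫) halfPlane y :=
      contDiffWithinAt_const.mul ((contDiffWithinAt_chart hV hy).inner ℝ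
        ((hφ.contDiffWithinAt_partialD i hy).of_le (by norm_cast)))
    have hev := hN.signedField_eventuallyEq (V := V) hφ hy i
    exact h.congr_of_eventuallyEq hev (hev.eq_of_nhdsWithin hyR)
  · have hyK : y ∉ extChartAt (𝓡∂ 2) x '' tsupport V := by
      rintro ⟨q, hq, rfl⟩
      exact hy ((extChartAt (𝓡∂ 2) x).map_source (hVx hq))
    have hev : (fun z => ⟪signedField φ N V x z, partialD i (localParam φ x) z⟫)
        =ᶠ[nhdsWithin y halfPlane] fun _ => (0 : ℝ) := by
      filter_upwards [mem_nhdsWithin_of_mem_nhds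
        ((isCompact_image_tsupport hVx).isClosed.isOpen_compl.mem_nhds hyK)] with z hz
      rw [signedField_eq_zero hz, inner_zero_left]
    exact contDiffWithinAt_const.congr_of_eventuallyEq hev (hev.eq_of_nhdsWithin hyR)

variable [MeasurableSpace M] [BorelSpace M]

/-- Stokes' theorem for a field supported in the domain of a chart. -/
theorem IsGaussMap.integral_surfaceCurl_chart (hN : IsGaussMap φ N) (hφ : IsSmoothImmersion φ)
    (hV : ContMDiff (𝓡∂ 2) 𝓘(ℝ, E3) 1 V) {x : M}
    (hVx : tsupport V ⊆ (extChartAt (𝓡∂ 2) x).source) :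
    ∫ p, surfaceCurl φ N V p ∂(areaMeasure φ) =
      -∫ v : ℝ, ⟪signedField φ N V x (planePt 0 v), partialD 1 (localParam φ x) (planePt 0 v)⟫ := by
  have hK := isCompact_image_tsupport hVx
  have h0 : ∀ i, ∀ y ∈ halfPlane, y ∉ extChartAt (𝓡∂ 2) x '' tsupport V →
      ⟪signedField φ N V x y, partialD i (localParam φ x) y⟫ = 0 := fun i y _ hy => by
    rw [signedField_eq_zero hy, inner_zero_left]
  rw [← integral_halfPlane_green (hN.contDiffOn_inner_signedField hφ hV hVx 0)
    (hN.contDiffOn_inner_signedField hφ hV hVx 1) hK (h0 0) (h0 1),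
    hN.integral_areaMeasure hφ x (hN.continuous_surfaceCurl hφ hV)
      fun p hp => surfaceCurl_eq_zero_of_notMem_tsupport fun h => hp (hVx h)]
  rw [setIntegral_eq_of_subset_of_forall_sdiff_eq_zero isClosed_halfPlane.measurableSet
    (target_subset_halfPlane x)]
  · refine setIntegral_congr_fun (measurableSet_target x) fun y hy => ?_
    have hs := (extChartAt (𝓡∂ 2) x).map_target hy
    have h := hN.surfaceCurl_mul hφ hV hs
    simp only [chartDeriv, (extChartAt (𝓡∂ 2) x).right_inv hy] at h
    have h1 := hN.fderivWithin_inner_signedField hφ hV hy 1 0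
    have h2 := hN.fderivWithin_inner_signedField hφ hV hy 0 1
    have h3 := hφ.partialD_comm hy
    beta_reduce
    rw [h1, h2, h3, ← sign_mul_self, mul_assoc, mul_comm (areaDensity _ _ _ _), ← h]
    simp only [partialD, localParam]
    ring
  · intro y hy
    have hyK : y ∉ extChartAt (𝓡∂ 2) x '' tsupport V := by
      rintro ⟨q, hq, rfl⟩
      exact hy.2 ((extChartAt (𝓡∂ 2) x).map_source (hVx hq))
    rw [fderivWithin_eq_zero_of_notMem hK (h0 0) hy.1 hyK,
      fderivWithin_eq_zero_of_notMem hK (h0 1) hy.1 hyK]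
    simp

end LocalStokes

/-! ### Stokes' theorem on the surface -/

theorem convex_halfPlane : Convex ℝ halfPlane := by
  rw [halfPlane, range_modelWithCornersEuclideanHalfSpace]
  exact EuclideanHalfSpace.convex

section Boundary

variable {M : Type*} [TopologicalSpace M] [ChartedSpace (EuclideanHalfSpace 2) M]
  {φ N V : M → E3} {β : ℝ → M} {γ : ℝ → E3}

theorem eventually_curve_mem_source (hβ : Continuous β) {x : M} {t : ℝ}
    (ht : β t ∈ (extChartAt (𝓡∂ 2) x).source) :
    ∀ᶠ s in nhds t, β s ∈ (extChartAt (𝓡∂ 2) x).source :=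
  hβ.continuousAt ((isOpen_extChartAt_source x).mem_nhds ht)

variable [IsManifold (𝓡∂ 2) ∞ M]

theorem symm_mem_boundary_iff {x : M} {y : E2} (hy : y ∈ (extChartAt (𝓡∂ 2) x).target) :
    (extChartAt (𝓡∂ 2) x).symm y ∈ (𝓡∂ 2).boundary M ↔ y 0 = 0 := by
  have hs := (extChartAt (𝓡∂ 2) x).map_target hy
  rw [extChartAt_source] at hs
  have h := (𝓡∂ 2).isInteriorPoint_iff_of_mem_atlas (n := ∞) (by simp)
    (chart_mem_atlas (EuclideanHalfSpace 2) x) hs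
  have hE : (chartAt (EuclideanHalfSpace 2) x).extend (𝓡∂ 2) ((extChartAt (𝓡∂ 2) x).symm y) = y :=
    (extChartAt (𝓡∂ 2) x).right_inv hy
  have hI : y ∈ interior ((chartAt (EuclideanHalfSpace 2) x).extend (𝓡∂ 2)).target ↔ 0 < y 0 := by
    have ho : IsOpen ((𝓡∂ 2).symm ⁻¹' (chartAt (EuclideanHalfSpace 2) x).target) :=
      (chartAt _ x).open_target.preimage (𝓡∂ 2).continuous_symm
    rw [OpenPartialHomeomorph.extend_target, interior_inter, ho.interior_eq,
      interior_range_modelWithCornersEuclideanHalfSpace]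
    rw [extChartAt_target] at hy
    exact ⟨fun h => h.2, fun h => ⟨hy.1, h⟩⟩
  rw [hE, hI] at h
  have h2 : (extChartAt (𝓡∂ 2) x).symm y ∈ (𝓡∂ 2).boundary M ↔
      ¬ (𝓡∂ 2).IsInteriorPoint ((extChartAt (𝓡∂ 2) x).symm y) :=
    (𝓡∂ 2).isBoundaryPoint_iff_not_isInteriorPoint _
  rw [h2, h, not_lt]
  have h3 := mem_halfPlane.1 (target_subset_halfPlane x hy)
  exact ⟨fun h => le_antisymm h h3, fun h => h.le⟩

theorem extChartAt_boundary_zero {x p : M} (hx : p ∈ (extChartAt (𝓡∂ 2) x).source)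
    (hp : p ∈ (𝓡∂ 2).boundary M) : extChartAt (𝓡∂ 2) x p 0 = 0 := by
  rw [← symm_mem_boundary_iff ((extChartAt (𝓡∂ 2) x).map_source hx),
    (extChartAt (𝓡∂ 2) x).left_inv hx]
  exact hp

theorem differentiableAt_chart_curve (hβ : ContMDiff 𝓘(ℝ, ℝ) (𝓡∂ 2) ∞ β) {x : M} {t : ℝ}
    (ht : β t ∈ (extChartAt (𝓡∂ 2) x).source) :
    DifferentiableAt ℝ (fun s => extChartAt (𝓡∂ 2) x (β s)) t := by
  rw [extChartAt_source] at ht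
  have h : ContMDiffAt 𝓘(ℝ, ℝ) 𝓘(ℝ, E2) ∞ (extChartAt (𝓡∂ 2) x ∘ β) t :=
    (contMDiffAt_extChartAt' ht).comp t (hβ t)
  exact (contMDiffAt_iff_contDiffAt.1 h).differentiableAt (by simp)

/-- The speed of the boundary curve `β` in the chart at `x`, along the line `y 0 = 0`. -/
noncomputable def chartSpeed (β : ℝ → M) (x : M) (t : ℝ) : ℝ :=
  deriv (fun s => extChartAt (𝓡∂ 2) x (β s)) t 1

theorem deriv_chart_curve (hβ : ContMDiff 𝓘(ℝ, ℝ) (𝓡∂ 2) ∞ β)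
    (hβM : range β = (𝓡∂ 2).boundary M) {x : M} {t : ℝ}
    (ht : β t ∈ (extChartAt (𝓡∂ 2) x).source) :
    deriv (fun s => extChartAt (𝓡∂ 2) x (β s)) t = chartSpeed β x t • e1 := by
  have hd := (differentiableAt_chart_curve hβ ht).hasDerivAt
  have h0 : HasDerivAt (fun s => extChartAt (𝓡∂ 2) x (β s) 0)
      (deriv (fun s => extChartAt (𝓡∂ 2) x (β s)) t 0) t :=
    (EuclideanSpace.proj (𝕜 := ℝ) (0 : Fin 2)).hasFDerivAt.comp_hasDerivAt t hd
  have h1 : HasDerivAt (fun s => extChartAt (𝓡∂ 2) x (β s) 0) 0 t := by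
    refine (hasDerivAt_const t (0 : ℝ)).congr_of_eventuallyEq ?_
    filter_upwards [eventually_curve_mem_source hβ.continuous ht] with s hs
    exact extChartAt_boundary_zero hs (hβM ▸ mem_range_self s)
  rw [E2_eq (deriv _ _), h0.unique h1, zero_smul, zero_add]
  rfl

theorem deriv_boundary_curve (hφ : IsSmoothImmersion φ) (hβ : ContMDiff 𝓘(ℝ, ℝ) (𝓡∂ 2) ∞ β)
    (hβM : range β = (𝓡∂ 2).boundary M) (hγ : ∀ t, φ (β t) = γ t) {x : M} {t : ℝ}
    (ht : β t ∈ (extChartAt (𝓡∂ 2) x).source) :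
    deriv γ t = chartSpeed β x t • chartDeriv φ x (β t) e1 := by
  have hd := (differentiableAt_chart_curve hβ ht).hasDerivAt
  have hψ : HasFDerivWithinAt (φ ∘ (extChartAt (𝓡∂ 2) x).symm) (chartDeriv φ x (β t)) halfPlane
      (extChartAt (𝓡∂ 2) x (β t)) :=
    (differentiableWithinAt_chart hφ.contMDiff_one
      ((extChartAt (𝓡∂ 2) x).map_source ht)).hasFDerivWithinAt
  have h := hψ.comp_hasDerivAt t hd (Filter.Eventually.of_forall fun s =>
    (mem_range_self _ : extChartAt (𝓡∂ 2) x (β s) ∈ halfPlane))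
  rw [deriv_chart_curve hβ hβM ht, map_smul] at h
  refine (h.congr_of_eventuallyEq ?_).deriv
  filter_upwards [eventually_curve_mem_source hβ.continuous ht] with s hs
  rw [Function.comp_apply, Function.comp_apply, (extChartAt (𝓡∂ 2) x).left_inv hs, hγ]

/-- The determinant of the normal vector, the inward direction of the chart at `x` and the velocity
of the boundary curve. Its sign tells whether the boundary curve runs along the orientation that
`N` induces on the boundary. -/
noncomputable def boundaryDet (φ N : M → E3) (β : ℝ → M) (γ : ℝ → E3) (x : M) (t : ℝ) : ℝ :=
  triple (N (β t)) (chartDeriv φ x (β t) e0) (deriv γ t)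

theorem boundaryDet_eq (hφ : IsSmoothImmersion φ) (hβ : ContMDiff 𝓘(ℝ, ℝ) (𝓡∂ 2) ∞ β)
    (hβM : range β = (𝓡∂ 2).boundary M) (hγ : ∀ t, φ (β t) = γ t) {x : M} {t : ℝ}
    (ht : β t ∈ (extChartAt (𝓡∂ 2) x).source) :
    boundaryDet φ N β γ x t = chartSpeed β x t * areaDensity φ N x (β t) := by
  rw [boundaryDet, deriv_boundary_curve hφ hβ hβM hγ ht, triple_smul_right, areaDensity]

theorem chartSpeed_ne_zero (hφ : IsSmoothImmersion φ) (hβ : ContMDiff 𝓘(ℝ, ℝ) (𝓡∂ 2) ∞ β)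
    (hβM : range β = (𝓡∂ 2).boundary M) (hγ : ∀ t, φ (β t) = γ t) (hγ' : ∀ t, deriv γ t ≠ 0)
    {x : M} {t : ℝ} (ht : β t ∈ (extChartAt (𝓡∂ 2) x).source) : chartSpeed β x t ≠ 0 := by
  intro h
  apply hγ' t
  rw [deriv_boundary_curve hφ hβ hβM hγ ht, h, zero_smul]

theorem IsGaussMap.boundaryDet_ne_zero (hN : IsGaussMap φ N) (hφ : IsSmoothImmersion φ)
    (hβ : ContMDiff 𝓘(ℝ, ℝ) (𝓡∂ 2) ∞ β)
    (hβM : range β = (𝓡∂ 2).boundary M) (hγ : ∀ t, φ (β t) = γ t) (hγ' : ∀ t, deriv γ t ≠ 0)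
    {x : M} {t : ℝ} (ht : β t ∈ (extChartAt (𝓡∂ 2) x).source) : boundaryDet φ N β γ x t ≠ 0 := by
  rw [boundaryDet_eq hφ hβ hβM hγ ht]
  exact mul_ne_zero (chartSpeed_ne_zero hφ hβ hβM hγ hγ' ht) (hN.areaDensity_ne_zero hφ ht)

/-- At a boundary point, a change of charts maps the inward direction to an inward direction. -/
theorem tangentCoordChange_inward_nonneg {x z p : M} (hx : p ∈ (extChartAt (𝓡∂ 2) x).source)
    (hz : p ∈ (extChartAt (𝓡∂ 2) z).source) (hp : p ∈ (𝓡∂ 2).boundary M) :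
    0 ≤ tangentCoordChange (𝓡∂ 2) x z p e0 0 := by
  have hτ := hasFDerivWithinAt_tangentCoordChange (I := 𝓡∂ 2) (x := x) (y := z) ⟨hx, hz⟩
  have h0 := (EuclideanSpace.proj (𝕜 := ℝ) (0 : Fin 2)).hasFDerivAt.comp_hasFDerivWithinAt _ hτ
  have hmin : IsLocalMinOn (EuclideanSpace.proj (𝕜 := ℝ) (0 : Fin 2) ∘
      (extChartAt (𝓡∂ 2) z ∘ (extChartAt (𝓡∂ 2) x).symm)) halfPlane (extChartAt (𝓡∂ 2) x p) := by
    -- `extChartAt` takes values in the half-plane even outside the domain of the chart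
    refine Filter.Eventually.of_forall fun y => ?_
    simp only [Function.comp_apply, (extChartAt (𝓡∂ 2) x).left_inv hx]
    have h1 : extChartAt (𝓡∂ 2) z p 0 = 0 := extChartAt_boundary_zero hz hp
    have h2 : 0 ≤ extChartAt (𝓡∂ 2) z ((extChartAt (𝓡∂ 2) x).symm y) 0 :=
      mem_halfPlane.1 (mem_range_self _)
    exact h1.le.trans h2
  refine hmin.hasFDerivWithinAt_nonneg h0 ?_
  apply mem_posTangentConeAt_of_segment_subset
  have hxR := target_subset_halfPlane x ((extChartAt (𝓡∂ 2) x).map_source hx)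
  refine convex_halfPlane.segment_subset hxR ?_
  rw [mem_halfPlane] at hxR ⊢
  simp only [PiLp.add_apply, PiLp.single_apply, if_true]
  linarith

/-- The sign of `boundaryDet` does not depend on the chart: the tangential part of the transformed
inward direction is parallel to the velocity of the boundary curve, so it does not contribute. -/
theorem IsGaussMap.sign_boundaryDet_eq (hN : IsGaussMap φ N) (hφ : IsSmoothImmersion φ)
    (hβ : ContMDiff 𝓘(ℝ, ℝ) (𝓡∂ 2) ∞ β)
    (hβM : range β = (𝓡∂ 2).boundary M) (hγ : ∀ t, φ (β t) = γ t) (hγ' : ∀ t, deriv γ t ≠ 0)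
    {x z : M} {t : ℝ} (hx : β t ∈ (extChartAt (𝓡∂ 2) x).source)
    (hz : β t ∈ (extChartAt (𝓡∂ 2) z).source) :
    SignType.sign (boundaryDet φ N β γ x t) = SignType.sign (boundaryDet φ N β γ z t) := by
  set A := tangentCoordChange (𝓡∂ 2) x z (β t) e0 0
  have hA : 0 ≤ A := tangentCoordChange_inward_nonneg hx hz (hβM ▸ mem_range_self t)
  have h : boundaryDet φ N β γ x t = A * boundaryDet φ N β γ z t := by
    simp only [boundaryDet]
    rw [chartDeriv_eq_comp hφ.contMDiff_one hx hz, ContinuousLinearMap.comp_apply,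
      clm_E2_apply (chartDeriv φ z (β t)), deriv_boundary_curve hφ hβ hβM hγ hz]
    simp only [triple_eq, PiLp.add_apply, PiLp.smul_apply, smul_eq_mul]
    ring
  have hne := hN.boundaryDet_ne_zero hφ hβ hβM hγ hγ' hx
  have hA' : 0 < A := hA.lt_of_ne fun h0 => hne (by rw [h, ← h0, zero_mul])
  rw [h, sign_mul, sign_pos hA', one_mul]

theorem IsGaussMap.continuousAt_boundaryDet (hN : IsGaussMap φ N) (hφ : IsSmoothImmersion φ)
    (hβ : ContMDiff 𝓘(ℝ, ℝ) (𝓡∂ 2) ∞ β) (hγc : Continuous (deriv γ)) {x : M} {t : ℝ}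
    (hx : β t ∈ (extChartAt (𝓡∂ 2) x).source) : ContinuousAt (boundaryDet φ N β γ x) t := by
  have h : ContinuousAt (fun s => chartDeriv φ x (β s)) t :=
    (continuousAt_chartDeriv hφ.contMDiff_one hx).comp hβ.continuous.continuousAt
  have h1 : Continuous fun s => N (β s) := hN.continuous.comp hβ.continuous
  exact h1.continuousAt.triple (h.clm_apply continuousAt_const) hγc.continuousAt

/-- The boundary curve runs all along with, or all against, the orientation induced by `N`. -/
theorem IsGaussMap.exists_boundary_sign (hN : IsGaussMap φ N) (hφ : IsSmoothImmersion φ)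
    (hβ : ContMDiff 𝓘(ℝ, ℝ) (𝓡∂ 2) ∞ β) (hγc : Continuous (deriv γ))
    (hβM : range β = (𝓡∂ 2).boundary M) (hγ : ∀ t, φ (β t) = γ t) (hγ' : ∀ t, deriv γ t ≠ 0) :
    ∃ ε : ℝ, |ε| = 1 ∧ ∀ (x : M) (t : ℝ), β t ∈ (extChartAt (𝓡∂ 2) x).source →
      (SignType.sign (boundaryDet φ N β γ x t) : ℝ) = ε := by
  set σ : ℝ → SignType := fun t => SignType.sign (boundaryDet φ N β γ (β t) t) with hσ
  have hsrc : ∀ t, β t ∈ (extChartAt (𝓡∂ 2) (β t)).source := fun t => mem_extChartAt_source _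
  have hloc : IsLocallyConstant σ := by
    rw [IsLocallyConstant.iff_eventually_eq]
    intro t
    have hc := hN.continuousAt_boundaryDet hφ hβ hγc (hsrc t)
    have hne := hN.boundaryDet_ne_zero hφ hβ hβM hγ hγ' (hsrc t)
    have hev : ∀ᶠ s in nhds t, SignType.sign (boundaryDet φ N β γ (β t) s) = σ t := by
      rcases hne.lt_or_gt with h | h
      · filter_upwards [hc.eventually (gt_mem_nhds h)] with s hs
        exact (sign_neg hs).trans (sign_neg h).symm
      · filter_upwards [hc.eventually (lt_mem_nhds h)] with s hs
        exact (sign_pos hs).trans (sign_pos h).symm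
    filter_upwards [hev, eventually_curve_mem_source hβ.continuous (hsrc t)] with s hs hs'
    rw [← hs]
    exact hN.sign_boundaryDet_eq hφ hβ hβM hγ hγ' (hsrc s) hs'
  refine ⟨(σ 0 : ℝ), ?_, fun x t ht => ?_⟩
  · have hne := hN.boundaryDet_ne_zero hφ hβ hβM hγ hγ' (hsrc 0)
    rcases hne.lt_or_gt with h | h
    · simp [hσ, sign_neg h]
    · simp [hσ, sign_pos h]
  · rw [hN.sign_boundaryDet_eq hφ hβ hβM hγ hγ' ht (hsrc t)]
    exact congrArg _ (hloc.apply_eq_of_preconnectedSpace t 0)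

/-- The boundary term of Stokes' theorem in a chart, as an integral along the boundary curve. The
part of the curve in the chart is injectively mapped to the line `y 0 = 0`, and the absolute value
in the change of variables combines with the orientation sign of the chart to the sign `ε`. -/
theorem integral_signedField_boundary (hφ : IsSmoothImmersion φ)
    (hβ : ContMDiff 𝓘(ℝ, ℝ) (𝓡∂ 2) ∞ β) (hper : Function.Periodic β 1) (hinj : InjOn β (Ico 0 1))
    (hβM : range β = (𝓡∂ 2).boundary M) (hγ : ∀ t, φ (β t) = γ t) {x : M} {ε : ℝ}
    (hε : ∀ t, β t ∈ (extChartAt (𝓡∂ 2) x).source →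
      (SignType.sign (boundaryDet φ N β γ x t) : ℝ) = ε)
    (hVx : tsupport V ⊆ (extChartAt (𝓡∂ 2) x).source) :
    ∫ v : ℝ, ⟪signedField φ N V x (planePt 0 v), partialD 1 (localParam φ x) (planePt 0 v)⟫ =
      ε * ∫ t in Ico (0 : ℝ) 1, ⟪V (β t), deriv γ t⟫ := by
  set T : Set ℝ := Ico 0 1 ∩ β ⁻¹' (extChartAt (𝓡∂ 2) x).source with hT
  set f : ℝ → ℝ := fun t => extChartAt (𝓡∂ 2) x (β t) 1 with hf
  have hTm : MeasurableSet T := measurableSet_Ico.inter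
    ((isOpen_extChartAt_source x).preimage hβ.continuous).measurableSet
  have hpt : ∀ t ∈ T, planePt 0 (f t) = extChartAt (𝓡∂ 2) x (β t) := by
    intro t ht
    rw [← planePt_eta (extChartAt (𝓡∂ 2) x (β t)),
      extChartAt_boundary_zero ht.2 (hβM ▸ mem_range_self t)]
  have hfd : ∀ t ∈ T, HasDerivWithinAt f (chartSpeed β x t) T t := by
    intro t ht
    exact ((EuclideanSpace.proj (𝕜 := ℝ) (1 : Fin 2)).hasFDerivAt.comp_hasDerivAt t
      (differentiableAt_chart_curve hβ ht.2).hasDerivAt).hasDerivWithinAt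
  have hfinj : InjOn f T := by
    intro t ht s hs hts
    have h : extChartAt (𝓡∂ 2) x (β t) = extChartAt (𝓡∂ 2) x (β s) := by
      rw [← hpt t ht, ← hpt s hs, hts]
    exact hinj ht.1 hs.1 ((extChartAt (𝓡∂ 2) x).injOn ht.2 hs.2 h)
  have himage : ∀ v, v ∉ f '' T →
      ⟪signedField φ N V x (planePt 0 v), partialD 1 (localParam φ x) (planePt 0 v)⟫ = 0 := by
    intro v hv
    have hvt : planePt 0 v ∉ (extChartAt (𝓡∂ 2) x).target := by
      intro h
      have hb : (extChartAt (𝓡∂ 2) x).symm (planePt 0 v) ∈ range β := by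
        rw [hβM, symm_mem_boundary_iff h, planePt_zero]
      obtain ⟨t', ht'⟩ := hb
      obtain ⟨t, ht, htt⟩ := hper.exists_mem_Ico₀ one_pos t'
      have hβt : β t = (extChartAt (𝓡∂ 2) x).symm (planePt 0 v) := by rw [← htt, ht']
      refine hv ⟨t, ⟨ht, ?_⟩, ?_⟩
      · rw [mem_preimage, hβt]; exact (extChartAt (𝓡∂ 2) x).map_target h
      · rw [hf]
        simp only
        rw [hβt, (extChartAt (𝓡∂ 2) x).right_inv h, planePt_one]
    rw [signedField_eq_zero, inner_zero_left]
    rintro ⟨q, hq, hqv⟩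
    exact hvt (hqv ▸ (extChartAt (𝓡∂ 2) x).map_source (hVx hq))
  rw [← setIntegral_eq_integral_of_forall_compl_eq_zero himage,
    integral_image_eq_integral_abs_deriv_smul hTm hfd hfinj, ← integral_const_mul,
    setIntegral_eq_of_subset_of_forall_sdiff_eq_zero measurableSet_Ico
      (inter_subset_left : T ⊆ Ico 0 1)]
  · refine setIntegral_congr_fun hTm fun t ht => ?_
    have htt := (extChartAt (𝓡∂ 2) x).map_source ht.2
    beta_reduce
    rw [hpt t ht, signedField_of_mem htt, (extChartAt (𝓡∂ 2) x).left_inv ht.2,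
      partialD_localParam_one, ← hε t ht.2, boundaryDet_eq hφ hβ hβM hγ ht.2, sign_mul,
      deriv_boundary_curve hφ hβ hβM hγ ht.2, real_inner_smul_left, real_inner_smul_right,
      smul_eq_mul, ← sign_mul_self]
    push_cast
    ring
  · intro t ht
    have hV0 : V (β t) = 0 := image_eq_zero_of_notMem_tsupport fun h => ht.2 ⟨ht.1, hVx h⟩
    rw [hV0, inner_zero_left, mul_zero]

variable [CompactSpace M] [T2Space M] [MeasurableSpace M] [BorelSpace M]

/-- Stokes' theorem for the `1`-form `⟪V, dφ⟫` on a compact oriented surface whose boundary is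
parametrized by a single closed curve. The curve may run along either orientation of the boundary,
hence the sign `ε`, which does not depend on `V`. -/
theorem IsGaussMap.exists_stokes (hN : IsGaussMap φ N) (hφ : IsSmoothImmersion φ)
    (hβ : ContMDiff 𝓘(ℝ, ℝ) (𝓡∂ 2) ∞ β) (hper : Function.Periodic β 1) (hinj : InjOn β (Ico 0 1))
    (hβM : range β = (𝓡∂ 2).boundary M) (hγ : ∀ t, φ (β t) = γ t) (hγc : Continuous (deriv γ))
    (hγ' : ∀ t, deriv γ t ≠ 0) :
    ∃ ε : ℝ, |ε| = 1 ∧ ∀ V : M → E3, ContMDiff (𝓡∂ 2) 𝓘(ℝ, E3) 1 V →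
      ∫ p, surfaceCurl φ N V p ∂(areaMeasure φ) =
        ε * ∫ t in Ico (0 : ℝ) 1, ⟪V (β t), deriv γ t⟫ := by
  obtain ⟨ε, hε, hεx⟩ := hN.exists_boundary_sign hφ hβ hγc hβM hγ hγ'
  refine ⟨-ε, by rwa [abs_neg], fun V hV => ?_⟩
  have hfin := hN.isFiniteMeasure hφ
  obtain ⟨s, hs⟩ := isCompact_univ.elim_finite_subcover
    (fun x : M => (extChartAt (𝓡∂ 2) x).source) (fun x => isOpen_extChartAt_source x)
    (fun x _ => mem_iUnion.2 ⟨x, mem_extChartAt_source x⟩)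
  obtain ⟨ρ, hρ⟩ := SmoothPartitionOfUnity.exists_isSubordinate (𝓡∂ 2) isClosed_univ
    (fun i : s => (extChartAt (𝓡∂ 2) (i : M)).source) (fun i => isOpen_extChartAt_source _)
    (fun x hx => by
      obtain ⟨i, hi, hxi⟩ := mem_iUnion₂.1 (hs hx)
      exact mem_iUnion.2 ⟨⟨i, hi⟩, hxi⟩)
  set W : s → M → E3 := fun i p => ρ i p • V p with hW
  have hWc : ∀ i, ContMDiff (𝓡∂ 2) 𝓘(ℝ, E3) 1 (W i) := fun i =>
    ((ρ i).contMDiff.of_le (by norm_cast)).smul hV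
  have hWs : ∀ i, tsupport (W i) ⊆ (extChartAt (𝓡∂ 2) (i : M)).source := fun i =>
    (tsupport_smul_subset_left _ _).trans (hρ i)
  have hsum : ∀ p, ∑ i, W i p = V p := by
    intro p
    have h := ρ.sum_eq_one (mem_univ p)
    rw [finsum_eq_sum_of_fintype] at h
    simp only [hW]
    rw [← Finset.sum_smul, h, one_smul]
  have hVW : (fun q => ∑ i, W i q) = V := funext hsum
  have hcurl : ∀ p, surfaceCurl φ N V p = ∑ i, surfaceCurl φ N (W i) p := by
    intro p
    rw [← surfaceCurl_sum Finset.univ W hWc, hVW]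
  simp only [hcurl]
  rw [integral_finsetSum _ fun i _ =>
    (hN.continuous_surfaceCurl hφ (hWc i)).integrable_of_hasCompactSupport
      (HasCompactSupport.of_compactSpace _)]
  have hloc : ∀ i : s, ∫ p, surfaceCurl φ N (W i) p ∂(areaMeasure φ) =
      -ε * ∫ t in Ico (0 : ℝ) 1, ⟪W i (β t), deriv γ t⟫ := by
    intro i
    rw [hN.integral_surfaceCurl_chart hφ (hWc i) (hWs i),
      integral_signedField_boundary hφ hβ hper hinj hβM hγ (hεx i) (hWs i), neg_mul]
  simp only [hloc]
  rw [← Finset.mul_sum, ← integral_finsetSum]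
  · congr 1
    refine setIntegral_congr_fun measurableSet_Ico fun t _ => ?_
    beta_reduce
    rw [← sum_inner, hsum]
  · intro i _
    have hc : Continuous fun t => ⟪W i (β t), deriv γ t⟫ :=
      ((hWc i).continuous.comp hβ.continuous).inner hγc
    exact (hc.integrableOn_Icc (a := 0) (b := 1)).mono_set Ico_subset_Icc_self

end Boundary

/-! ### The area bound -/

section AreaBound

variable {M : Type*} [TopologicalSpace M] [ChartedSpace (EuclideanHalfSpace 2) M]
  {φ N : M → E3} {a : E3} {α : ℝ}

theorem fderivWithin_eq_zero_of_eqOn_target {f : E2 → ℝ} {x : M} {c : ℝ} {y : E2}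
    (hy : y ∈ (extChartAt (𝓡∂ 2) x).target) (hf : ∀ z ∈ (extChartAt (𝓡∂ 2) x).target, f z = c) :
    fderivWithin ℝ f halfPlane y = 0 := by
  have h : f =ᶠ[nhdsWithin y halfPlane] fun _ => c := by
    filter_upwards [target_mem_nhdsWithin hy] with z hz using hf z hz
  rw [h.fderivWithin_eq (hf y hy)]
  simp

variable [IsManifold (𝓡∂ 2) ∞ M]

theorem IsGaussMap.contMDiff_one (hN : IsGaussMap φ N) (hφ : IsSmoothImmersion φ) :
    ContMDiff (𝓡∂ 2) 𝓘(ℝ, E3) 1 N := (hN.contMDiff hφ).of_le (by norm_cast)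

theorem IsGaussMap.inner_chartDeriv_self (hN : IsGaussMap φ N) (hφ : IsSmoothImmersion φ) (p : M)
    (e : E2) : ⟪N p, chartDeriv N p p e⟫ = 0 := by
  have hy := mem_extChartAt_target (I := 𝓡∂ 2) p
  have hd := differentiableWithinAt_chart (hN.contMDiff_one hφ) hy
  have h := fderivWithin_inner_halfPlane hd hd (target_subset_halfPlane p hy) e
  have hone : ∀ z ∈ (extChartAt (𝓡∂ 2) p).target, ⟪(N ∘ (extChartAt (𝓡∂ 2) p).symm) z,
      (N ∘ (extChartAt (𝓡∂ 2) p).symm) z⟫ = 1 := fun z _ => hN.inner_self _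
  rw [fderivWithin_eq_zero_of_eqOn_target hy hone, zero_apply,
    Function.comp_apply, extChartAt_to_inv, real_inner_comm (N p)] at h
  change 0 = ⟪N p, chartDeriv N p p e⟫ + ⟪N p, chartDeriv N p p e⟫ at h
  linarith

/-- The Weingarten relations `⟪N_j, φ_i⟫ = -⟪φ_ij, N⟫`. -/
theorem IsGaussMap.inner_chartDeriv_partialD (hN : IsGaussMap φ N) (hφ : IsSmoothImmersion φ)
    (p : M) (i j : Fin 2) :
    ⟪chartDeriv N p p (EuclideanSpace.single j 1), chartDeriv φ p p (EuclideanSpace.single i 1)⟫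
      = -secondForm (localParam φ p) (N p) (extChartAt (𝓡∂ 2) p p) i j := by
  have hy := mem_extChartAt_target (I := 𝓡∂ 2) p
  have hd := differentiableWithinAt_chart (hN.contMDiff_one hφ) hy
  have hd2 := (hφ.contDiffWithinAt_partialD i hy).differentiableWithinAt (by simp)
  have h := fderivWithin_inner_halfPlane hd hd2 (target_subset_halfPlane p hy)
    (EuclideanSpace.single j 1)
  have hzero : ∀ z ∈ (extChartAt (𝓡∂ 2) p).target,
      ⟪(N ∘ (extChartAt (𝓡∂ 2) p).symm) z, partialD i (localParam φ p) z⟫ = 0 := by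
    intro z hz
    have := hN.inner_chartDeriv hφ ((extChartAt (𝓡∂ 2) p).map_target hz)
      (EuclideanSpace.single i 1)
    rw [chartDeriv, (extChartAt (𝓡∂ 2) p).right_inv hz] at this
    exact this
  rw [fderivWithin_eq_zero_of_eqOn_target hy hzero, zero_apply,
    Function.comp_apply, extChartAt_to_inv] at h
  rw [secondForm, real_inner_comm (N p)]
  change 0 = ⟪N p, partialD j (partialD i (localParam φ p)) (extChartAt (𝓡∂ 2) p p)⟫ +
    ⟪chartDeriv N p p (EuclideanSpace.single j 1),
      chartDeriv φ p p (EuclideanSpace.single i 1)⟫ at h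
  linarith

/-- The field `⟪φ, a⟫ N × a`. The `1`-form `⟪V, dφ⟫` is dual to the gradient of `⟪φ, a⟫² / 2`. -/
noncomputable def heightField (φ N : M → E3) (a : E3) (p : M) : E3 := ⟪φ p, a⟫ • cross3 (N p) a

theorem IsGaussMap.contMDiff_heightField (hN : IsGaussMap φ N) (hφ : IsSmoothImmersion φ) :
    ContMDiff (𝓡∂ 2) 𝓘(ℝ, E3) 1 (heightField φ N a) := by
  have h1 : ContMDiff (𝓡∂ 2) 𝓘(ℝ, ℝ) 1 fun p => ⟪φ p, a⟫ :=
    (contDiff_id.inner ℝ contDiff_const : ContDiff ℝ 1 fun q : E3 => ⟪q, a⟫).contMDiff.comp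
      hφ.contMDiff_one
  have h2 : ContMDiff (𝓡∂ 2) 𝓘(ℝ, E3) 1 fun p => cross3 (N p) a :=
    (cross3.flip a).contDiff.contMDiff.comp (hN.contMDiff_one hφ)
  exact h1.smul h2

theorem IsGaussMap.chartDeriv_heightField (hN : IsGaussMap φ N) (hφ : IsSmoothImmersion φ) (p : M)
    (e : E2) : chartDeriv (heightField φ N a) p p e =
      ⟪φ p, a⟫ • cross3 (chartDeriv N p p e) a + ⟪chartDeriv φ p p e, a⟫ • cross3 (N p) a := by
  have hy := mem_extChartAt_target (I := 𝓡∂ 2) p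
  have hd1 := (differentiableWithinAt_chart hφ.contMDiff_one hy).hasFDerivWithinAt
  have hd2 := (differentiableWithinAt_chart (hN.contMDiff_one hφ) hy).hasFDerivWithinAt
  have h1 := ((innerSL ℝ).flip a).hasFDerivAt.comp_hasFDerivWithinAt _ hd1
  have h2 := (cross3.flip a).hasFDerivAt.comp_hasFDerivWithinAt _ hd2
  have h := (h1.smul h2).fderivWithin ((𝓡∂ 2).uniqueDiffOn _ (target_subset_halfPlane p hy))
  have h3 := congrArg (fun L : E2 →L[ℝ] E3 => L e) h
  refine Eq.trans h3 ?_
  simp only [add_apply, smul_apply, ContinuousLinearMap.comp_apply,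
    ContinuousLinearMap.smulRight_apply, Function.comp_apply, extChartAt_to_inv]
  rfl

/-- `div (h ∇h) = 1 + (α - 1) ⟪N, a⟫²` for the height `h` on a singular minimal surface. -/
theorem IsGaussMap.surfaceCurl_heightField (hN : IsGaussMap φ N) (hφ : IsSmoothImmersion φ)
    (ha : ‖a‖ = 1) (hpos : ∀ p, 0 < ⟪φ p, a⟫) (p : M)
    (hH : 2 * meanCurvature φ N p p = α * (⟪N p, a⟫ / ⟪φ p, a⟫)) :
    surfaceCurl φ N (heightField φ N a) p = 1 + (α - 1) * ⟪N p, a⟫ ^ 2 := by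
  have hp := mem_extChartAt_source (I := 𝓡∂ 2) p
  have hJ := hN.areaDensity_ne_zero hφ hp
  apply mul_right_cancel₀ hJ
  rw [← hN.surfaceCurl_mul hφ (hN.contMDiff_heightField hφ) hp,
    hN.chartDeriv_heightField hφ, hN.chartDeriv_heightField hφ]
  have hf : secondForm (localParam φ p) (N p) (extChartAt (𝓡∂ 2) p p) 1 0 =
      secondForm (localParam φ p) (N p) (extChartAt (𝓡∂ 2) p p) 0 1 := by
    rw [secondForm, secondForm, hφ.partialD_comm (mem_extChartAt_target p)]
  have key := curl_height_algebra (a := a) (h := ⟪φ p, a⟫) (α := α)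
    (by rw [real_inner_self_eq_norm_sq, ha, one_pow]) (hN.inner_self p)
    (hN.inner_chartDeriv hφ hp e0) (hN.inner_chartDeriv hφ hp e1)
    (hN.inner_chartDeriv_self hφ p e0) (hN.inner_chartDeriv_self hφ p e1)
    (hN.inner_chartDeriv_partialD hφ p 0 0)
    ((hN.inner_chartDeriv_partialD hφ p 1 0).trans (by rw [hf]))
    (hN.inner_chartDeriv_partialD hφ p 0 1) (hN.inner_chartDeriv_partialD hφ p 1 1)
    hJ (hpos p).ne' hH
  rw [areaDensity, ← key]
  simp only [inner_add_left, real_inner_smul_left, triple]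
  ring

variable [CompactSpace M] [T2Space M] [MeasurableSpace M] [BorelSpace M] {γ : ℝ → E3}

/-- The area bound, with any bound `C` for the height of the boundary curve. -/
theorem surfaceArea_le (hα : 1 ≤ α) (ha : ‖a‖ = 1) (hγ : IsClosedCurve γ)
    (hφ : IsSingularMinimal α a φ) (hbd : HasBoundaryCurve φ γ) {C : ℝ}
    (hC : ∀ t, ⟪γ t, a⟫ ≤ C) :
    surfaceArea φ ≤ ENNReal.ofReal (curveLength γ * C) := by
  obtain ⟨N, hN, hH⟩ := hφ.equation
  obtain ⟨β, hβ, hper, hinj, hβM, hβγ⟩ := hbd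
  have hi := hφ.immersion
  have hγc : Continuous (deriv γ) := hγ.smooth.continuous_deriv (by simp)
  have hfin := hN.isFiniteMeasure hi
  obtain ⟨ε, hε, hstokes⟩ :=
    hN.exists_stokes hi hβ hper hinj hβM hβγ hγc hγ.deriv_ne_zero
  have hV := hN.contMDiff_heightField (a := a) hi
  have h1 : ∀ p, 1 ≤ surfaceCurl φ N (heightField φ N a) p := by
    intro p
    rw [hN.surfaceCurl_heightField hi ha hφ.inner_pos p (hH p p (mem_chart_source _ p))]
    nlinarith [sq_nonneg ⟪N p, a⟫]
  have hint : Integrable (surfaceCurl φ N (heightField φ N a)) (areaMeasure φ) :=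
    (hN.continuous_surfaceCurl hi hV).integrable_of_hasCompactSupport
      (HasCompactSupport.of_compactSpace _)
  have h2 : (areaMeasure φ).real univ ≤
      ∫ p, surfaceCurl φ N (heightField φ N a) p ∂(areaMeasure φ) := by
    calc (areaMeasure φ).real univ = ∫ _, (1 : ℝ) ∂(areaMeasure φ) := by simp
      _ ≤ _ := integral_mono (integrable_const 1) hint h1
  have h3 : ∀ t, |⟪heightField φ N a (β t), deriv γ t⟫| ≤ C * ‖deriv γ t‖ := by
    intro t
    rw [heightField, real_inner_smul_left, abs_mul, abs_of_pos (hφ.inner_pos _), hβγ]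
    have hpos : 0 < ⟪γ t, a⟫ := hβγ t ▸ hφ.inner_pos (β t)
    exact mul_le_mul (hC t) (abs_triple_le _ _ _ (hN.norm_eq_one _) ha) (abs_nonneg _)
      (hpos.le.trans (hC t))
  have h4 : ε * ∫ t in Ico (0 : ℝ) 1, ⟪heightField φ N a (β t), deriv γ t⟫ ≤ curveLength γ * C := by
    have hint2 : IntegrableOn (fun t => C * ‖deriv γ t‖) (Ico 0 1) :=
      ((continuous_const.mul hγc.norm).integrableOn_Icc (a := 0) (b := 1)).mono_set
        Ico_subset_Icc_self
    calc ε * ∫ t in Ico (0 : ℝ) 1, ⟪heightField φ N a (β t), deriv γ t⟫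
        ≤ |ε * ∫ t in Ico (0 : ℝ) 1, ⟪heightField φ N a (β t), deriv γ t⟫| := le_abs_self _
      _ = ‖∫ t in Ico (0 : ℝ) 1, ⟪heightField φ N a (β t), deriv γ t⟫‖ := by
          rw [abs_mul, hε, one_mul, Real.norm_eq_abs]
      _ ≤ ∫ t in Ico (0 : ℝ) 1, C * ‖deriv γ t‖ :=
          norm_integral_le_of_norm_le hint2 (Filter.Eventually.of_forall h3)
      _ = curveLength γ * C := by
          rw [integral_const_mul, curveLength, intervalIntegral.integral_of_le zero_le_one,
            integral_Ico_eq_integral_Ioo, integral_Ioc_eq_integral_Ioo, mul_comm]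
  rw [surfaceArea, ← ofReal_measureReal]
  exact ENNReal.ofReal_le_ofReal (h2.trans ((hstokes _ hV).trans_le h4))

end AreaBound

/-! ### The winding number of a smooth simple closed curve in the plane -/

section CauchyIntegral

variable {γ : ℝ → ℂ}

/-- `∫ dz / (z - q)` along the arc of `γ` over `[a, b]`. -/
noncomputable def cauchyIntegral (γ : ℝ → ℂ) (a b : ℝ) (q : ℂ) : ℂ :=
  ∫ t in a..b, deriv γ t / (γ t - q)

/-- A point off an arc has a neighbourhood at a positive distance from the arc. -/
theorem exists_ball_away (hγ : Continuous γ) {a b : ℝ} {q : ℂ} (hq : ∀ t ∈ uIcc a b, γ t ≠ q) :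
    ∃ d > 0, ∀ t ∈ uIcc a b, ∀ z ∈ Metric.ball q d, d ≤ ‖γ t - z‖ := by
  have hc : IsClosed (γ '' uIcc a b) := (isCompact_uIcc.image hγ).isClosed
  have hnm : q ∈ (γ '' uIcc a b)ᶜ := by
    rintro ⟨t, ht, h⟩; exact hq t ht h
  obtain ⟨d, hd, hball⟩ := Metric.isOpen_iff.1 hc.isOpen_compl q hnm
  refine ⟨d / 2, by positivity, fun t ht z hz => ?_⟩
  by_contra! h
  refine hball (?_ : γ t ∈ Metric.ball q d) ⟨t, ht, rfl⟩
  rw [Metric.mem_ball, dist_eq_norm] at hz ⊢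
  calc ‖γ t - q‖ = ‖(γ t - z) + (z - q)‖ := by congr 1; ring
    _ ≤ ‖γ t - z‖ + ‖z - q‖ := norm_add_le _ _
    _ < d := by linarith

/-- The derivative of the Cauchy integral in `q`; it vanishes for a closed curve. -/
theorem hasDerivAt_cauchyIntegral (hγ : ContDiff ℝ 1 γ) {a b : ℝ} {q : ℂ}
    (hq : ∀ t ∈ uIcc a b, γ t ≠ q) :
    HasDerivAt (cauchyIntegral γ a b) ((γ a - q)⁻¹ - (γ b - q)⁻¹) q := by
  have hγc := hγ.continuous
  have hγ'c : Continuous (deriv γ) := hγ.continuous_deriv le_rfl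
  obtain ⟨d, hd, hball⟩ := exists_ball_away hγc hq
  have hne : ∀ t ∈ uIcc a b, ∀ z ∈ Metric.ball q d, γ t - z ≠ 0 := fun t ht z hz =>
    norm_pos_iff.1 (hd.trans_le (hball t ht z hz))
  have hcont : ∀ z ∈ Metric.ball q d, ContinuousOn (fun t => deriv γ t / (γ t - z)) (uIcc a b) :=
    fun z hz => hγ'c.continuousOn.div (hγc.continuousOn.sub continuousOn_const)
      fun t ht => hne t ht z hz
  have hqm := Metric.mem_ball_self (x := q) hd
  have hcont2 : ContinuousOn (fun t => deriv γ t / (γ t - q) ^ 2) (uIcc a b) :=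
    hγ'c.continuousOn.div ((hγc.continuousOn.sub continuousOn_const).pow 2)
      fun t ht => pow_ne_zero 2 (hne t ht q hqm)
  have h := intervalIntegral.hasDerivAt_integral_of_dominated_loc_of_deriv_le (μ := volume)
    (F := fun z t => deriv γ t / (γ t - z)) (F' := fun z t => deriv γ t / (γ t - z) ^ 2)
    (bound := fun t => ‖deriv γ t‖ / d ^ 2) (a := a) (b := b)
    (Metric.ball_mem_nhds q hd)
    (by
      filter_upwards [Metric.ball_mem_nhds q hd] with z hz
      exact ((hcont z hz).mono uIoc_subset_uIcc).aestronglyMeasurable measurableSet_uIoc)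
    ((hcont q hqm).intervalIntegrable)
    ((hcont2.mono uIoc_subset_uIcc).aestronglyMeasurable measurableSet_uIoc)
    (Filter.Eventually.of_forall fun t ht z hz => by
      have h1 := hball t (uIoc_subset_uIcc ht) z hz
      rw [norm_div, norm_pow]
      gcongr)
    ((hγ'c.norm.div_const _).intervalIntegrable _ _)
    (Filter.Eventually.of_forall fun t ht z hz => by
      have h1 : HasDerivAt (fun w => γ t - w) (-1) z := by
        simpa using (hasDerivAt_id z).const_sub (γ t)
      have h2 := (h1.inv (hne t (uIoc_subset_uIcc ht) z hz)).const_mul (deriv γ t)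
      simpa [div_eq_mul_inv] using h2)
  have hFTC : ∫ t in a..b, deriv γ t / (γ t - q) ^ 2 = (γ a - q)⁻¹ - (γ b - q)⁻¹ := by
    rw [intervalIntegral.integral_eq_sub_of_hasDerivAt (f := fun t => -(γ t - q)⁻¹)
      (fun t ht => ?_) hcont2.intervalIntegrable]
    · ring
    · have h1 : HasDerivAt (fun s => γ s - q) (deriv γ t) t :=
        ((hγ.differentiable one_ne_zero) t).hasDerivAt.sub_const q
      have h2 := (h1.inv (hne t ht q hqm)).neg
      exact h2.congr_deriv (by rw [neg_div, neg_neg])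
  rw [← hFTC]
  exact h.2

end CauchyIntegral

theorem Function.Periodic.apply_fract {f : ℝ → ℂ} (hf : Function.Periodic f 1) (u : ℝ) :
    f (Int.fract u) = f u := by
  have := hf.sub_zsmul_eq (x := u) ⌊u⌋
  rwa [zsmul_one, Int.self_sub_floor] at this

/-- A closed `C¹` curve in the complex plane with nonvanishing velocity, of period `1` and injective
on a period. -/
structure IsJordanCurve (γ : ℝ → ℂ) : Prop where
  contDiff : ContDiff ℝ 1 γ
  periodic : Function.Periodic γ 1
  deriv_ne_zero : ∀ t, deriv γ t ≠ 0
  injOn : InjOn γ (Ico 0 1)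

namespace IsJordanCurve

variable {γ : ℝ → ℂ} (h : IsJordanCurve γ)
include h

theorem continuous : Continuous γ := h.contDiff.continuous

theorem continuous_deriv : Continuous (deriv γ) := h.contDiff.continuous_deriv le_rfl

theorem hasDerivAt (t : ℝ) : HasDerivAt γ (deriv γ t) t :=
  ((h.contDiff.differentiable one_ne_zero) t).hasDerivAt

theorem periodic_deriv : Function.Periodic (deriv γ) 1 := by
  intro t
  have h1 : (fun s => γ (s + 1)) = γ := funext h.periodic
  rw [← deriv_comp_add_const, h1]

theorem range_eq : range γ = γ '' Icc 0 1 := by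
  refine Subset.antisymm ?_ (image_subset_range _ _)
  rintro _ ⟨t, rfl⟩
  obtain ⟨s, hs, hst⟩ := h.periodic.exists_mem_Ico₀ one_pos t
  exact ⟨s, Ico_subset_Icc_self hs, hst.symm⟩

theorem isCompact_range : IsCompact (range γ) := by
  rw [h.range_eq]; exact isCompact_Icc.image h.continuous

theorem exists_int_of_eq {s t : ℝ} (hst : γ s = γ t) : ∃ n : ℤ, s - t = n := by
  have h1 : Int.fract s = Int.fract t := h.injOn ⟨Int.fract_nonneg s, Int.fract_lt_one s⟩
    ⟨Int.fract_nonneg t, Int.fract_lt_one t⟩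
    (by rw [h.periodic.apply_fract, h.periodic.apply_fract, hst])
  exact Int.fract_eq_fract.1 h1

theorem exists_deriv_lower : ∃ m > 0, ∀ t, m ≤ ‖deriv γ t‖ := by
  obtain ⟨t₀, _, ht₀⟩ := isCompact_Icc.exists_isMinOn (nonempty_Icc.2 zero_le_one)
    (h.continuous_deriv.norm.continuousOn (s := Icc (0 : ℝ) 1))
  refine ⟨‖deriv γ t₀‖, norm_pos_iff.2 (h.deriv_ne_zero t₀), fun t => ?_⟩
  obtain ⟨s, hs, hst⟩ := h.periodic_deriv.exists_mem_Ico₀ one_pos t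
  rw [hst]
  exact ht₀ (Ico_subset_Icc_self hs)

theorem exists_deriv_upper : ∃ C > 0, ∀ t, ‖deriv γ t‖ ≤ C := by
  obtain ⟨C, hC⟩ := isCompact_Icc.exists_bound_of_continuousOn
    (h.continuous_deriv.continuousOn (s := Icc (0 : ℝ) 1))
  refine ⟨max C 1, by positivity, fun t => ?_⟩
  obtain ⟨s, hs, hst⟩ := h.periodic_deriv.exists_mem_Ico₀ one_pos t
  rw [hst]
  exact (hC s (Ico_subset_Icc_self hs)).trans (le_max_left _ _)

/-- Short chords are almost tangent to the curve, uniformly. -/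
theorem exists_chord_bound {c : ℝ} (hc : 0 < c) : ∃ η > 0, η < 1 / 2 ∧ ∀ t ∈ Ico (0 : ℝ) 1, ∀ s,
    |s - t| ≤ η → ‖γ s - γ t - ((s - t : ℝ) : ℂ) * deriv γ t‖ ≤ c * |s - t| := by
  have huc : UniformContinuousOn (deriv γ) (Icc (-1) 2) :=
    isCompact_Icc.uniformContinuousOn_of_continuous h.continuous_deriv.continuousOn
  obtain ⟨η, hη, hηc⟩ := Metric.uniformContinuousOn_iff.1 huc c hc
  refine ⟨min (η / 2) (1 / 4), by positivity, (min_le_right _ _).trans_lt (by norm_num),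
    fun t ht s hs => ?_⟩
  have hmin1 := min_le_left (η / 2) (1 / 4)
  have hmin2 := min_le_right (η / 2) (1 / 4)
  have hd : ∀ u ∈ uIcc t s, HasDerivWithinAt (fun u : ℝ => γ u - (u : ℂ) * deriv γ t)
      (deriv γ u - deriv γ t) (uIcc t s) u := by
    intro u _
    have h1 : HasDerivAt (fun u : ℝ => (u : ℂ) * deriv γ t) (1 * deriv γ t) u :=
      (Complex.ofRealCLM.hasDerivAt (x := u)).mul_const _
    rw [one_mul] at h1
    exact ((h.hasDerivAt u).sub h1).hasDerivWithinAt
  have hb : ∀ u ∈ uIcc t s, ‖deriv γ u - deriv γ t‖ ≤ c := by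
    intro u hu
    have hut : |u - t| ≤ |s - t| := abs_sub_left_of_mem_uIcc hu
    have hu1 := abs_le.1 (hut.trans (hs.trans hmin2))
    have hdist : dist u t < η := by
      rw [Real.dist_eq]
      linarith
    have h3 := hηc u ⟨by linarith [ht.1], by linarith [ht.2]⟩ t
      ⟨by linarith [ht.1], by linarith [ht.2]⟩ hdist
    rw [dist_eq_norm] at h3
    exact h3.le
  have h2 := (convex_uIcc t s).norm_image_sub_le_of_norm_hasDerivWithin_le hd hb
    left_mem_uIcc right_mem_uIcc
  rw [Real.norm_eq_abs] at h2
  refine le_trans (le_of_eq ?_) h2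
  congr 1
  push_cast
  ring

/-- Small displacements along the normal do not meet the curve: a chord that is short in the
parameter is almost tangent, hence not normal, and the other chords are too long. -/
theorem exists_tube : ∃ δ > 0, ∀ t ε : ℝ, 0 < |ε| → |ε| < δ →
    γ t + ε * (Complex.I * deriv γ t) ∉ range γ := by
  obtain ⟨m, hm, hml⟩ := h.exists_deriv_lower
  obtain ⟨C, hC, hCu⟩ := h.exists_deriv_upper
  obtain ⟨η, hη, hη2, hchord⟩ := h.exists_chord_bound (c := m / 2) (by positivity)
  -- chords whose end points are not close in the parameter are bounded below
  have hfar : ∃ μ > 0, ∀ t ∈ Icc (0 : ℝ) 1, ∀ s, η ≤ |s - t| → |s - t| ≤ 1 / 2 →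
      μ ≤ ‖γ s - γ t‖ := by
    set K : Set (ℝ × ℝ) := {p | p.1 ∈ Icc (0 : ℝ) 1 ∧ η ≤ |p.2 - p.1| ∧ |p.2 - p.1| ≤ 1 / 2} with hK
    have hKc : IsCompact K := by
      refine (isCompact_Icc (a := ((0 : ℝ), (-1 : ℝ))) (b := (1, 2))).of_isClosed_subset ?_ ?_
      · have h1 : IsClosed {p : ℝ × ℝ | p.1 ∈ Icc (0 : ℝ) 1} := isClosed_Icc.preimage continuous_fst
        have h2 : IsClosed {p : ℝ × ℝ | η ≤ |p.2 - p.1|} :=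
          isClosed_le continuous_const (by fun_prop)
        have h3 : IsClosed {p : ℝ × ℝ | |p.2 - p.1| ≤ 1 / 2} :=
          isClosed_le (by fun_prop) continuous_const
        exact h1.inter (h2.inter h3)
      · rintro ⟨t, s⟩ ⟨ht, _, hs⟩
        have := abs_le.1 hs
        simp only at this ht
        exact ⟨⟨ht.1, by simp only; linarith [ht.1]⟩, ⟨ht.2, by simp only; linarith [ht.2]⟩⟩
    have hpos : ∀ p ∈ K, γ p.2 - γ p.1 ≠ 0 := by
      rintro ⟨t, s⟩ ⟨_, hs1, hs2⟩ h0
      obtain ⟨n, hn⟩ := h.exists_int_of_eq (sub_eq_zero.1 h0)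
      simp only at hn hs1 hs2
      rw [hn] at hs1 hs2
      have hn0 : n = 0 := by
        have h1 : |(n : ℝ)| < 1 := by linarith
        rw [← Int.cast_abs] at h1
        have h2 : |n| < 1 := by exact_mod_cast h1
        exact Int.abs_lt_one_iff.1 h2
      rw [hn0] at hs1
      simp at hs1
      linarith
    have hcont : Continuous fun p : ℝ × ℝ => ‖γ p.2 - γ p.1‖ := by
      have := h.continuous
      fun_prop
    by_cases hne : K.Nonempty
    · obtain ⟨p, hp, hpmin⟩ := hKc.exists_isMinOn hne hcont.continuousOn
      exact ⟨_, norm_pos_iff.2 (hpos p hp), fun t ht s h1 h2 =>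
        hpmin (show (t, s) ∈ K from ⟨ht, h1, h2⟩)⟩
    · exact ⟨1, one_pos, fun t ht s h1 h2 => (hne ⟨(t, s), ht, h1, h2⟩).elim⟩
  obtain ⟨μ, hμ, hμf⟩ := hfar
  refine ⟨μ / C, by positivity, fun t' ε hε hεδ hmem => ?_⟩
  obtain ⟨s', hs'⟩ := hmem
  -- by periodicity the parameters may be moved to `t ∈ [0, 1)` and `|s - t| ≤ 1 / 2`
  obtain ⟨t, ht, htt⟩ : ∃ t ∈ Ico (0 : ℝ) 1, γ t' = γ t ∧ deriv γ t' = deriv γ t := by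
    refine ⟨Int.fract t', ⟨Int.fract_nonneg _, Int.fract_lt_one _⟩,
      (h.periodic.apply_fract t').symm, (h.periodic_deriv.apply_fract t').symm⟩
  rw [htt.1, htt.2] at hs'
  obtain ⟨s, hst, hγs⟩ : ∃ s, |s - t| ≤ 1 / 2 ∧ γ s = γ s' := by
    refine ⟨s' - round (s' - t), ?_, ?_⟩
    · have := abs_sub_round (s' - t)
      rwa [show s' - round (s' - t) - t = s' - t - round (s' - t) by ring]
    · simpa using h.periodic.sub_zsmul_eq (x := s') (round (s' - t))
  rw [← hγs] at hs'
  have hdiff : γ s - γ t = ε * (Complex.I * deriv γ t) := by rw [hs']; ring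
  by_cases hnear : |s - t| ≤ η
  · have h1 := hchord t ht s hnear
    rw [hdiff, show (ε : ℂ) * (Complex.I * deriv γ t) - ((s - t : ℝ) : ℂ) * deriv γ t
      = (-((s - t : ℝ) : ℂ) + ε * Complex.I) * deriv γ t by ring, norm_mul] at h1
    have h2 : |s - t| ≤ ‖-((s - t : ℝ) : ℂ) + ε * Complex.I‖ := by
      have := Complex.abs_re_le_norm (-((s - t : ℝ) : ℂ) + ε * Complex.I)
      simpa [abs_sub_comm] using this
    have h2' : |ε| ≤ ‖-((s - t : ℝ) : ℂ) + ε * Complex.I‖ := by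
      have := Complex.abs_im_le_norm (-((s - t : ℝ) : ℂ) + ε * Complex.I)
      simpa using this
    have h3 := hml t
    have h4 : ‖-((s - t : ℝ) : ℂ) + ε * Complex.I‖ * m ≤ m / 2 * |s - t| :=
      (mul_le_mul_of_nonneg_left h3 (norm_nonneg _)).trans h1
    have h5 : ‖-((s - t : ℝ) : ℂ) + ε * Complex.I‖ ≤ |s - t| / 2 := by
      apply le_of_mul_le_mul_right _ hm
      linarith
    linarith [abs_nonneg (s - t)]
  · push Not at hnear
    have h1 := hμf t (Ico_subset_Icc_self ht) s hnear.le hst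
    rw [hdiff, norm_mul, norm_mul, Complex.norm_I, one_mul, Complex.norm_real,
      Real.norm_eq_abs] at h1
    have h2 : |ε| * ‖deriv γ t‖ ≤ |ε| * C := mul_le_mul_of_nonneg_left (hCu t) (abs_nonneg _)
    rw [lt_div_iff₀ hC] at hεδ
    linarith

/-- Every point lies on the normal at a nearest point of the curve. -/
theorem exists_normal_coordinate (q : ℂ) : ∃ t ε : ℝ, q = γ t + ε * (Complex.I * deriv γ t) ∧
    ∀ s, ‖q - γ t‖ ≤ ‖q - γ s‖ := by
  have hcont : Continuous fun t => ‖q - γ t‖ := (continuous_const.sub h.continuous).norm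
  obtain ⟨t, _, ht⟩ := isCompact_Icc.exists_isMinOn (nonempty_Icc.2 zero_le_one)
    (hcont.continuousOn (s := Icc (0 : ℝ) 1))
  have hmin : ∀ s, ‖q - γ t‖ ≤ ‖q - γ s‖ := by
    intro s
    obtain ⟨u, hu, hsu⟩ := h.periodic.exists_mem_Ico₀ one_pos s
    rw [hsu]
    exact ht (Ico_subset_Icc_self hu)
  have hd : HasDerivAt (fun s => ‖q - γ s‖ ^ 2) (2 * ⟪q - γ t, -deriv γ t⟫) t :=
    ((h.hasDerivAt t).const_sub q).norm_sq
  have hloc : IsLocalMin (fun s => ‖q - γ s‖ ^ 2) t :=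
    Filter.Eventually.of_forall fun s => pow_le_pow_left₀ (norm_nonneg _) (hmin s) 2
  have hz := hloc.hasDerivAt_eq_zero hd
  have hne := h.deriv_ne_zero t
  refine ⟨t, ((q - γ t) / deriv γ t).im, ?_, hmin⟩
  have hre : ((q - γ t) / deriv γ t).re = 0 := by
    rw [Complex.div_re, ← add_div]
    have : (q - γ t).re * (deriv γ t).re + (q - γ t).im * (deriv γ t).im = 0 := by
      rw [Complex.inner] at hz
      simp at hz
      simp
      linarith
    rw [this, zero_div]
  have h1 : (q - γ t) / deriv γ t = (((q - γ t) / deriv γ t).im : ℂ) * Complex.I := by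
    apply Complex.ext <;> simp [hre]
  rw [← mul_assoc, ← h1, div_mul_cancel₀ _ hne]
  ring

end IsJordanCurve

namespace IsJordanCurve

variable {γ : ℝ → ℂ} (h : IsJordanCurve γ)
include h

/-- The winding number, up to the factor `2πi`, is constant on connected sets off the curve. -/
theorem cauchyIntegral_eq_of_isPreconnected {S : Set ℂ} (hS : IsPreconnected S)
    (hSγ : S ⊆ (range γ)ᶜ) {p q : ℂ} (hp : p ∈ S) (hq : q ∈ S) :
    cauchyIntegral γ 0 1 p = cauchyIntegral γ 0 1 q := by
  have ho : IsOpen (range γ)ᶜ := h.isCompact_range.isClosed.isOpen_compl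
  set U := connectedComponentIn (range γ)ᶜ p with hU
  have hUo : IsOpen U := ho.connectedComponentIn
  have hd : ∀ z ∈ U, HasDerivAt (cauchyIntegral γ 0 1) 0 z := by
    intro z hz
    have h1 := hasDerivAt_cauchyIntegral h.contDiff (a := 0) (b := 1) (q := z) fun t _ ht =>
      (connectedComponentIn_subset _ _ hz) ⟨t, ht⟩
    have h2 : γ 1 = γ 0 := by simpa using h.periodic 0
    rwa [h2, sub_self] at h1
  exact hUo.is_const_of_deriv_eq_zero isPreconnected_connectedComponentIn
    (fun z hz => (hd z hz).differentiableAt.differentiableWithinAt) (fun z hz => (hd z hz).deriv)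
    (mem_connectedComponentIn (hSγ hp))
    (hS.subset_connectedComponentIn hp hSγ hq)

/-- Far away from the curve the winding number vanishes, as it is constant along the ray from `q` to
infinity, where it tends to zero. -/
theorem exists_far : ∃ R, 0 < R ∧ ∀ q : ℂ, R < ‖q‖ → cauchyIntegral γ 0 1 q = 0 ∧
    q ∉ range γ ∧ ¬ Bornology.IsBounded (connectedComponentIn (range γ)ᶜ q) := by
  obtain ⟨R, hR⟩ := h.isCompact_range.isBounded.exists_norm_le
  obtain ⟨C, hC, hCu⟩ := h.exists_deriv_upper
  refine ⟨max R 1, by positivity, fun q hq => ?_⟩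
  have hRq : R < ‖q‖ := (le_max_left _ _).trans_lt hq
  have h1q : 1 < ‖q‖ := (le_max_right _ _).trans_lt hq
  set ray : Set ℂ := (fun s : ℝ => (s : ℂ) * q) '' Ici 1 with hray
  have hpre : IsPreconnected ray := isPreconnected_Ici.image _ (by fun_prop)
  have hnorm : ∀ s : ℝ, 1 ≤ s → ‖(s : ℂ) * q‖ = s * ‖q‖ := fun s hs => by
    rw [norm_mul, Complex.norm_real, Real.norm_eq_abs, abs_of_nonneg (by linarith)]
  have hsub : ray ⊆ (range γ)ᶜ := by
    rintro _ ⟨s, hs, rfl⟩ hm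
    have h1 := hR _ hm
    simp only at h1
    rw [hnorm s hs] at h1
    have : (1 : ℝ) ≤ s := hs
    nlinarith
  have hqm : q ∈ ray := ⟨1, self_mem_Ici, by simp⟩
  refine ⟨?_, hsub hqm, ?_⟩
  · have hbound : ∀ s : ℝ, 1 ≤ s → R < s → ‖cauchyIntegral γ 0 1 q‖ ≤ C / (s - R) := by
      intro s hs hsR
      have hsm : (s : ℂ) * q ∈ ray := ⟨s, hs, rfl⟩
      rw [h.cauchyIntegral_eq_of_isPreconnected hpre hsub hqm hsm, cauchyIntegral]
      have hb : ∀ t ∈ uIoc (0 : ℝ) 1, ‖deriv γ t / (γ t - s * q)‖ ≤ C / (s - R) := by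
        intro t _
        have h1 := hR _ (mem_range_self t)
        have h2 : s - R ≤ ‖γ t - s * q‖ := by
          have := norm_sub_norm_le ((s : ℂ) * q) (γ t)
          rw [hnorm s hs, norm_sub_rev] at this
          nlinarith
        rw [norm_div]
        exact div_le_div₀ hC.le (hCu t) (by linarith) h2
      simpa using intervalIntegral.norm_integral_le_of_norm_le_const hb
    have hlim : Filter.Tendsto (fun s : ℝ => C / (s - R)) Filter.atTop (nhds 0) :=
      Filter.Tendsto.div_atTop tendsto_const_nhds
        (Filter.tendsto_atTop_add_const_right _ _ Filter.tendsto_id)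
    have hle : ‖cauchyIntegral γ 0 1 q‖ ≤ 0 := by
      refine ge_of_tendsto hlim ?_
      filter_upwards [Filter.eventually_ge_atTop 1, Filter.eventually_gt_atTop R] with s hs hsR
        using hbound s hs hsR
    exact norm_le_zero_iff.1 hle
  · intro hb
    have hb2 := hb.subset (hpre.subset_connectedComponentIn hqm hsub)
    obtain ⟨B, hB⟩ := hb2.exists_norm_le
    have h1 := hB _ (⟨max B 1 + 1, by
      have := le_max_right B 1
      rw [mem_Ici]; linarith, rfl⟩ : ((max B 1 + 1 : ℝ) : ℂ) * q ∈ ray)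
    have h2 := le_max_right B 1
    have h3 := le_max_left B 1
    rw [hnorm _ (by linarith)] at h1
    nlinarith


/-- The points displaced from the curve along its normal by a signed distance in `S`, measured in
units of the speed `‖γ'‖`. -/
noncomputable def _root_.normalStrip (γ : ℝ → ℂ) (S : Set ℝ) : Set ℂ :=
  (fun p : ℝ × ℝ => γ p.1 + p.2 * (Complex.I * deriv γ p.1)) '' (univ ×ˢ S)

theorem isPreconnected_normalStrip {S : Set ℝ} (hS : IsPreconnected S) :
    IsPreconnected (normalStrip γ S) := by
  refine (isPreconnected_univ.prod hS).image _ (Continuous.continuousOn ?_)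
  have h1 := h.continuous
  have h2 := h.continuous_deriv
  fun_prop

/-- Each component of the complement of the curve comes arbitrarily close to the curve; otherwise it
would be open and closed. -/
theorem exists_near (q : ℂ) (hq : q ∈ (range γ)ᶜ) {r : ℝ} (hr : 0 < r) :
    ∃ p ∈ connectedComponentIn (range γ)ᶜ q, ∃ t, ‖p - γ t‖ < r := by
  by_contra! hfar
  set U := connectedComponentIn (range γ)ᶜ q with hU
  have hUo : IsOpen U := h.isCompact_range.isClosed.isOpen_compl.connectedComponentIn
  have hqU : q ∈ U := mem_connectedComponentIn hq
  have hUc : IsClosed U := by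
    have hcl : closure U ⊆ (range γ)ᶜ := by
      rintro z hz ⟨t, rfl⟩
      obtain ⟨p, hp, hpz⟩ := Metric.mem_closure_iff.1 hz r hr
      have := hfar p hp t
      rw [dist_comm, dist_eq_norm] at hpz
      linarith
    have hsub : closure U ⊆ U :=
      isPreconnected_connectedComponentIn.closure.subset_connectedComponentIn
        (subset_closure hqU) hcl
    exact closure_subset_iff_isClosed.1 hsub
  have huniv : U = univ := IsClopen.eq_univ ⟨hUc, hUo⟩ ⟨q, hqU⟩
  have h0 : γ 0 ∈ U := by rw [huniv]; exact mem_univ _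
  exact connectedComponentIn_subset _ _ h0 (mem_range_self 0)

/-- The two sides of the curve: two connected strips off the curve, such that each component of the
complement contains one of them. -/
theorem exists_strips : ∃ δ > 0, normalStrip γ (Ioo 0 δ) ⊆ (range γ)ᶜ ∧
    normalStrip γ (Ioo (-δ) 0) ⊆ (range γ)ᶜ ∧ ∀ q ∈ (range γ)ᶜ,
      normalStrip γ (Ioo 0 δ) ⊆ connectedComponentIn (range γ)ᶜ q ∨
        normalStrip γ (Ioo (-δ) 0) ⊆ connectedComponentIn (range γ)ᶜ q := by
  obtain ⟨δ, hδ, htube⟩ := h.exists_tube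
  obtain ⟨m, hm, hml⟩ := h.exists_deriv_lower
  have hpos : normalStrip γ (Ioo 0 δ) ⊆ (range γ)ᶜ := by
    rintro _ ⟨⟨t, ε⟩, ⟨_, hε⟩, rfl⟩
    exact htube t ε (abs_pos.2 hε.1.ne') (by rw [abs_of_pos hε.1]; exact hε.2)
  have hneg : normalStrip γ (Ioo (-δ) 0) ⊆ (range γ)ᶜ := by
    rintro _ ⟨⟨t, ε⟩, ⟨_, hε⟩, rfl⟩
    exact htube t ε (abs_pos.2 hε.2.ne) (by rw [abs_of_neg hε.2]; linarith [hε.1])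
  refine ⟨δ, hδ, hpos, hneg, fun q hq => ?_⟩
  obtain ⟨p, hp, s, hps⟩ := h.exists_near q hq (r := δ * m) (by positivity)
  have hpγ := connectedComponentIn_subset _ _ hp
  obtain ⟨t, ε, hpt, hmin⟩ := h.exists_normal_coordinate p
  have hεδ : |ε| < δ := by
    have h1 := (hmin s).trans_lt hps
    have h2 : ‖p - γ t‖ = |ε| * ‖deriv γ t‖ := by
      rw [hpt, add_sub_cancel_left, norm_mul, norm_mul, Complex.norm_I, one_mul,
        Complex.norm_real, Real.norm_eq_abs]
    rw [h2] at h1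
    have h3 := mul_le_mul_of_nonneg_left (hml t) (abs_nonneg ε)
    exact lt_of_mul_lt_mul_right (h3.trans_lt h1) hm.le
  have hε0 : ε ≠ 0 := by
    rintro rfl
    exact hpγ ⟨t, by simpa using hpt.symm⟩
  have hcomp := connectedComponentIn_eq hp
  rw [abs_lt] at hεδ
  rcases hε0.lt_or_gt with hlt | hgt
  · right
    rw [hcomp]
    exact (h.isPreconnected_normalStrip isPreconnected_Ioo).subset_connectedComponentIn
      ⟨(t, ε), ⟨mem_univ _, hεδ.1, hlt⟩, hpt.symm⟩ hneg
  · left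
    rw [hcomp]
    exact (h.isPreconnected_normalStrip isPreconnected_Ioo).subset_connectedComponentIn
      ⟨(t, ε), ⟨mem_univ _, hgt, hεδ.2⟩, hpt.symm⟩ hpos

/-- On an arc that a factor `c` turns away from the negative real axis, seen from `q`, a branch of
the logarithm is a primitive. -/
theorem cauchyIntegral_eq_log {a b : ℝ} {q c : ℂ}
    (hslit : ∀ t ∈ uIcc a b, c * (γ t - q) ∈ Complex.slitPlane) :
    cauchyIntegral γ a b q = Complex.log (c * (γ b - q)) - Complex.log (c * (γ a - q)) := by
  have hne : ∀ t ∈ uIcc a b, c ≠ 0 ∧ γ t - q ≠ 0 := fun t ht =>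
    mul_ne_zero_iff.1 (Complex.slitPlane_ne_zero (hslit t ht))
  rw [cauchyIntegral]
  refine intervalIntegral.integral_eq_sub_of_hasDerivAt
    (f := fun t => Complex.log (c * (γ t - q))) (fun t ht => ?_)
    (ContinuousOn.intervalIntegrable ?_)
  · have h1 : HasDerivAt (fun s => c * (γ s - q)) (c * deriv γ t) t :=
      ((h.hasDerivAt t).sub_const q).const_mul c
    exact (h1.clog_real (hslit t ht)).congr_deriv (mul_div_mul_left _ _ (hne t ht).1)
  · exact h.continuous_deriv.continuousOn.div
      (h.continuous.continuousOn.sub continuousOn_const) fun t ht => (hne t ht).2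

omit h in
theorem _root_.Complex.log_sub_log_neg {z : ℂ} (hz : 0 < z.im) :
    Complex.log z - Complex.log (-z) = Real.pi * Complex.I := by
  simp only [Complex.log, norm_neg, Complex.arg_neg_eq_arg_sub_pi_of_im_pos hz]
  push_cast
  ring

/-- The winding number jumps by one across the curve. The integral over the arc away from `γ 0` is
continuous at `γ 0`. Over a short arc around `γ 0`, the normal at `γ 0` is turned onto the positive
real axis, and the limits on the two sides are differences of principal logarithms at opposite
points; each of the two end points contributes `πi` to the jump. -/
theorem tendsto_jump : Filter.Tendsto
    (fun ε : ℝ => cauchyIntegral γ 0 1 (γ 0 + ε * (Complex.I * deriv γ 0)) -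
      cauchyIntegral γ 0 1 (γ 0 + (-ε : ℝ) * (Complex.I * deriv γ 0)))
    (nhdsWithin 0 (Ioi 0)) (nhds (2 * Real.pi * Complex.I)) := by
  set τ := deriv γ 0 with hτ
  have hτ0 : τ ≠ 0 := h.deriv_ne_zero 0
  obtain ⟨δ, hδ, htube⟩ := h.exists_tube
  -- on a short arc around `0` the tangential coordinate of the curve is increasing
  obtain ⟨d, hd, hd4, hdre⟩ : ∃ d > 0, d ≤ 1 / 4 ∧ ∀ t ∈ Icc (-d) d, 0 < (deriv γ t / τ).re := by
    have hc : Continuous fun t => (deriv γ t / τ).re :=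
      Complex.continuous_re.comp (h.continuous_deriv.div_const τ)
    have h0 : 0 < (deriv γ 0 / τ).re := by rw [← hτ, div_self hτ0]; simp
    obtain ⟨r, hr, hball⟩ :=
      Metric.eventually_nhds_iff.1 (hc.continuousAt.eventually (lt_mem_nhds h0))
    have hm1 := min_le_left (r / 2) (1 / 4)
    refine ⟨min (r / 2) (1 / 4), by positivity, min_le_right _ _, fun t ht => hball ?_⟩
    rw [Real.dist_eq, sub_zero, abs_lt]
    exact ⟨by linarith [ht.1], by linarith [ht.2]⟩
  set ζ : ℝ → ℂ := fun t => (γ t - γ 0) / τ with hζ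
  have hζd : ∀ t, HasDerivAt (fun s => (ζ s).re) (deriv γ t / τ).re t := fun t =>
    Complex.reCLM.hasFDerivAt.comp_hasDerivAt t (((h.hasDerivAt t).sub_const (γ 0)).div_const τ)
  have hmono : StrictMonoOn (fun s => (ζ s).re) (Icc (-d) d) :=
    strictMonoOn_of_deriv_pos (convex_Icc _ _)
      (fun t _ => (hζd t).continuousAt.continuousWithinAt) fun t ht => by
        rw [(hζd t).deriv]; exact hdre t (interior_subset ht)
  have hζ0 : ζ 0 = 0 := by simp [hζ]
  have h0m : (0 : ℝ) ∈ Icc (-d) d := ⟨by linarith, hd.le⟩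
  have hpos : ∀ t ∈ Icc (-d) d, 0 < t → 0 < (ζ t).re := fun t ht h0t => by
    have := hmono h0m ht h0t
    simpa [hζ0] using this
  have hneg : ∀ t ∈ Icc (-d) d, t < 0 → (ζ t).re < 0 := fun t ht h0t => by
    have := hmono ht h0m h0t
    simpa [hζ0] using this
  -- the short arc, seen from the points `γ 0 + σ ε i τ` on the two sides
  have hshort : ∀ σ : ℝ, σ ^ 2 = 1 → ∀ ε : ℝ, 0 < ε →
      cauchyIntegral γ (-d) d (γ 0 + (σ * ε : ℝ) * (Complex.I * τ)) =
        Complex.log (σ * Complex.I * ζ d + ε) - Complex.log (σ * Complex.I * ζ (-d) + ε) := by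
    intro σ hσ ε hε
    have hval : ∀ t, σ * Complex.I / τ * (γ t - (γ 0 + (σ * ε : ℝ) * (Complex.I * τ))) =
        σ * Complex.I * ζ t + ε := by
      intro t
      have hσ' : (σ : ℂ) ^ 2 = 1 := by exact_mod_cast hσ
      simp only [hζ]
      push_cast
      field_simp
      linear_combination (-(Complex.I ^ 2 * ε * τ)) * hσ' - (ε * τ) * Complex.I_sq
    rw [h.cauchyIntegral_eq_log (c := σ * Complex.I / τ), hval, hval]
    intro t ht
    rw [uIcc_of_le (by linarith)] at ht
    rw [hval]
    have him : (σ * Complex.I * ζ t + ε).im = σ * (ζ t).re := by simp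
    have hσ0 : σ ≠ 0 := by rintro rfl; norm_num at hσ
    rcases lt_trichotomy t 0 with h1 | h1 | h1
    · exact Or.inr (by rw [him]; exact mul_ne_zero hσ0 (hneg t ht h1).ne)
    · left
      rw [h1, hζ0]
      simpa using hε
    · exact Or.inr (by rw [him]; exact mul_ne_zero hσ0 (hpos t ht h1).ne')
  have hsplit : ∀ ε : ℝ, 0 < |ε| → |ε| < δ →
      cauchyIntegral γ 0 1 (γ 0 + ε * (Complex.I * τ)) =
        cauchyIntegral γ (-d) d (γ 0 + ε * (Complex.I * τ)) +
          cauchyIntegral γ d (1 - d) (γ 0 + ε * (Complex.I * τ)) := by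
    intro ε h1 h2
    set q := γ 0 + ε * (Complex.I * τ)
    have hq : q ∉ range γ := htube 0 ε h1 h2
    have hcont : Continuous fun t => deriv γ t / (γ t - q) :=
      h.continuous_deriv.div (h.continuous.sub continuous_const) fun t h0 =>
        hq ⟨t, sub_eq_zero.1 h0⟩
    have hper : Function.Periodic (fun t => deriv γ t / (γ t - q)) 1 := fun t => by
      simp only
      rw [h.periodic_deriv, h.periodic]
    have h3 := hper.intervalIntegral_add_eq 0 (-d)
    rw [zero_add, show -d + 1 = 1 - d by ring] at h3
    rw [cauchyIntegral, h3, cauchyIntegral, cauchyIntegral,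
      intervalIntegral.integral_add_adjacent_intervals] <;> exact hcont.intervalIntegrable _ _
  -- the long arc stays away from `γ 0`
  have hlong : ContinuousAt (cauchyIntegral γ d (1 - d)) (γ 0) := by
    refine (hasDerivAt_cauchyIntegral h.contDiff fun t ht h0 => ?_).continuousAt
    rw [uIcc_of_le (by linarith)] at ht
    have := h.injOn ⟨by linarith [ht.1], by linarith [ht.2]⟩ ⟨le_rfl, one_pos⟩ h0
    linarith [ht.1]
  have hlog : ∀ z : ℂ, z.im ≠ 0 → Filter.Tendsto (fun ε : ℝ => Complex.log (z + ε))
      (nhdsWithin 0 (Ioi 0)) (nhds (Complex.log z)) := by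
    intro z hz
    have hc : ContinuousAt (fun ε : ℝ => Complex.log (z + ε)) 0 :=
      ContinuousAt.clog (by fun_prop) (Or.inr (by simpa using hz))
    have := hc.tendsto
    simp only [Complex.ofReal_zero, add_zero] at this
    exact this.mono_left nhdsWithin_le_nhds
  have hlongt : ∀ σ : ℝ, Filter.Tendsto
      (fun ε : ℝ => cauchyIntegral γ d (1 - d) (γ 0 + (σ * ε : ℝ) * (Complex.I * τ)))
      (nhdsWithin 0 (Ioi 0)) (nhds (cauchyIntegral γ d (1 - d) (γ 0))) := by
    intro σ
    refine hlong.tendsto.comp ?_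
    have hc : Continuous fun ε : ℝ => γ 0 + ((σ * ε : ℝ) : ℂ) * (Complex.I * τ) := by fun_prop
    have := hc.tendsto 0
    simp only [mul_zero, Complex.ofReal_zero, zero_mul, add_zero] at this
    exact this.mono_left nhdsWithin_le_nhds
  have hdp : 0 < (ζ d).re := hpos d ⟨by linarith, le_rfl⟩ hd
  have hdn : (ζ (-d)).re < 0 := hneg (-d) ⟨le_rfl, by linarith⟩ (by linarith)
  have hside : ∀ σ : ℝ, σ ^ 2 = 1 → Filter.Tendsto
      (fun ε : ℝ => cauchyIntegral γ 0 1 (γ 0 + (σ * ε : ℝ) * (Complex.I * τ)))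
      (nhdsWithin 0 (Ioi 0)) (nhds (Complex.log (σ * Complex.I * ζ d) -
        Complex.log (σ * Complex.I * ζ (-d)) + cauchyIntegral γ d (1 - d) (γ 0))) := by
    intro σ hσ
    have hσ0 : σ ≠ 0 := by rintro rfl; norm_num at hσ
    have hσa : |σ| = 1 := by rw [← sq_eq_sq₀ (abs_nonneg _) one_pos.le, sq_abs, hσ, one_pow]
    have hlim := ((hlog (σ * Complex.I * ζ d) (by simpa using ⟨hσ0, hdp.ne'⟩)).sub
      (hlog (σ * Complex.I * ζ (-d)) (by simpa using ⟨hσ0, hdn.ne⟩))).add (hlongt σ)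
    refine hlim.congr' ?_
    filter_upwards [Ioo_mem_nhdsGT hδ] with ε hε
    rw [hsplit (σ * ε) (by rw [abs_mul, hσa, one_mul]; exact abs_pos.2 hε.1.ne')
      (by rw [abs_mul, hσa, one_mul, abs_of_pos hε.1]; exact hε.2), hshort σ hσ ε hε.1]
  have hfin := (hside 1 (by norm_num)).sub (hside (-1) (by norm_num))
  have h1 := Complex.log_sub_log_neg (z := Complex.I * ζ d) (by simpa using hdp)
  have h2 := Complex.log_sub_log_neg (z := -(Complex.I * ζ (-d))) (by simpa using hdn)
  rw [neg_neg] at h2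
  convert hfin using 2
  · simp
  · simp only [Complex.ofReal_one, Complex.ofReal_neg, one_mul, neg_mul]
    linear_combination -h1 - h2

/-- In the bounded components of the complement of the curve the winding number does not vanish. -/
theorem cauchyIntegral_im_ne_zero {q : ℂ} (hq : q ∈ (range γ)ᶜ)
    (hb : Bornology.IsBounded (connectedComponentIn (range γ)ᶜ q)) :
    (cauchyIntegral γ 0 1 q).im ≠ 0 := by
  obtain ⟨R, hR, hfar⟩ := h.exists_far
  obtain ⟨δ, hδ, hpos, hneg, hcomp⟩ := h.exists_strips
  have hqfar : R < ‖((R + 1 : ℝ) : ℂ)‖ := by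
    rw [Complex.norm_real, Real.norm_eq_abs]
    exact (lt_add_one R).trans_le (le_abs_self _)
  obtain ⟨hz0, hzγ, hzb⟩ := hfar _ hqfar
  set z : ℂ := ((R + 1 : ℝ) : ℂ)
  have hmp : ∀ ε ∈ Ioo 0 δ, γ 0 + ε * (Complex.I * deriv γ 0) ∈ normalStrip γ (Ioo 0 δ) :=
    fun ε hε => ⟨(0, ε), ⟨mem_univ _, hε⟩, rfl⟩
  have hmn : ∀ ε ∈ Ioo 0 δ, γ 0 + (-ε : ℝ) * (Complex.I * deriv γ 0) ∈ normalStrip γ (Ioo (-δ) 0) :=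
    fun ε hε => ⟨(0, -ε), ⟨mem_univ _, by linarith [hε.2], by linarith [hε.1]⟩, rfl⟩
  have hδ2 : δ / 2 ∈ Ioo 0 δ := ⟨by positivity, by linarith⟩
  have hcomp_eq : ∀ {S : Set ℂ} {w p : ℂ}, w ∈ (range γ)ᶜ →
      S ⊆ connectedComponentIn (range γ)ᶜ w → p ∈ S →
      cauchyIntegral γ 0 1 p = cauchyIntegral γ 0 1 w := fun hw hS hp =>
    h.cauchyIntegral_eq_of_isPreconnected isPreconnected_connectedComponentIn
      (connectedComponentIn_subset _ _) (hS hp) (mem_connectedComponentIn hw)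
  have hne : ∀ {S : Set ℂ} {p : ℂ}, p ∈ S → S ⊆ connectedComponentIn (range γ)ᶜ q →
      ¬ S ⊆ connectedComponentIn (range γ)ᶜ z := by
    intro S p hp hSq hSz
    rw [connectedComponentIn_eq (hSq hp)] at hb
    rw [connectedComponentIn_eq (hSz hp)] at hzb
    exact hzb hb
  have hlim : ∀ w : ℂ, (∀ ε ∈ Ioo 0 δ, cauchyIntegral γ 0 1 (γ 0 + ε * (Complex.I * deriv γ 0)) -
      cauchyIntegral γ 0 1 (γ 0 + (-ε : ℝ) * (Complex.I * deriv γ 0)) = w) →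
      w = 2 * Real.pi * Complex.I := by
    intro w hw
    refine tendsto_nhds_unique (tendsto_const_nhds.congr' ?_) h.tendsto_jump
    filter_upwards [Ioo_mem_nhdsGT hδ] with ε hε
    exact (hw ε hε).symm
  have hpi := Real.pi_pos
  rcases hcomp q hq with hq1 | hq1
  · have hz1 := (hcomp z hzγ).resolve_left (hne (hmp _ hδ2) hq1)
    have := hlim (cauchyIntegral γ 0 1 q) fun ε hε => by
      rw [hcomp_eq hq hq1 (hmp ε hε), hcomp_eq hzγ hz1 (hmn ε hε), hz0, sub_zero]
    rw [this]
    simp [hpi.ne']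
  · have hz1 := (hcomp z hzγ).resolve_right (hne (hmn _ hδ2) hq1)
    have := hlim (-cauchyIntegral γ 0 1 q) fun ε hε => by
      rw [hcomp_eq hq hq1 (hmn ε hε), hcomp_eq hzγ hz1 (hmp ε hε), hz0, zero_sub]
    rw [neg_eq_iff_eq_neg.1 this]
    simp [hpi.ne']

end IsJordanCurve

/-! ### Orthogonal projection to a plane -/

/-- Euclidean coordinates `P` on the planes orthogonal to the unit vector `a`, with inverse `ι` on
each plane; the determinant of the projections of two vectors is at most the area of the
parallelogram that they span. -/
theorem exists_planeCoord {a : E3} (ha : ‖a‖ = 1) : ∃ P : E3 →L[ℝ] E2,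
    (∀ u v, ((P u) 0 * (P v) 1 - (P v) 0 * (P u) 1) ^ 2 ≤ ⟪u, u⟫ * ⟪v, v⟫ - ⟪u, v⟫ ^ 2) ∧
    ∀ c, ∃ ι : E2 → E3, Isometry ι ∧ (∀ y, ι y ∈ heightPlane a c) ∧ (∀ y, P (ι y) = y) ∧
      ∀ q ∈ heightPlane a c, ι (P q) = q := by
  have hv : Orthonormal ℝ (({0} : Set (Fin 3)).domRestrict fun _ => a) :=
    ⟨fun _ => ha, fun i j hij => absurd (Subsingleton.elim i j) hij⟩
  obtain ⟨b, hb⟩ := hv.exists_orthonormalBasis_extension_of_card_eq (by simp)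
  have hb0 : b 0 = a := hb 0 rfl
  have hinn : ∀ i j, ⟪b i, b j⟫ = if i = j then (1 : ℝ) else 0 :=
    orthonormal_iff_ite.1 b.orthonormal
  have hsum : ∀ q : E3, q = ⟪b 0, q⟫ • b 0 + ⟪b 1, q⟫ • b 1 + ⟪b 2, q⟫ • b 2 := fun q => by
    conv_lhs => rw [← b.sum_repr' q, Fin.sum_univ_three]
  set P : E3 →L[ℝ] E2 := (innerSL ℝ (b 1)).smulRight e0 + (innerSL ℝ (b 2)).smulRight e1 with hP
  have hP0 : ∀ q, (P q) 0 = ⟪b 1, q⟫ := fun q => by simp [hP, e0, e1]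
  have hP1 : ∀ q, (P q) 1 = ⟪b 2, q⟫ := fun q => by simp [hP, e0, e1]
  refine ⟨P, fun u v => ?_, fun c => ⟨fun y => c • b 0 + y 0 • b 1 + y 1 • b 2, ?_, ?_, ?_, ?_⟩⟩
  · refine le_trans (le_of_eq ?_) (triple_sq_le u v ha)
    have h1 : triple a (b 1) (b 2) ^ 2 = 1 := by
      rw [← hb0, triple_sq] <;> simp [hinn]
    have h2 : triple a u v * triple a (b 1) (b 2) =
        ⟪b 1, u⟫ * ⟪b 2, v⟫ - ⟪b 1, v⟫ * ⟪b 2, u⟫ := by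
      rw [triple_mul_triple, ← hb0, real_inner_comm (b 1) u, real_inner_comm (b 2) u,
        real_inner_comm (b 1) v, real_inner_comm (b 2) v]
      simp only [hinn]
      simp
      ring
    rw [hP0, hP1, hP0, hP1, ← h2, mul_pow, h1, mul_one]
  · refine Isometry.of_dist_eq fun x y => ?_
    have h : c • b 0 + x 0 • b 1 + x 1 • b 2 - (c • b 0 + y 0 • b 1 + y 1 • b 2) =
      (x 0 - y 0) • b 1 + (x 1 - y 1) • b 2 := by module
    rw [dist_eq_norm, dist_eq_norm x y, h, EuclideanSpace.norm_eq (x - y), Fin.sum_univ_two,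
      norm_eq_sqrt_real_inner]
    congr 1
    simp only [inner_add_left, inner_add_right, real_inner_smul_left, real_inner_smul_right, hinn]
    simp
    ring
  · intro y
    have : a = b 0 := hb0.symm
    simp [heightPlane, this, inner_add_left, real_inner_smul_left, hinn]
  · intro y
    ext i
    fin_cases i
    · simp [hP0, hinn]
    · simp [hP1, hinn]
  · intro q hq
    have hc : c = ⟪b 0, q⟫ := by rw [hb0, real_inner_comm]; exact hq.symm
    beta_reduce
    rw [hP0, hP1, hc]
    exact (hsum q).symm

section Projection

variable {M : Type*} [TopologicalSpace M] [ChartedSpace (EuclideanHalfSpace 2) M]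
  [IsManifold (𝓡∂ 2) ∞ M] [CompactSpace M] [MeasurableSpace M] [BorelSpace M] {φ N : M → E3}

theorem volume_image_le_areaMeasure_of_subset_source (hN : IsGaussMap φ N)
    (hφ : IsSmoothImmersion φ) {P : E3 →L[ℝ] E2} (hP : ∀ u v,
      ((P u) 0 * (P v) 1 - (P v) 0 * (P u) 1) ^ 2 ≤ ⟪u, u⟫ * ⟪v, v⟫ - ⟪u, v⟫ ^ 2)
    (x : M) {S : Set M} (hS : MeasurableSet S) (hSx : S ⊆ (extChartAt (𝓡∂ 2) x).source) :
    volume ((fun p => P (φ p)) '' S) ≤ areaMeasure φ S := by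
  rw [hN.areaMeasure_apply hφ x hS hSx, chartMeasure_apply φ x hS]
  set A := (extChartAt (𝓡∂ 2) x).symm ⁻¹' S ∩ (extChartAt (𝓡∂ 2) x).target with hA
  have hAm : MeasurableSet A := measurableSet_symm_preimage x hS
  have himage : (fun p => P (φ p)) '' S ⊆ (P ∘ localParam φ x) '' A := by
    rintro _ ⟨p, hp, rfl⟩
    have h := (extChartAt (𝓡∂ 2) x).left_inv (hSx hp)
    refine ⟨extChartAt (𝓡∂ 2) x p, ⟨by rwa [mem_preimage, h],
      (extChartAt (𝓡∂ 2) x).map_source (hSx hp)⟩, ?_⟩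
    simp only [localParam, Function.comp_apply, h]
  have hd : ∀ y ∈ A, HasFDerivWithinAt (P ∘ localParam φ x)
      (P ∘L fderivWithin ℝ (localParam φ x) halfPlane y) A y := fun y hy =>
    (P.hasFDerivAt.comp_hasFDerivWithinAt y
      (differentiableWithinAt_chart hφ.contMDiff_one hy.2).hasFDerivWithinAt).mono
      fun w hw => target_subset_halfPlane x hw.2
  calc volume ((fun p => P (φ p)) '' S) ≤ volume ((P ∘ localParam φ x) '' A) := measure_mono himage
    _ ≤ ∫⁻ y in A, ENNReal.ofReal |(P ∘L fderivWithin ℝ (localParam φ x) halfPlane y).det| :=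
        addHaar_image_le_lintegral_abs_det_fderiv volume hAm hd
    _ ≤ ∫⁻ y in A, chartDensity φ x y := by
        refine setLIntegral_mono' hAm fun y hy => ENNReal.ofReal_le_ofReal ?_
        refine Real.abs_le_sqrt ?_
        rw [det_E2]
        exact hP _ _

/-- A projection does not increase area, even though the projected surface may overlap itself. -/
theorem volume_image_le_surfaceArea (hN : IsGaussMap φ N)
    (hφ : IsSmoothImmersion φ) {P : E3 →L[ℝ] E2} (hP : ∀ u v,
      ((P u) 0 * (P v) 1 - (P v) 0 * (P u) 1) ^ 2 ≤ ⟪u, u⟫ * ⟪v, v⟫ - ⟪u, v⟫ ^ 2) :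
    volume (range fun p => P (φ p)) ≤ surfaceArea φ := by
  obtain ⟨s, hs, hcov⟩ := countable_cover_nhds_of_sigmaCompact
    (f := fun z : M => (extChartAt (𝓡∂ 2) z).source) fun z => extChartAt_source_mem_nhds z
  rcases isEmpty_or_nonempty M with hM | hM
  · rw [range_eq_empty]; simp
  have hne : s.Nonempty := by
    by_contra h
    rw [not_nonempty_iff_eq_empty] at h
    rw [h] at hcov
    simp only [mem_empty_iff_false, iUnion_of_empty, iUnion_empty] at hcov
    exact empty_ne_univ hcov
  obtain ⟨t, rfl⟩ := hs.exists_eq_range hne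
  rw [biUnion_range] at hcov
  set D : ℕ → Set M := disjointed fun n => (extChartAt (𝓡∂ 2) (t n)).source with hD
  have hDm : ∀ n, MeasurableSet (D n) := MeasurableSet.disjointed fun n => measurableSet_source _
  have hDuniv : ⋃ n, D n = univ := by rw [hD, iUnion_disjointed, hcov]
  rw [← image_univ, ← hDuniv, image_iUnion, surfaceArea, ← hDuniv,
    measure_iUnion (disjoint_disjointed _) hDm]
  exact (measure_iUnion_le _).trans (ENNReal.tsum_le_tsum fun n =>
    volume_image_le_areaMeasure_of_subset_source hN hφ hP (t n) (hDm n) (disjointed_subset _ n))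

end Projection

/-! ### The surface covers the domain bounded by its boundary curve -/

section Covering

variable {M : Type*} [TopologicalSpace M] [ChartedSpace (EuclideanHalfSpace 2) M]
  {φ N : M → E3}

/-- The vector of `E3` dual to the real linear form `v ↦ Im (z ζ(v))`. -/
noncomputable def imDual (ζ : E3 →L[ℝ] ℂ) : ℂ →L[ℝ] E3 :=
  ContinuousLinearMap.adjoint ζ ∘L
    (ContinuousLinearMap.mul ℝ ℂ Complex.I ∘L (Complex.conjCLE : ℂ →L[ℝ] ℂ))

theorem inner_imDual (ζ : E3 →L[ℝ] ℂ) (z : ℂ) (v : E3) : ⟪imDual ζ z, v⟫ = (z * ζ v).im := by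
  rw [imDual, ContinuousLinearMap.comp_apply, ContinuousLinearMap.adjoint_inner_left]
  simp [Complex.inner]
  ring

/-- The field representing the angular form `Im (dζ / (ζ - w))` along the surface. -/
noncomputable def angularField (φ : M → E3) (ζ : E3 →L[ℝ] ℂ) (w : ℂ) (p : M) : E3 :=
  imDual ζ (ζ (φ p) - w)⁻¹

theorem contMDiff_angularField (hφ : IsSmoothImmersion φ) {ζ : E3 →L[ℝ] ℂ} {w : ℂ}
    (hw : ∀ p, ζ (φ p) ≠ w) : ContMDiff (𝓡∂ 2) 𝓘(ℝ, E3) 1 (angularField φ ζ w) := by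
  intro p
  have h : ContDiffAt ℝ 1 (fun q : E3 => imDual ζ (ζ q - w)⁻¹) (φ p) :=
    (imDual ζ).contDiff.contDiffAt.comp _
      ((ζ.contDiff.contDiffAt.sub contDiffAt_const).inv (sub_ne_zero.2 (hw p)))
  exact h.contMDiffAt.comp p (hφ.contMDiff_one p)

variable [IsManifold (𝓡∂ 2) ∞ M]

/-- The angular form is closed: its derivative `-Im (ζ(u) ζ(v) / (ζ - w)²)` is symmetric in `u` and
`v`. -/
theorem surfaceCurl_angularField (hφ : IsSmoothImmersion φ) {ζ : E3 →L[ℝ] ℂ} {w : ℂ}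
    (hw : ∀ p, ζ (φ p) ≠ w) (p : M) : surfaceCurl φ N (angularField φ ζ w) p = 0 := by
  have hy := mem_extChartAt_target (I := 𝓡∂ 2) p
  have hd := (differentiableWithinAt_chart hφ.contMDiff_one hy).hasFDerivWithinAt
  have hne : ζ (φ p) - w ≠ 0 := sub_ne_zero.2 (hw p)
  have h : ∀ e, chartDeriv (angularField φ ζ w) p p e =
      imDual ζ (-ζ (chartDeriv φ p p e) / (ζ (φ p) - w) ^ 2) := by
    intro e
    have h1 := (ζ.hasFDerivAt.comp_hasFDerivWithinAt _ hd).sub_const w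
    have h2 : HasFDerivAt (𝕜 := ℝ) (fun z : ℂ => z⁻¹) _ (ζ (φ p) - w) :=
      (hasFDerivAt_inv hne).restrictScalars ℝ
    have h4 : (ζ ∘ φ ∘ (extChartAt (𝓡∂ 2) p).symm) (extChartAt (𝓡∂ 2) p p) - w = ζ (φ p) - w := by
      simp only [Function.comp_apply, extChartAt_to_inv]
    rw [← h4] at h2
    have h3 := ((imDual ζ).hasFDerivAt.comp_hasFDerivWithinAt _
      (h2.comp_hasFDerivWithinAt (extChartAt (𝓡∂ 2) p p) h1)).fderivWithin
        ((𝓡∂ 2).uniqueDiffOn _ (target_subset_halfPlane p hy))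
    refine (congrArg (fun L : E2 →L[ℝ] E3 => L e) h3).trans ?_
    simp only [ContinuousLinearMap.comp_apply, h4]
    congr 1
    simp [chartDeriv]
    ring
  rw [surfaceCurl, h, h, inner_imDual, inner_imDual, ← Complex.sub_im]
  have : -ζ (chartDeriv φ p p e0) / (ζ (φ p) - w) ^ 2 * ζ (chartDeriv φ p p e1) -
      -ζ (chartDeriv φ p p e1) / (ζ (φ p) - w) ^ 2 * ζ (chartDeriv φ p p e0) = 0 := by ring
  rw [this]
  simp

variable [CompactSpace M] [T2Space M] [MeasurableSpace M] [BorelSpace M] {γ : ℝ → E3}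

/-- The projection of the boundary curve does not wind around a point that the projection of the
surface omits. -/
theorem cauchyIntegral_im_eq_zero (hN : IsGaussMap φ N) (hφ : IsSmoothImmersion φ)
    (hγ : IsClosedCurve γ) (hbd : HasBoundaryCurve φ γ) {ζ : E3 →L[ℝ] ℂ} {w : ℂ}
    (hw : ∀ p, ζ (φ p) ≠ w) : (cauchyIntegral (fun t => ζ (γ t)) 0 1 w).im = 0 := by
  obtain ⟨β, hβ, hper, hinj, hβM, hβγ⟩ := hbd
  have hγc : Continuous (deriv γ) := hγ.smooth.continuous_deriv (by simp)
  obtain ⟨ε, hε, hstokes⟩ := hN.exists_stokes hφ hβ hper hinj hβM hβγ hγc hγ.deriv_ne_zero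
  have h := hstokes _ (contMDiff_angularField hφ hw)
  simp only [surfaceCurl_angularField hφ hw, integral_zero] at h
  have hε0 : ε ≠ 0 := by
    rintro rfl
    simp at hε
  have h1 := (mul_eq_zero.1 h.symm).resolve_left hε0
  have hd : ∀ t, deriv (fun t => ζ (γ t)) t = ζ (deriv γ t) := fun t =>
    (ζ.hasFDerivAt.comp_hasDerivAt t
      ((hγ.smooth.differentiable (by simp)) t).hasDerivAt).deriv
  have hne : ∀ t, ζ (γ t) - w ≠ 0 := fun t => sub_ne_zero.2 (hβγ t ▸ hw (β t))
  have hint : IntegrableOn (fun t => ζ (deriv γ t) / (ζ (γ t) - w)) (Ico 0 1) := by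
    have hc : Continuous fun t => ζ (deriv γ t) / (ζ (γ t) - w) :=
      (ζ.continuous.comp hγc).div
        ((ζ.continuous.comp hγ.smooth.continuous).sub continuous_const) hne
    exact (hc.integrableOn_Icc (a := 0) (b := 1)).mono_set Ico_subset_Icc_self
  rw [cauchyIntegral, intervalIntegral.integral_of_le zero_le_one, integral_Ioc_eq_integral_Ioo,
    ← integral_Ico_eq_integral_Ioo]
  simp only [hd]
  have h2 := integral_im (𝕜 := ℂ) hint
  refine Eq.trans h2.symm (Eq.trans ?_ h1)
  refine setIntegral_congr_fun measurableSet_Ico fun t _ => ?_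
  beta_reduce
  rw [angularField, inner_imDual, hβγ, div_eq_inv_mul]
  rfl

/-- In Euclidean coordinates `P` of the plane, the projection of the surface covers the domain
bounded by the boundary curve. -/
theorem IsDomainBoundedBy.image_subset {a : E3} {c : ℝ} {Ω : Set E3}
    (hΩ : IsDomainBoundedBy (heightPlane a c) (range γ) Ω)
    (hN : IsGaussMap φ N) (hφ : IsSmoothImmersion φ) (hγ : IsClosedCurve γ)
    (hbd : HasBoundaryCurve φ γ) (hinj : InjOn γ (Ico 0 1)) (hplane : range γ ⊆ heightPlane a c)
    {P : E3 →L[ℝ] E2} (hP : ∀ c', ∃ ι : E2 → E3, Isometry ι ∧ (∀ y, ι y ∈ heightPlane a c') ∧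
      (∀ y, P (ι y) = y) ∧ ∀ q ∈ heightPlane a c', ι (P q) = q) :
    P '' Ω ⊆ range fun p => P (φ p) := by
  obtain ⟨hb, q₀, hq₀, rfl⟩ := hΩ
  rintro _ ⟨q, hq, rfl⟩
  have hqP := connectedComponentIn_subset _ _ hq
  rw [connectedComponentIn_eq hq] at hb
  obtain ⟨ι, hι, hιc, hPι, hιP⟩ := hP c
  set L : E2 ≃ₗᵢ[ℝ] ℂ := Complex.orthonormalBasisOneI.repr.symm
  set ζ : E3 →L[ℝ] ℂ := (L : E2 →L[ℝ] ℂ) ∘L P with hζ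
  have hζL : ∀ v, ζ v = L (P v) := fun v => rfl
  have hinjP : ∀ u ∈ heightPlane a c, ∀ v ∈ heightPlane a c, ζ u = ζ v → u = v :=
    fun u hu v hv huv => by
      rw [hζL, hζL] at huv
      rw [← hιP u hu, ← hιP v hv, L.injective huv]
  have hγm : ∀ t, γ t ∈ heightPlane a c := fun t => hplane (mem_range_self t)
  have hγd : ∀ t, HasDerivAt γ (deriv γ t) t := fun t =>
    ((hγ.smooth.differentiable (by simp)) t).hasDerivAt
  -- the velocity is parallel to the plane, so the projection does not annihilate it
  have hγ0 : ∀ t, deriv γ t ∈ heightPlane a 0 := fun t => by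
    have h1 := (hγd t).inner ℝ (hasDerivAt_const t a)
    have h2 : (fun t => ⟪γ t, a⟫) = fun _ => c := funext hγm
    rw [h2] at h1
    have h3 := h1.unique (hasDerivAt_const t c)
    simpa [heightPlane] using h3
  have hJ : IsJordanCurve fun t => ζ (γ t) := by
    refine ⟨ζ.contDiff.comp (hγ.smooth.of_le (by norm_cast)), fun t => ?_, fun t h => ?_, ?_⟩
    · beta_reduce
      rw [hγ.periodic]
    · have h1 : deriv (fun t => ζ (γ t)) t = ζ (deriv γ t) :=
        (ζ.hasFDerivAt.comp_hasDerivAt t (hγd t)).deriv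
      rw [h1, hζL, LinearIsometryEquiv.map_eq_zero_iff] at h
      obtain ⟨ι', -, -, -, hι'⟩ := hP 0
      have h0 : (0 : E3) ∈ heightPlane a 0 := inner_zero_left _
      refine hγ.deriv_ne_zero t ?_
      rw [← hι' _ (hγ0 t), h, ← map_zero P, hι' _ h0]
    · intro s hs t ht hst
      exact hinj hs ht (hinjP _ (hγm s) _ (hγm t) hst)
  by_contra hw
  have hw' : ∀ p, ζ (φ p) ≠ ζ q := fun p hp => hw ⟨p, L.injective hp⟩
  refine hJ.cauchyIntegral_im_ne_zero (q := ζ q) ?_ ?_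
    (cauchyIntegral_im_eq_zero hN hφ hγ hbd hw')
  · rintro ⟨t, ht⟩
    exact hqP.2 ⟨t, hinjP _ (hγm t) _ hqP.1 ht⟩
  · -- the component of `ζ q` lifts into the component of `q`
    set K := connectedComponentIn (range fun t => ζ (γ t))ᶜ (ζ q)
    have hζι : ∀ z, ζ (ι (L.symm z)) = z := fun z => by
      rw [hζL, hPι, LinearIsometryEquiv.apply_symm_apply]
    have hqm : ζ q ∈ (range fun t => ζ (γ t))ᶜ := by
      rintro ⟨t, ht⟩
      exact hqP.2 ⟨t, hinjP _ (hγm t) _ hqP.1 ht⟩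
    have hlift : (fun z => ι (L.symm z)) '' K ⊆
        connectedComponentIn (heightPlane a c \ range γ) q := by
      refine IsPreconnected.subset_connectedComponentIn
        (isPreconnected_connectedComponentIn.image _
          (hι.continuous.comp L.symm.continuous).continuousOn)
        ⟨ζ q, mem_connectedComponentIn hqm, ?_⟩ ?_
      · beta_reduce
        rw [hζL, LinearIsometryEquiv.symm_apply_apply, hιP q hqP.1]
      · rintro _ ⟨z, hz, rfl⟩
        refine ⟨hιc _, ?_⟩
        rintro ⟨t, ht⟩
        refine connectedComponentIn_subset _ _ hz ⟨t, ?_⟩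
        beta_reduce
        rw [ht, hζι]
    have hK : K ⊆ ζ '' connectedComponentIn (heightPlane a c \ range γ) q := fun z hz =>
      ⟨_, hlift ⟨z, hz, rfl⟩, hζι z⟩
    exact (ζ.lipschitz.isBounded_image hb).subset hK

end Covering

theorem proposition3p1 (α : ℝ) (hα : 1 ≤ α) (a : E3) (ha : ‖a‖ = 1)
    (γ : ℝ → E3) (hγ : IsClosedCurve γ)
    {M : Type*} [TopologicalSpace M] [T2Space M] [CompactSpace M]
    [ChartedSpace (EuclideanHalfSpace 2) M] [IsManifold (𝓡∂ 2) ∞ M]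
    [MeasurableSpace M] [BorelSpace M]
    (φ : M → E3) (hφ : IsSingularMinimal α a φ) (hbd : HasBoundaryCurve φ γ) :
    surfaceArea φ ≤ ENNReal.ofReal (curveLength γ * sSup ((fun q => ⟪q, a⟫) '' range γ)) ∧
    ∀ c : ℝ, InjOn γ (Ico 0 1) → range γ ⊆ heightPlane a c →
      ∀ Ω : Set E3, IsDomainBoundedBy (heightPlane a c) (range γ) Ω →
        μHE[2] Ω ≤ ENNReal.ofReal (c * curveLength γ) := by
  constructor
  · have hcomp : IsCompact (range γ) := by
      rw [← hγ.periodic.image_Icc one_pos 0]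
      exact isCompact_Icc.image hγ.smooth.continuous
    have hbdd : BddAbove ((fun q => ⟪q, a⟫) '' range γ) :=
      (hcomp.image (continuous_id.inner continuous_const)).bddAbove
    exact surfaceArea_le hα ha hγ hφ hbd fun t => le_csSup hbdd ⟨γ t, mem_range_self t, rfl⟩
  · intro c hinj hplane Ω hΩ
    obtain ⟨N, hN, -⟩ := hφ.equation
    obtain ⟨P, hPdet, hP⟩ := exists_planeCoord ha
    obtain ⟨ι, hι, -, -, hιP⟩ := hP c
    have hΩP : Ω ⊆ ι '' (P '' Ω) := by
      intro q hq
      obtain ⟨-, q₀, -, rfl⟩ := hΩ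
      exact ⟨P q, ⟨q, hq, rfl⟩, hιP q (connectedComponentIn_subset _ _ hq).1⟩
    calc μHE[2] Ω ≤ μHE[2] (ι '' (P '' Ω)) := measure_mono hΩP
      _ = volume (P '' Ω) := by
        rw [hι.euclideanHausdorffMeasure_image,
          EuclideanSpace.euclideanHausdorffMeasure_eq_volume]
      _ ≤ volume (range fun p => P (φ p)) :=
        measure_mono (hΩ.image_subset hN hφ.immersion hγ hbd hinj hplane hP)
      _ ≤ surfaceArea φ := volume_image_le_surfaceArea hN hφ.immersion hPdet
      _ ≤ ENNReal.ofReal (curveLength γ * c) :=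
        surfaceArea_le hα ha hγ hφ hbd fun t => le_of_eq (hplane (mem_range_self t))
      _ = ENNReal.ofReal (c * curveLength γ) := by rw [mul_comm]
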